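/- Let $N\ge 2$, let $B_r\subset\mathbb R^N$ be the ball of radius $r$ about $0$, $\mathcal S^{N-1}=\partial B_1$ with surface measure $\sigma$, and $A_{1,R}=B_1\setminus B_R$ for $0<R<1$. For a map $u$ from $\mathcal S^{N-1}$ to a metric space $(Y,d)$ and $0<s<1$ put $$\lfloor u\rfloor_{s}^2=\int_{\mathcal S^{N-1}\times\mathcal S^{N-1}}\frac{d(u(x),u(y))^2}{|x-y|^{N-1+2s}}\,d\sigma(x)\,d\sigma(y),$$ and let $W^{s,2}(\mathcal S^{N-1})$ be the space of $u\in L^2(\mathcal S^{N-1},\mathbb R)$ with $\lfloor u\rfloor_s<\infty$. Let $\mathcal A_Q(\mathbb R^n)$ be the space of unordered $Q$-tuples $\sum_{i=1}^Q[\![t_i]\!]$ of points of $\mathbb R^n$ with the metric $\mathcal G(S,T)=\min_{\pi}\big(\sum_i|s_i-t_{\pi(i)}|^2\big)^{1/2}$, $\pi$ running over the permutations of $\{1,\dots,Q\}$. A measurable map $w:\Omega\to\mathcal A_Q(\mathbb R^n)$ on an open set $\Omega\subset\mathbb R^N$ belongs to $W^{1,2}(\Omega,\mathcal A_Q(\mathbb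 R^n))$ if $\mathcal G(w,T)\in W^{1,2}(\Omega)$ for every $T$ and there are $\varphi_1,\dots,\varphi_N\in L^2(\Omega)$ with $|D_j\mathcal G(w,T)|\le\varphi_j$ a.e. for every $j$ and every $T$; $|D_jw|$ denotes the smallest such $\varphi_j$, and $|Dw|^2=\sum_j|D_jw|^2$. The space $W^{1,2}(\mathcal S^{N-1},\mathcal A_Q(\mathbb R^n))$ and $|D_\tau u|$ are defined in the same way from the components in $\mathbb R^N$ of the weak tangential gradients of the functions $\mathcal G(u,T)$. For $\frac12<s<1$, $W^{s,2}(\mathcal S^{N-1},\mathcal A_Q(\mathbb R^n))$ is the set of $u\in L^2(\mathcal S^{N-1},\mathcal A_Q(\mathbb R^n))$ with $\lfloor u\rfloor_s<\infty$ (where $d=\mathcal G$); for $s=1$ it is $W^{1,2}(\mathcal S^{N-1},\mathcal A_Q(\mathbb R^n))$, and $\lfloor u\rfloor_1^2=\int_{\mathcal S^{N-1}}|D_\tau u|^2$. Boundary values of $W^{1,2}$ functions on $A_{1,R}$ are taken in the sense of traces; in the $Q$-valued case $u$ is the trace of $w$ if $\mathcal G(u,T)$ is the trace of $\mathcal G(w,T)$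 for every $T\in\mathcal A_Q(\mathbb R^n)$. (i) Let $\frac12<s<1$ and $\epsilon>0$. There is $R_\epsilon\in(0,1)$, depending only on $N,s,\epsilon$, such that for every $R\in[R_\epsilon,1)$ there is a constant $C$, depending only on $N,s,\epsilon,R$, with the following property: for all $u,v\in W^{s,2}(\mathcal S^{N-1})$ there is $w\in W^{1,2}(A_{1,R})$ with $w(x)=u(x)$ and $w(Rx)=v(x)$ for $x\in\mathcal S^{N-1}$ and $$\int_{A_{1,R}}|Dw|^2\le\epsilon\left(\lfloor u\rfloor_s^2+\lfloor v\rfloor_s^2\right)+C\,\|u-v\|_{L^2(\mathcal S^{N-1})}^2 .$$ (ii) Let $Q,n$ be natural numbers, $\frac12<s\le1$ and $\epsilon>0$. There is $R_\epsilon\in(0,1)$, depending only on $N,Q,n,s,\epsilon$, such that for every $R\in[R_\epsilon,1)$ there is a constant $C$, depending only on $N,Q,n,s,\epsilon,R$, with the following property: for all $u,v\in W^{s,2}(\mathcal S^{N-1},\mathcal A_Q(\mathbb R^n))$ there is $w\in W^{1,2}(A_{1,R},\mathcal A_Q(\mathbb R^n))$ with $w(x)=u(x)$ and $w(Rx)=v(x)$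 for $x\in\mathcal S^{N-1}$ and $$\int_{A_{1,R}}|Dw|^2\le\epsilon\left(\lfloor u\rfloor_s^2+\lfloor v\rfloor_s^2\right)+C\,\|\mathcal G(u,v)\|_{L^2(\mathcal S^{N-1})}^2 .$$ -/

import Mathlib

open MeasureTheory Set Filter
open scoped ENNReal

noncomputable section

/-- `ℝ^N` with the Euclidean norm. -/
abbrev Euc (N : ℕ) : Type := EuclideanSpace ℝ (Fin N)

/-- The unit sphere `S^{N-1}` of `ℝ^N`, with the Euclidean (chordal) distance. -/
abbrev USphere (N : ℕ) : Type := Metric.sphere (0 : Euc N) 1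

/-- The surface measure of `S^{N-1}`. -/
abbrev sphMeas (N : ℕ) : Measure (USphere N) := (volume : Measure (Euc N)).toSphere

/-- The `j`-th vector of the standard basis of `ℝ^N`. -/
abbrev stdVec {N : ℕ} (j : Fin N) : Euc N := EuclideanSpace.single j (1 : ℝ)

/-! ### The space of unordered `Q`-tuples -/

/-- Two `Q`-tuples are equivalent when one is a rearrangement of the other. -/
def tupleSetoid (Q n : ℕ) : Setoid (Fin Q → Euc n) where
  r s t := ∃ σ : Equiv.Perm (Fin Q), t = s ∘ σ
  iseqv :=
    { refl := fun s => ⟨1, rfl⟩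
      symm := by
        rintro s t ⟨σ, rfl⟩
        exact ⟨σ⁻¹, by funext i; simp⟩
      trans := by
        rintro s t u ⟨σ, rfl⟩ ⟨τ, rfl⟩
        exact ⟨σ * τ, by funext i; simp⟩ }

/-- `A_Q(ℝ^n)`, the set of unordered `Q`-tuples of points of `ℝ^n`. -/
def AQ (Q n : ℕ) : Type := Quotient (tupleSetoid Q n)

/-- `G(s, t) = min_σ (∑ᵢ |sᵢ - t_{σ(i)}|²)^{1/2}` for ordered tuples. -/
def tupleG {Q n : ℕ} (s t : Fin Q → Euc n) : ℝ :=
  ⨅ σ : Equiv.Perm (Fin Q), √(∑ i, ‖s i - t (σ i)‖ ^ 2)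

namespace AQ

variable {Q n : ℕ}

/-- The unordered tuple `∑ᵢ ⟦tᵢ⟧`. -/
def mk (t : Fin Q → Euc n) : AQ Q n := Quotient.mk (tupleSetoid Q n) t

theorem tupleG_le (s t : Fin Q → Euc n) (σ : Equiv.Perm (Fin Q)) :
    tupleG s t ≤ √(∑ i, ‖s i - t (σ i)‖ ^ 2) :=
  ciInf_le (Set.finite_range _).bddBelow σ

theorem tupleG_attained (s t : Fin Q → Euc n) :
    ∃ σ : Equiv.Perm (Fin Q), √(∑ i, ‖s i - t (σ i)‖ ^ 2) = tupleG s t :=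
  exists_eq_ciInf_of_finite

theorem tupleG_perm (s t : Fin Q → Euc n) (σ τ : Equiv.Perm (Fin Q)) :
    tupleG (s ∘ σ) (t ∘ τ) = tupleG s t := by
  apply le_antisymm
  · obtain ⟨ρ, hρ⟩ := tupleG_attained s t
    rw [← hρ]
    refine (tupleG_le _ _ (τ⁻¹ * ρ * σ)).trans (le_of_eq ?_)
    congr 1
    rw [← Equiv.sum_comp σ (fun i => ‖s i - t (ρ i)‖ ^ 2)]
    simp
  · obtain ⟨ρ, hρ⟩ := tupleG_attained (s ∘ σ) (t ∘ τ)
    rw [← hρ]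
    refine (tupleG_le _ _ (τ * ρ * σ⁻¹)).trans (le_of_eq ?_)
    congr 1
    rw [← Equiv.sum_comp σ (fun i => ‖s i - t ((τ * ρ * σ⁻¹) i)‖ ^ 2)]
    simp

theorem tupleG_comm_le (s t : Fin Q → Euc n) : tupleG s t ≤ tupleG t s := by
  obtain ⟨ρ, hρ⟩ := tupleG_attained t s
  rw [← hρ]
  refine (tupleG_le _ _ ρ⁻¹).trans (le_of_eq ?_)
  congr 1
  rw [← Equiv.sum_comp ρ (fun i => ‖s i - t (ρ⁻¹ i)‖ ^ 2)]
  simp [norm_sub_rev]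

theorem tupleG_triangle (s t u : Fin Q → Euc n) :
    tupleG s u ≤ tupleG s t + tupleG t u := by
  obtain ⟨σ, hσ⟩ := tupleG_attained s t
  obtain ⟨τ, hτ⟩ := tupleG_attained t u
  rw [← hσ, ← hτ, ← Equiv.sum_comp σ (fun i => ‖t i - u (τ i)‖ ^ 2)]
  refine (tupleG_le s u (τ * σ)).trans ?_
  have h := dist_triangle (WithLp.toLp 2 s : PiLp 2 fun _ : Fin Q => Euc n)
    (WithLp.toLp 2 (t ∘ σ)) (WithLp.toLp 2 (u ∘ τ ∘ σ))
  rw [PiLp.dist_eq_of_L2, PiLp.dist_eq_of_L2, PiLp.dist_eq_of_L2] at h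
  simpa [dist_eq_norm] using h

/-- The metric `G` of `A_Q(ℝ^n)`. -/
def G : AQ Q n → AQ Q n → ℝ :=
  Quotient.lift₂ (s₁ := tupleSetoid Q n) (s₂ := tupleSetoid Q n) tupleG (by
    rintro s t _ _ ⟨σ, rfl⟩ ⟨τ, rfl⟩
    exact (tupleG_perm s t σ τ).symm)

instance : MetricSpace (AQ Q n) where
  dist := G
  dist_self := by
    rintro ⟨s⟩
    refine le_antisymm ((tupleG_le s s 1).trans (by simp)) ?_
    exact Real.iInf_nonneg fun _ => Real.sqrt_nonneg _
  dist_comm := by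
    rintro ⟨s⟩ ⟨t⟩
    exact le_antisymm (tupleG_comm_le s t) (tupleG_comm_le t s)
  dist_triangle := by
    rintro ⟨s⟩ ⟨t⟩ ⟨u⟩
    exact tupleG_triangle s t u
  eq_of_dist_eq_zero := by
    rintro ⟨s⟩ ⟨t⟩ h
    obtain ⟨σ, hσ⟩ := tupleG_attained s t
    have h0 : √(∑ i, ‖s i - t (σ i)‖ ^ 2) = 0 := hσ.trans h
    rw [Real.sqrt_eq_zero (Finset.sum_nonneg fun _ _ => by positivity),
      Finset.sum_eq_zero_iff_of_nonneg fun _ _ => by positivity] at h0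
    refine Quotient.sound (s := tupleSetoid Q n) ⟨σ⁻¹, ?_⟩
    funext i
    have hi : ‖s (σ.symm i) - t (σ (σ.symm i))‖ ^ 2 = 0 := h0 (σ.symm i) (Finset.mem_univ _)
    rw [Equiv.apply_symm_apply, sq_eq_zero_iff, norm_eq_zero, sub_eq_zero] at hi
    exact hi.symm

theorem dist_mk (s t : Fin Q → Euc n) :
    dist (mk s) (mk t) = ⨅ σ : Equiv.Perm (Fin Q), √(∑ i, ‖s i - t (σ i)‖ ^ 2) := rfl

/-- The unordered tuple `Q ⟦0⟧`. -/
def zero (Q n : ℕ) : AQ Q n := mk fun _ => 0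

end AQ

/-! ### Functions on the sphere of fractional order -/

/-- The squared Gagliardo semi-norm
`⌊u⌋_s² = ∫∫ |u(x) - u(y)|² / |x - y|^{N-1+2s}` on `S^{N-1}`, for `u` with values in a metric
space, whose distance replaces `|u(x) - u(y)|`. -/
def gagliardoSq {N : ℕ} {Y : Type} [PseudoEMetricSpace Y] (s : ℝ) (u : USphere N → Y) : ℝ≥0∞ :=
  ∫⁻ p : USphere N × USphere N,
    edist (u p.1) (u p.2) ^ 2 / edist p.1 p.2 ^ ((N : ℝ) - 1 + 2 * s)
    ∂((sphMeas N).prod (sphMeas N))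

/-- The squared `L²(S^{N-1})` distance of `u` and `v`. -/
def sphDistSq {N : ℕ} {Y : Type} [PseudoEMetricSpace Y] (u v : USphere N → Y) : ℝ≥0∞ :=
  ∫⁻ x, edist (u x) (v x) ^ 2 ∂(sphMeas N)

/-- `u ∈ W^{s,2}(S^{N-1})`, for `0 < s < 1` and real-valued `u`. -/
def MemWs {N : ℕ} (s : ℝ) (u : USphere N → ℝ) : Prop :=
  MemLp u 2 (sphMeas N) ∧ gagliardoSq s u < ⊤

/-! ### Sobolev functions on open sets, and traces on the boundary of an annulus -/

/-- `w ∈ W^{1,2}(Ω)` is real-valued with weak gradient `g ∈ L²(Ω)`. -/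
structure IsW12 {N : ℕ} (Ω : Set (Euc N)) (w : Euc N → ℝ) (g : Fin N → Euc N → ℝ) : Prop where
  memLp : MemLp w 2 (volume.restrict Ω)
  memLp_grad : ∀ j, MemLp (g j) 2 (volume.restrict Ω)
  weak : ∀ j, ∀ φ : Euc N → ℝ, ContDiff ℝ (⊤ : ℕ∞) φ → HasCompactSupport φ → tsupport φ ⊆ Ω →
    ∫ x in Ω, w x * fderiv ℝ φ x (stdVec j) = -∫ x in Ω, g j x * φ x

/-- The open annulus `A_{1,R}`. -/
def annulus (N : ℕ) (R : ℝ) : Set (Euc N) := {x | R < ‖x‖ ∧ ‖x‖ < 1}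

/-- The function `w ∈ W^{1,2}(A_{1,R})` with weak gradient `g` has the trace `u` on the outer
sphere and the trace `v`, pulled back by `x ↦ R x`, on the inner sphere. The trace is
the unique `L²` function on the boundary for which the Gauss–Green formula
`∫_A w ∂ⱼφ + ∫_A (∂ⱼw) φ = ∫_{∂A} (tr w) φ νⱼ` holds; `ν` is `x` on the outer
sphere and `-x/R` on the inner one. -/
structure HasTraces {N : ℕ} (R : ℝ) (w : Euc N → ℝ) (g : Fin N → Euc N → ℝ)
    (u v : USphere N → ℝ) : Prop where
  memLp_outer : MemLp u 2 (sphMeas N)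
  memLp_inner : MemLp v 2 (sphMeas N)
  gauss_green : ∀ j, ∀ φ : Euc N → ℝ, ContDiff ℝ (⊤ : ℕ∞) φ → HasCompactSupport φ →
    (∫ x in annulus N R, w x * fderiv ℝ φ x (stdVec j)) + ∫ x in annulus N R, g j x * φ x
      = (∫ x, u x * φ (x : Euc N) * (x : Euc N) j ∂(sphMeas N))
        - R ^ (N - 1) * ∫ x, v x * φ (R • (x : Euc N)) * (x : Euc N) j ∂(sphMeas N)

/-! ### `Q`-valued Sobolev functions -/

/-- `w ∈ W^{1,2}(Ω, A_Q(ℝ^n))`, with bounds `φⱼ ∈ L²(Ω)`: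
`w` is measurable, `G(w, T) ∈ W^{1,2}(Ω)` and `|Dⱼ G(w, T)| ≤ φⱼ` a.e. for all `T`. -/
structure IsQW12 {N Q n : ℕ} (Ω : Set (Euc N)) (w : Euc N → AQ Q n)
    (φ : Fin N → Euc N → ℝ) : Prop where
  meas : AEStronglyMeasurable w (volume.restrict Ω)
  memLp : ∀ j, MemLp (φ j) 2 (volume.restrict Ω)
  bound : ∀ T : AQ Q n, ∃ g : Fin N → Euc N → ℝ, IsW12 Ω (fun x => dist (w x) T) g ∧
    ∀ j, ∀ᵐ x ∂(volume.restrict Ω), |g j x| ≤ φ j x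

/-- `w ∈ W^{1,2}(Ω, A_Q(ℝ^n))`. -/
def MemQW12 {N Q n : ℕ} (Ω : Set (Euc N)) (w : Euc N → AQ Q n) : Prop := ∃ φ, IsQW12 Ω w φ

/-- The Dirichlet energy `∫_Ω |Dw|² = ∫_Ω ∑ⱼ |Dⱼw|²`. As `|Dⱼw|` is the smallest of the bounds
`φⱼ` in `IsQW12`, this is the least value of `∫_Ω ∑ⱼ φⱼ²`. -/
def qEnergy {N Q n : ℕ} (Ω : Set (Euc N)) (w : Euc N → AQ Q n) : ℝ≥0∞ :=
  ⨅ (φ : Fin N → Euc N → ℝ) (_ : IsQW12 Ω w φ), ∫⁻ x in Ω, ∑ j, ‖φ j x‖ₑ ^ 2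

/-- The `Q`-valued `w ∈ W^{1,2}(A_{1,R}, A_Q(ℝ^n))` has the trace `u` on the outer sphere and the
trace `v`, pulled back by `x ↦ R x`, on the inner one: this means that `G(w, T)` has the traces
`G(u, T)` and `G(v, T)` for every `T`. -/
def HasQTraces {N Q n : ℕ} (R : ℝ) (w : Euc N → AQ Q n) (u v : USphere N → AQ Q n) : Prop :=
  ∀ T : AQ Q n, ∃ g : Fin N → Euc N → ℝ, IsW12 (annulus N R) (fun x => dist (w x) T) g ∧
    HasTraces R (fun x => dist (w x) T) g (fun x => dist (u x) T) (fun x => dist (v x) T)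

/-- `f ∈ W^{1,2}(S^{N-1})` is real-valued with weak tangential gradient `g ∈ L²`, the components
`g j` being taken in `ℝ^N`. The weak formulation is the integration by parts formula
`∫ f D_{τ,j}φ = -∫ g_j φ + (N-1) ∫ x_j f φ` on the sphere, where
`D_{τ,j}φ = ∂_jφ - x_j (x · Dφ)`. -/
structure IsSphW12 {N : ℕ} (f : USphere N → ℝ) (g : Fin N → USphere N → ℝ) : Prop where
  memLp : MemLp f 2 (sphMeas N)
  memLp_grad : ∀ j, MemLp (g j) 2 (sphMeas N)
  weak : ∀ j, ∀ φ : Euc N → ℝ, ContDiff ℝ (⊤ : ℕ∞) φ → HasCompactSupport φ →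
    ∫ x, f x * fderiv ℝ φ (x : Euc N) (stdVec j - (x : Euc N) j • (x : Euc N)) ∂(sphMeas N)
      = -(∫ x, g j x * φ (x : Euc N) ∂(sphMeas N))
        + ((N : ℝ) - 1) * ∫ x, (x : Euc N) j * f x * φ (x : Euc N) ∂(sphMeas N)

/-- `u ∈ W^{1,2}(S^{N-1}, A_Q(ℝ^n))`, with bounds `φⱼ ∈ L²` for the `j`-th components of the
tangential gradients of the functions `G(u, T)`. -/
structure IsSphQW12 {N Q n : ℕ} (u : USphere N → AQ Q n) (φ : Fin N → USphere N → ℝ) :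
    Prop where
  meas : AEStronglyMeasurable u (sphMeas N)
  memLp : ∀ j, MemLp (φ j) 2 (sphMeas N)
  bound : ∀ T : AQ Q n, ∃ g : Fin N → USphere N → ℝ, IsSphW12 (fun x => dist (u x) T) g ∧
    ∀ j, ∀ᵐ x ∂(sphMeas N), |g j x| ≤ φ j x

/-- The tangential Dirichlet energy `∫_{S^{N-1}} |D_τ u|²` of a `Q`-valued function. -/
def sphQEnergy {N Q n : ℕ} (u : USphere N → AQ Q n) : ℝ≥0∞ :=
  ⨅ (φ : Fin N → USphere N → ℝ) (_ : IsSphQW12 u φ), ∫⁻ x, ∑ j, ‖φ j x‖ₑ ^ 2 ∂(sphMeas N)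

/-- `⌊u⌋_s²` for `Q`-valued `u` on `S^{N-1}` and `0 < s ≤ 1`: the Gagliardo semi-norm for `s < 1`,
and the tangential Dirichlet energy for `s = 1`. -/
def qSeminormSq {N Q n : ℕ} (s : ℝ) (u : USphere N → AQ Q n) : ℝ≥0∞ :=
  if s < 1 then gagliardoSq s u else sphQEnergy u

/-- `u ∈ W^{s,2}(S^{N-1}, A_Q(ℝ^n))` for `0 < s ≤ 1`. -/
def MemQWs {N Q n : ℕ} (s : ℝ) (u : USphere N → AQ Q n) : Prop :=
  AEStronglyMeasurable u (sphMeas N) ∧ sphDistSq u (fun _ => AQ.zero Q n) < ⊤ ∧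
    qSeminormSq s u < ⊤

end

/-! Let U be the map on the annulus that equals u(x/|x|) in the outer half and v(x/|x|) in the inner
half, and let t be the distance to the boundary. U has the right boundary values, but it jumps
across the middle sphere and need not have a gradient. It is therefore smoothed at scale t. The
annulus is covered by Whitney balls of radius comparable to t, on each ball a value of U close to U
in mean square is selected, and these values are interpolated by a locally Lipschitz map w
(`exists_whitney_approximation`).

Unordered tuples cannot be averaged, so a partition of unity is not available. The only property of
the target that is used is `ConeContractible`. The balls are coloured so that doubled balls of one
colour are disjoint, and the colours are treated one after the other: in each ball of the current
colour the map built so far is coned off (`IsGluing.exists_succ`). The real line contracts along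
segments. In the space of tuples, a set of diameter D is either contracted by a homothety, when the
points of a reference tuple spread by at most a multiple of D, or it splits consistently into two
well separated groups, and induction on Q applies (`AQ.coneContractible`).

Near x the map w has Lipschitz constant at most a multiple of osc(U)/t, where osc is a mean
oscillation over the ball of radius t/4. By Fubini the energy of w is bounded by the double integral
E(U) of t(z)^(-N-2) d(U(z),U(z'))² over |z-z'| < 2t(z)/3 (`whitneyEnergy`). Three estimates of E
finish the energy bound. For a homogeneous map u(x/|x|) and s < 1, polar coordinates bound E by the
Gagliardo semi-norm times the integral of t^(2s-2) across the annulus, which is of order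
(1-R)^(2s-1) (`whitneyEnergy_le_gagliardoSq`). For s = 1, E is at most a constant times (1-R) times
the tangential energy (`whitneyEnergy_le_sphQEnergy`). Since s > 1/2, both factors tend to 0 as R
tends to 1, and this produces ε. The jump is seen only from points with t at least (1-R)/10, so it
costs a constant depending on R times the squared L² distance of u and v
(`whitneyEnergy_annMap_le`).

For the traces, the same double integral shows that d(w,U)/t is square integrable. Radial cut-offs
with derivative of order 1/t may then be removed in the integration by parts, with U in place of w
near the boundary, and this gives the Gauss-Green formula (`gauss_green_annulus`). All of this is
done for ψ(w) with ψ an arbitrary 1-Lipschitz function: ψ is the identity in the real case and the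
distance to T in the case of tuples. -/

/-! ### Lipschitz contractions of bounded sets, on the line and in the space of tuples -/

/-- Every bounded subset of `Y` can be contracted to a point, inside `Y`, by a homotopy which is
Lipschitz with a constant controlled by the diameter of the subset. -/
def ConeContractible (Y : Type) [PseudoMetricSpace Y] : Prop :=
  ∃ C : ℝ, 0 ≤ C ∧ ∀ Z : Set Y, Z.Nonempty → ∀ D : ℝ, 0 ≤ D →
    (∀ z ∈ Z, ∀ z' ∈ Z, dist z z' ≤ D) →
    ∃ (H : Y → ℝ → Y) (q : Y), (∀ z ∈ Z, H z 1 = z) ∧ (∀ z ∈ Z, H z 0 = q) ∧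
      ∀ z ∈ Z, ∀ z' ∈ Z, ∀ t ∈ Icc (0 : ℝ) 1, ∀ t' ∈ Icc (0 : ℝ) 1,
        dist (H z t) (H z' t') ≤ C * (D * |t - t'| + dist z z')

/-- Contraction along segments to a point a of Z; as |z' - a| ≤ D, moving t to t' costs at most D|t
- t'|. -/
theorem coneContractible_real : ConeContractible ℝ := by
  refine ⟨1, zero_le_one, fun Z ⟨a, ha⟩ D hD hZ => ⟨fun z t => a + t * (z - a), a, ?_, ?_, ?_⟩⟩
  · intro z _; ring
  · intro z _; ring
  · intro z hz z' hz' t ht t' ht'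
    have h1 : |z' - a| ≤ D := hZ z' hz' a ha
    rw [Real.dist_eq, Real.dist_eq]
    have : a + t * (z - a) - (a + t' * (z' - a)) = (t - t') * (z' - a) + t * (z - z') := by ring
    rw [this]
    refine (abs_add_le _ _).trans ?_
    rw [abs_mul, abs_mul, abs_of_nonneg ht.1]
    nlinarith [mul_le_mul_of_nonneg_left h1 (abs_nonneg (t - t')),
      mul_le_mul_of_nonneg_right ht.2 (abs_nonneg (z - z'))]

namespace AQ

variable {Q n : ℕ}

theorem mk_comp_perm (s : Fin Q → Euc n) (σ : Equiv.Perm (Fin Q)) : mk (s ∘ σ) = mk s :=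
  (Quotient.sound (s := tupleSetoid Q n) ⟨σ, rfl⟩).symm

theorem exists_mk_eq (z : AQ Q n) : ∃ s, mk s = z := Quotient.exists_rep z

theorem dist_mk_le (s t : Fin Q → Euc n) (σ : Equiv.Perm (Fin Q)) :
    dist (mk s) (mk t) ≤ √(∑ i, ‖s i - t (σ i)‖ ^ 2) := tupleG_le s t σ

theorem exists_dist_mk_eq (s t : Fin Q → Euc n) :
    ∃ σ : Equiv.Perm (Fin Q), √(∑ i, ‖s i - t (σ i)‖ ^ 2) = dist (mk s) (mk t) :=
  tupleG_attained s t

theorem norm_le_sqrt_sum (f : Fin Q → Euc n) (i : Fin Q) : ‖f i‖ ≤ √(∑ i, ‖f i‖ ^ 2) :=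
  Real.le_sqrt_of_sq_le
    (Finset.single_le_sum (f := fun i => ‖f i‖ ^ 2) (fun _ _ => by positivity)
      (Finset.mem_univ i))

theorem exists_aligned (T : Fin Q → Euc n) (z : AQ Q n) {D : ℝ} (h : dist (mk T) z ≤ D) :
    ∃ s, mk s = z ∧ ∀ i, ‖s i - T i‖ ≤ D := by
  obtain ⟨s, rfl⟩ := exists_mk_eq z
  obtain ⟨σ, hσ⟩ := exists_dist_mk_eq T s
  refine ⟨s ∘ σ, mk_comp_perm s σ, fun i => ?_⟩
  rw [norm_sub_rev]
  exact (norm_le_sqrt_sum (fun i => T i - s (σ i)) i).trans (hσ.le.trans h)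

/-- The homothety with ratio `t` and centre `c`, acting on tuples. -/
noncomputable def homothety (c : Euc n) (t : ℝ) : AQ Q n → AQ Q n :=
  Quotient.map' (s₁ := tupleSetoid Q n) (s₂ := tupleSetoid Q n)
    (fun s i => c + t • (s i - c)) (by
      rintro s _ ⟨σ, rfl⟩
      exact ⟨σ, rfl⟩)

theorem homothety_mk (c : Euc n) (t : ℝ) (s : Fin Q → Euc n) :
    homothety c t (mk s) = mk fun i => c + t • (s i - c) := rfl

theorem dist_homothety_le (c : Euc n) {t : ℝ} (ht : 0 ≤ t) (z z' : AQ Q n) :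
    dist (homothety c t z) (homothety c t z') ≤ t * dist z z' := by
  obtain ⟨s, rfl⟩ := exists_mk_eq z
  obtain ⟨s', rfl⟩ := exists_mk_eq z'
  obtain ⟨σ, hσ⟩ := exists_dist_mk_eq s s'
  rw [← hσ, homothety_mk, homothety_mk]
  refine (dist_mk_le _ _ σ).trans (le_of_eq ?_)
  have : ∀ i, ‖c + t • (s i - c) - (c + t • (s' (σ i) - c))‖ ^ 2
      = t ^ 2 * ‖s i - s' (σ i)‖ ^ 2 := by
    intro i
    rw [show c + t • (s i - c) - (c + t • (s' (σ i) - c)) = t • (s i - s' (σ i)) by module,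
      norm_smul, mul_pow, Real.norm_eq_abs, sq_abs]
  rw [Finset.sum_congr rfl fun i _ => this i, ← Finset.mul_sum, Real.sqrt_mul (sq_nonneg t),
    Real.sqrt_sq ht]

theorem dist_homothety_homothety_le (c : Euc n) (t t' : ℝ) (s : Fin Q → Euc n) {b : ℝ}
    (hb : 0 ≤ b) (h : ∀ i, ‖s i - c‖ ≤ b) :
    dist (homothety c t (mk s)) (homothety c t' (mk s)) ≤ Q * b * |t - t'| := by
  rw [homothety_mk, homothety_mk]
  refine (dist_mk_le _ _ 1).trans (Real.sqrt_le_iff.2 ⟨by positivity, ?_⟩)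
  have : ∀ i, ‖c + t • (s i - c) - (c + t' • (s ((1 : Equiv.Perm (Fin Q)) i) - c))‖ ^ 2
      ≤ (b * |t - t'|) ^ 2 := by
    intro i
    rw [Equiv.Perm.one_apply,
      show c + t • (s i - c) - (c + t' • (s i - c)) = (t - t') • (s i - c) by module,
      norm_smul, Real.norm_eq_abs, mul_comm]
    gcongr
    exact h i
  refine (Finset.sum_le_sum fun i _ => this i).trans ?_
  rw [Finset.sum_const, Finset.card_univ, Fintype.card_fin, nsmul_eq_mul]
  have hQ : (Q : ℝ) ≤ (Q : ℝ) ^ 2 := by exact_mod_cast Nat.le_self_pow two_ne_zero Q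
  nlinarith [mul_le_mul_of_nonneg_right hQ (sq_nonneg (b * |t - t'|))]

/-- The union of two unordered tuples. -/
noncomputable def join {k l : ℕ} (e : Fin k ⊕ Fin l ≃ Fin Q) : AQ k n → AQ l n → AQ Q n :=
  Quotient.map₂ (sa := tupleSetoid k n) (sb := tupleSetoid l n) (sc := tupleSetoid Q n)
    (fun a b i => Sum.elim a b (e.symm i)) (by
      rintro a _ ⟨σ, rfl⟩ b _ ⟨τ, rfl⟩
      refine ⟨(e.symm.trans (Equiv.sumCongr σ τ)).trans e, ?_⟩
      funext i
      obtain ⟨j, rfl⟩ := e.surjective i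
      rcases j with j | j <;> simp)

theorem join_mk {k l : ℕ} (e : Fin k ⊕ Fin l ≃ Fin Q) (a : Fin k → Euc n) (b : Fin l → Euc n) :
    join e (mk a) (mk b) = mk fun i => Sum.elim a b (e.symm i) := rfl

theorem join_mk_mk {k l : ℕ} (e : Fin k ⊕ Fin l ≃ Fin Q) (s : Fin Q → Euc n) :
    join e (mk fun a => s (e (Sum.inl a))) (mk fun b => s (e (Sum.inr b))) = mk s := by
  rw [join_mk]
  congr 1
  funext i
  obtain ⟨j, rfl⟩ := e.surjective i
  rcases j with j | j <;> simp

theorem dist_join_le {k l : ℕ} (e : Fin k ⊕ Fin l ≃ Fin Q) (a a' : AQ k n) (b b' : AQ l n) :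
    dist (join e a b) (join e a' b') ≤ dist a a' + dist b b' := by
  obtain ⟨a, rfl⟩ := exists_mk_eq a
  obtain ⟨a', rfl⟩ := exists_mk_eq a'
  obtain ⟨b, rfl⟩ := exists_mk_eq b
  obtain ⟨b', rfl⟩ := exists_mk_eq b'
  obtain ⟨σ, hσ⟩ := exists_dist_mk_eq a a'
  obtain ⟨τ, hτ⟩ := exists_dist_mk_eq b b'
  rw [join_mk, join_mk, ← hσ, ← hτ]
  refine (dist_mk_le _ _ ((e.symm.trans (Equiv.sumCongr σ τ)).trans e)).trans ?_
  rw [← Equiv.sum_comp e, Fintype.sum_sum_type]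
  simp only [Equiv.symm_apply_apply, Equiv.trans_apply, Equiv.sumCongr_apply, Sum.map_inl,
    Sum.map_inr, Sum.elim_inl, Sum.elim_inr]
  refine Real.sqrt_le_iff.2 ⟨by positivity, ?_⟩
  rw [add_sq, Real.sq_sqrt (Finset.sum_nonneg fun _ _ => by positivity),
    Real.sq_sqrt (Finset.sum_nonneg fun _ _ => by positivity)]
  have : 0 ≤ 2 * √(∑ i, ‖a i - a' (σ i)‖ ^ 2) * √(∑ i, ‖b i - b' (τ i)‖ ^ 2) := by positivity
  linarith

/-- An optimal matching σ of s with s' satisfies |T i - T (σ i)| ≤ 3D, by three steps of length at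
most D. The two groups of T are more than 4D apart, so σ preserves them and restricts to matchings
of the parts. Hence splitting tuples close to T into groups does not increase distances. -/
theorem dist_parts_le {k l : ℕ} (e : Fin k ⊕ Fin l ≃ Fin Q) {D : ℝ} {T s s' : Fin Q → Euc n}
    (hT : ∀ a b, 4 * D < ‖T (e (Sum.inl a)) - T (e (Sum.inr b))‖)
    (hs : ∀ i, ‖s i - T i‖ ≤ D) (hs' : ∀ i, ‖s' i - T i‖ ≤ D) (h : dist (mk s) (mk s') ≤ D) :
    dist (mk fun a => s (e (Sum.inl a))) (mk fun a => s' (e (Sum.inl a))) ≤ dist (mk s) (mk s') ∧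
    dist (mk fun b => s (e (Sum.inr b))) (mk fun b => s' (e (Sum.inr b)))
      ≤ dist (mk s) (mk s') := by
  obtain ⟨σ, hσ⟩ := exists_dist_mk_eq s s'
  have hD : 0 ≤ D := dist_nonneg.trans h
  have hclose : ∀ i, ‖T i - T (σ i)‖ ≤ 3 * D := by
    intro i
    have h1 := (norm_le_sqrt_sum (fun i => s i - s' (σ i)) i).trans (hσ.le.trans h)
    have h2 := norm_add₃_le (a := T i - s i) (b := s i - s' (σ i)) (c := s' (σ i) - T (σ i))
    rw [show T i - s i + (s i - s' (σ i)) + (s' (σ i) - T (σ i)) = T i - T (σ i) by abel,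
      norm_sub_rev (T i) (s i)] at h2
    linarith [hs i, hs' (σ i)]
  have hmaps : MapsTo ((e.trans σ).trans e.symm) (range (Sum.inl : Fin k → Fin k ⊕ Fin l))
      (range Sum.inl) := by
    rintro _ ⟨a, rfl⟩
    rcases hc : ((e.trans σ).trans e.symm) (Sum.inl a) with a' | b
    · exact ⟨a', rfl⟩
    · exfalso
      have h1 : σ (e (Sum.inl a)) = e (Sum.inr b) := by
        rw [← hc]; simp
      have h2 := hclose (e (Sum.inl a))
      rw [h1] at h2
      linarith [hT a b]
  obtain ⟨⟨σ₁, σ₂⟩, h12⟩ := Equiv.Perm.mem_sumCongrHom_range_of_perm_mapsTo_inl hmaps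
  have hl : ∀ a, σ (e (Sum.inl a)) = e (Sum.inl (σ₁ a)) := by
    intro a
    have := congrArg (fun f => e (f (Sum.inl a))) h12
    simpa using this.symm
  have hr : ∀ b, σ (e (Sum.inr b)) = e (Sum.inr (σ₂ b)) := by
    intro b
    have := congrArg (fun f => e (f (Sum.inr b))) h12
    simpa using this.symm
  rw [← hσ, ← Equiv.sum_comp e, Fintype.sum_sum_type]
  simp only [hl, hr]
  exact ⟨(dist_mk_le _ _ σ₁).trans (Real.sqrt_le_sqrt (le_add_of_nonneg_right
      (Finset.sum_nonneg fun _ _ => by positivity))),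
    (dist_mk_le _ _ σ₂).trans (Real.sqrt_le_sqrt (le_add_of_nonneg_left
      (Finset.sum_nonneg fun _ _ => by positivity)))⟩

/-- A tuple with widely spread points splits into two well separated groups. -/
theorem exists_splitting {m : ℕ} (T : Fin (m + 1) → Euc n) {D : ℝ} (hD : 0 ≤ D)
    (j : Fin (m + 1)) (hj : 4 * (m + 1) * D < ‖T j - T 0‖) :
    ∃ k < m + 1, ∃ l < m + 1, ∃ e : Fin k ⊕ Fin l ≃ Fin (m + 1),
      ∀ a b, 4 * D < ‖T (e (Sum.inl a)) - T (e (Sum.inr b))‖ := by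
  classical
  -- Pigeonhole: of the m + 1 shells 4kD < |T i - T 0| ≤ 4(k+1)D around T 0, one contains no point.
  -- Otherwise choosing a point in each shell would be an injective, hence surjective, map of the
  -- indices, and some shell would contain T 0 itself, at distance 0. The empty shell is the gap
  -- between the groups.
  obtain ⟨k, hk⟩ : ∃ k : Fin (m + 1), ∀ i, ‖T i - T 0‖ ≤ 4 * k * D ∨
      4 * (k + 1) * D < ‖T i - T 0‖ := by
    by_contra! hcon
    choose f hf1 hf2 using hcon
    have hinj : Function.Injective f := by
      have key : ∀ a b : Fin (m + 1), a < b → f a ≠ f b := by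
        intro a b hab heq
        have h1 := hf2 a
        have h2 := hf1 b
        rw [← heq] at h2
        have h3 : (a : ℝ) + 1 ≤ b := by exact_mod_cast hab
        nlinarith [mul_le_mul_of_nonneg_right h3 hD]
      intro a b hab
      by_contra hne
      rcases lt_or_gt_of_ne hne with h | h
      · exact key a b h hab
      · exact key b a h hab.symm
    obtain ⟨a, ha⟩ := Finite.surjective_of_injective hinj 0
    have := hf1 a
    rw [ha, sub_self, norm_zero] at this
    have : 0 ≤ 4 * (a : ℝ) * D := by positivity
    linarith
  let p : Fin (m + 1) → Prop := fun i => ‖T i - T 0‖ ≤ 4 * k * D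
  have hp0 : p 0 := by
    simp only [p, sub_self, norm_zero]; positivity
  have hpj : ¬ p j := by
    have h3 : (k : ℝ) ≤ m + 1 := by exact_mod_cast k.is_lt.le
    simp only [p, not_le]
    nlinarith [mul_le_mul_of_nonneg_right h3 hD]
  refine ⟨Fintype.card {i // p i}, ?_, Fintype.card {i // ¬ p i}, ?_,
    (Equiv.sumCongr (Fintype.equivFin _).symm (Fintype.equivFin _).symm).trans
      (Equiv.sumCompl p), fun a b => ?_⟩
  · simpa using Fintype.card_subtype_lt (p := p) hpj
  · simpa using Fintype.card_subtype_lt (p := fun i => ¬ p i) (not_not.2 hp0)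
  · have ha : p ((Fintype.equivFin {i // p i}).symm a) := Subtype.prop _
    have hb : ¬ p ((Fintype.equivFin {i // ¬ p i}).symm b) :=
      ((Fintype.equivFin {i // ¬ p i}).symm b).prop
    simp only [Equiv.trans_apply, Equiv.sumCongr_apply, Sum.map_inl, Sum.map_inr,
      Equiv.sumCompl_apply_inl, Equiv.sumCompl_apply_inr]
    generalize ((Fintype.equivFin {i // p i}).symm a : Fin (m + 1)) = i at ha ⊢
    generalize ((Fintype.equivFin {i // ¬ p i}).symm b : Fin (m + 1)) = i' at hb ⊢
    have hb' := (hk i').resolve_left hb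
    have h1 := norm_sub_norm_le (T i' - T 0) (T i - T 0)
    rw [sub_sub_sub_cancel_right, norm_sub_rev (T i') (T i)] at h1
    have ha' : ‖T i - T 0‖ ≤ 4 * k * D := ha
    linarith

/-- Strong induction on Q. Fix a tuple T of Z. If its points spread by a large multiple of D, all
tuples of Z split along the same two groups, and the contractions of the two factors are joined.
Otherwise the homothety centred at T 0 moves every point by at most a multiple of D. -/
theorem coneContractible (Q n : ℕ) : ConeContractible (AQ Q n) := by
  induction Q using Nat.strong_induction_on with
  | _ Q ih =>
  rcases Q with _ | m
  · refine ⟨1, zero_le_one, fun Z ⟨a, ha⟩ D hD hZ => ⟨fun _ _ => a, a, ?_, ?_, ?_⟩⟩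
    · intro z _
      obtain ⟨s, rfl⟩ := exists_mk_eq z
      obtain ⟨s', rfl⟩ := exists_mk_eq a
      exact congrArg mk (Subsingleton.elim _ _)
    · intro _ _; rfl
    · intro z _ z' _ t _ t' _
      rw [dist_self]; positivity
  choose! C hC hH using ih
  have hsum : ∀ k < m + 1, C k ≤ ∑ i ∈ Finset.range (m + 1), C i := fun k hk =>
    Finset.single_le_sum (f := C) (fun i hi => hC i (Finset.mem_range.1 hi))
      (Finset.mem_range.2 hk)
  have hsum0 : 0 ≤ ∑ i ∈ Finset.range (m + 1), C i :=
    Finset.sum_nonneg fun i hi => hC i (Finset.mem_range.1 hi)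
  set S := ∑ i ∈ Finset.range (m + 1), C i
  -- In the homothety case all points of T lie within 4(m+1)D of T 0, hence those of any tuple of Z,
  -- aligned with T, within (4(m+1)+1)D; B is the constant that `dist_homothety_homothety_le` then
  -- gives.
  set B : ℝ := ((m + 1 : ℕ) : ℝ) * (4 * (m + 1) + 1)
  have hB : 0 ≤ B := by positivity
  refine ⟨B + 1 + 2 * S, by positivity, fun Z ⟨z₀, hz₀⟩ D hD hZ => ?_⟩
  obtain ⟨T, rfl⟩ := exists_mk_eq z₀
  by_cases hT : ∃ j, 4 * (m + 1) * D < ‖T j - T 0‖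
  · obtain ⟨j, hj⟩ := hT
    obtain ⟨k, hk, l, hl, e, he⟩ := exists_splitting T hD j hj
    -- Representatives are aligned with T, so the index splitting `e` has the same meaning for all
    -- of Z. Off Z the value T is a mere filler.
    have hal : ∀ z : AQ (m + 1) n, ∃ s : Fin (m + 1) → Euc n,
        z ∈ Z → mk s = z ∧ ∀ i, ‖s i - T i‖ ≤ D := by
      intro z
      by_cases hz : z ∈ Z
      · obtain ⟨s, hs⟩ := exists_aligned T z (hZ _ hz₀ z hz)
        exact ⟨s, fun _ => hs⟩
      · exact ⟨T, fun h => absurd h hz⟩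
    choose s hs using hal
    let f₁ : AQ (m + 1) n → AQ k n := fun z => mk fun a => s z (e (Sum.inl a))
    let f₂ : AQ (m + 1) n → AQ l n := fun z => mk fun b => s z (e (Sum.inr b))
    have hf : ∀ z ∈ Z, ∀ z' ∈ Z, dist (f₁ z) (f₁ z') ≤ dist z z' ∧
        dist (f₂ z) (f₂ z') ≤ dist z z' := by
      intro z hz z' hz'
      have := dist_parts_le e he (hs z hz).2 (hs z' hz').2
        (by rw [(hs z hz).1, (hs z' hz').1]; exact hZ z hz z' hz')
      rwa [(hs z hz).1, (hs z' hz').1] at this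
    obtain ⟨H₁, q₁, h11, h10, hL1⟩ := hH k hk (f₁ '' Z) ⟨_, mem_image_of_mem _ hz₀⟩ D hD (by
      rintro _ ⟨z, hz, rfl⟩ _ ⟨z', hz', rfl⟩
      exact (hf z hz z' hz').1.trans (hZ z hz z' hz'))
    obtain ⟨H₂, q₂, h21, h20, hL2⟩ := hH l hl (f₂ '' Z) ⟨_, mem_image_of_mem _ hz₀⟩ D hD (by
      rintro _ ⟨z, hz, rfl⟩ _ ⟨z', hz', rfl⟩
      exact (hf z hz z' hz').2.trans (hZ z hz z' hz'))
    refine ⟨fun z t => join e (H₁ (f₁ z) t) (H₂ (f₂ z) t), join e q₁ q₂, ?_, ?_, ?_⟩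
    · intro z hz
      change join e (H₁ (f₁ z) 1) (H₂ (f₂ z) 1) = z
      rw [h11 _ (mem_image_of_mem _ hz), h21 _ (mem_image_of_mem _ hz), join_mk_mk, (hs z hz).1]
    · intro z hz
      change join e (H₁ (f₁ z) 0) (H₂ (f₂ z) 0) = _
      rw [h10 _ (mem_image_of_mem _ hz), h20 _ (mem_image_of_mem _ hz)]
    · intro z hz z' hz' t ht t' ht'
      refine (dist_join_le e _ _ _ _).trans ?_
      have h1 := hL1 _ (mem_image_of_mem _ hz) _ (mem_image_of_mem _ hz') t ht t' ht'
      have h2 := hL2 _ (mem_image_of_mem _ hz) _ (mem_image_of_mem _ hz') t ht t' ht'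
      have hX : 0 ≤ D * |t - t'| + dist z z' := by positivity
      have h1' : dist (H₁ (f₁ z) t) (H₁ (f₁ z') t') ≤ S * (D * |t - t'| + dist z z') := by
        refine h1.trans (mul_le_mul (hsum k hk) ?_ (by positivity) hsum0)
        linarith [(hf z hz z' hz').1]
      have h2' : dist (H₂ (f₂ z) t) (H₂ (f₂ z') t') ≤ S * (D * |t - t'| + dist z z') := by
        refine h2.trans (mul_le_mul (hsum l hl) ?_ (by positivity) hsum0)
        linarith [(hf z hz z' hz').2]
      nlinarith [mul_nonneg hB hX]
  · push Not at hT
    refine ⟨fun z t => homothety (T 0) t z, mk fun _ => T 0, ?_, ?_, ?_⟩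
    · intro z _
      obtain ⟨s, rfl⟩ := exists_mk_eq z
      simp [homothety_mk]
    · intro z _
      obtain ⟨s, rfl⟩ := exists_mk_eq z
      simp [homothety_mk]
    · intro z hz z' hz' t ht t' ht'
      obtain ⟨s, rfl, hs⟩ := exists_aligned T z' (hZ _ hz₀ z' hz')
      have h1 := dist_homothety_le (T 0) ht.1 z (mk s)
      have h2 := dist_homothety_homothety_le (T 0) t t' s (b := (4 * (m + 1) + 1) * D)
        (by positivity) (fun i => by
          have := norm_add_le (s i - T i) (T i - T 0)
          rw [sub_add_sub_cancel] at this
          linarith [hs i, hT i])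
      refine (dist_triangle _ (homothety (T 0) t (mk s)) _).trans ((add_le_add h1 h2).trans ?_)
      have h3 : t * dist z (mk s) ≤ dist z (mk s) := mul_le_of_le_one_left dist_nonneg ht.2
      have h4 : ((m + 1 : ℕ) : ℝ) * ((4 * (m + 1) + 1) * D) * |t - t'| = B * (D * |t - t'|) := by
        simp only [B]; ring
      rw [h4]
      have hX : 0 ≤ D * |t - t'| := by positivity
      have hY : 0 ≤ dist z (mk s) := dist_nonneg
      nlinarith [mul_nonneg hB hY, mul_nonneg hsum0 hX, mul_nonneg hsum0 hY]

/-- Ordered tuples are separable and map continuously onto the unordered ones. Separability reduces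
statements about G(u,T) for all T, each valid almost everywhere, to countably many T. -/
instance : TopologicalSpace.SeparableSpace (AQ Q n) := by
  have hsurj : Function.Surjective (mk : (Fin Q → Euc n) → AQ Q n) := exists_mk_eq
  have hlip : Continuous (mk : (Fin Q → Euc n) → AQ Q n) := by
    refine LipschitzWith.continuous (K := Q) (LipschitzWith.of_dist_le_mul fun s t => ?_)
    refine (dist_mk_le s t 1).trans (Real.sqrt_le_iff.2 ⟨by positivity, ?_⟩)
    have : ∀ i, ‖s i - t ((1 : Equiv.Perm (Fin Q)) i)‖ ^ 2 ≤ dist s t ^ 2 := by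
      intro i
      rw [Equiv.Perm.one_apply, ← dist_eq_norm]
      gcongr
      exact dist_le_pi_dist s t i
    refine (Finset.sum_le_sum fun i _ => this i).trans ?_
    rw [Finset.sum_const, Finset.card_univ, Fintype.card_fin, nsmul_eq_mul]
    have hQ : (Q : ℝ) ≤ (Q : ℝ) ^ 2 := by exact_mod_cast Nat.le_self_pow two_ne_zero Q
    simp only [NNReal.coe_natCast]
    nlinarith [mul_le_mul_of_nonneg_right hQ (sq_nonneg (dist s t))]
  exact hsurj.denseRange.separableSpace hlip

end AQ

/-- Taking D to be the diameter makes the homotopy depend on Z alone. This matters in the gluing,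
where the map is built once but estimated at every centre and scale with different bounds D. For
unbounded Z no D is admissible and the homotopy is arbitrary. -/
theorem ConeContractible.exists_contraction {Y : Type} [PseudoMetricSpace Y]
    (hY : ConeContractible Y) :
    ∃ C : ℝ, 0 ≤ C ∧ ∀ Z : Set Y, Z.Nonempty → ∃ (H : Y → ℝ → Y) (q : Y), ∀ D : ℝ, 0 ≤ D →
      (∀ z ∈ Z, ∀ z' ∈ Z, dist z z' ≤ D) →
      (∀ z ∈ Z, H z 1 = z) ∧ (∀ z ∈ Z, H z 0 = q) ∧
        ∀ z ∈ Z, ∀ z' ∈ Z, ∀ t ∈ Icc (0 : ℝ) 1, ∀ t' ∈ Icc (0 : ℝ) 1,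
          dist (H z t) (H z' t') ≤ C * (D * |t - t'| + dist z z') := by
  obtain ⟨C, hC, h⟩ := hY
  refine ⟨C, hC, fun Z hZ => ?_⟩
  by_cases hb : Bornology.IsBounded Z
  · obtain ⟨H, q, h1, h0, hL⟩ := h Z hZ (Metric.diam Z) Metric.diam_nonneg
      fun z hz z' hz' => Metric.dist_le_diam_of_mem hb hz hz'
    refine ⟨H, q, fun D hD hZD => ⟨h1, h0, fun z hz z' hz' t ht t' ht' =>
      (hL z hz z' hz' t ht t' ht').trans ?_⟩⟩
    have := Metric.diam_le_of_forall_dist_le hD hZD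
    gcongr
  · obtain ⟨z, -⟩ := hZ
    refine ⟨fun z _ => z, z, fun D hD hZD => absurd ?_ hb⟩
    exact Metric.isBounded_iff.2 ⟨D, fun z hz z' hz' => hZD z hz z' hz'⟩

/-! ### Interpolation of values on balls, one colour at a time -/

section Gluing

variable {E Y ι : Type} [PseudoMetricSpace E] [PseudoMetricSpace Y]

/-- The union of the balls whose colour is less than `k`. -/
def colorUnion (x : ι → E) (r : ι → ℝ) (col : ι → ℕ) (k : ℕ) : Set E :=
  {y | ∃ i, col i < k ∧ dist y (x i) ≤ r i}

/-- The indices of the balls which, when doubled, meet the closed ball of radius `ρ` at `x₀`. -/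
def nearIndices (x : ι → E) (r : ι → ℝ) (x₀ : E) (ρ : ℝ) : Set ι :=
  {i | ∃ y, dist y (x i) ≤ 2 * r i ∧ dist y x₀ ≤ ρ}

/-- Near `x₀`, at scale `τ`, the radii are comparable to `τ` and the values `p i` oscillate by
at most `O`. -/
structure LocalControl (M : ℕ) (b : ℝ) (x : ι → E) (r : ι → ℝ) (p : ι → Y) (x₀ : E)
    (τ O : ℝ) : Prop where
  pos : 0 < τ
  nonneg : 0 ≤ O
  four_mul_le : ∀ i ∈ nearIndices x r x₀ ((M + 1) * τ), 4 * r i ≤ τ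
  le_radius : ∀ i ∈ nearIndices x r x₀ ((M + 1) * τ), b * τ ≤ r i
  dist_le : ∀ i ∈ nearIndices x r x₀ ((M + 1) * τ), ∀ j ∈ nearIndices x r x₀ ((M + 1) * τ),
    dist (p i) (p j) ≤ O

/-- `w` interpolates the values `p i` on the balls of colour less than `k`, with constant `K`. -/
def IsGluing (M : ℕ) (b : ℝ) (x : ι → E) (r : ι → ℝ) (col : ι → ℕ) (p : ι → Y) (k : ℕ) (K : ℝ)
    (w : E → Y) : Prop :=
  ∀ x₀ τ O, LocalControl M b x r p x₀ τ O →
    ∀ y ∈ colorUnion x r col k, dist y x₀ ≤ (M + 1 - k) * τ →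
      (∀ j ∈ nearIndices x r x₀ ((M + 1) * τ), dist (w y) (p j) ≤ K * O) ∧
      ∀ y' ∈ colorUnion x r col k, dist y' x₀ ≤ (M + 1 - k) * τ →
        dist (w y) (w y') ≤ K * (O / τ) * dist y y'

/-- In each ball of colour k the new map is the apex of a cone, in the surrounding shell it runs
along the cone from the apex to w, and elsewhere it is w. Doubled balls of colour k are disjoint, so
the modifications do not interact. The new constant is a sum of four terms: the distance to the
values `p j`, two points in a common doubled ball, two points at distance at least bτ, and two
closer points without a common doubled ball. -/
theorem IsGluing.exists_succ {C : ℝ} (hC : 0 ≤ C)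
    (hH : ∀ Z : Set Y, Z.Nonempty → ∃ (H : Y → ℝ → Y) (q : Y), ∀ D : ℝ, 0 ≤ D →
      (∀ z ∈ Z, ∀ z' ∈ Z, dist z z' ≤ D) →
      (∀ z ∈ Z, H z 1 = z) ∧ (∀ z ∈ Z, H z 0 = q) ∧
        ∀ z ∈ Z, ∀ z' ∈ Z, ∀ t ∈ Icc (0 : ℝ) 1, ∀ t' ∈ Icc (0 : ℝ) 1,
          dist (H z t) (H z' t') ≤ C * (D * |t - t'| + dist z z'))
    {M : ℕ} {b : ℝ} (hb : 0 < b) {K : ℝ} (hK : 0 ≤ K) {k : ℕ}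
    {x : ι → E} {r : ι → ℝ} {col : ι → ℕ} {p : ι → Y} (hr : ∀ i, 0 < r i)
    (huniq : ∀ i j y, col i = col j → dist y (x i) ≤ 2 * r i → dist y (x j) ≤ 2 * r j → i = j)
    {w : E → Y} (hw : IsGluing M b x r col p k K w) :
    ∃ w', IsGluing M b x r col p (k + 1)
      ((2 * C * K + K + 1) + (2 * C * K / b + C * K) + 2 * (2 * C * K + K + 1) / b
        + (4 * C * K / b + K)) w' := by
  classical
  -- The values to be coned off over ball i: those already taken on the part of the doubled ball
  -- where w is controlled, together with `p i`, which makes the set nonempty and provides a centre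
  -- for its diameter bound.
  set Z : ι → Set Y := fun i =>
    insert (p i) (w '' {y | y ∈ colorUnion x r col k ∧ dist y (x i) ≤ 2 * r i}) with hZdef
  have hpZ : ∀ i, p i ∈ Z i := fun i => mem_insert _ _
  have hwZ : ∀ i y, y ∈ colorUnion x r col k → dist y (x i) ≤ 2 * r i → w y ∈ Z i :=
    fun i y h1 h2 => mem_insert_of_mem _ ⟨y, ⟨h1, h2⟩, rfl⟩
  choose H q hHq using fun i => hH (Z i) ⟨_, hpZ i⟩
  -- The cone parameter: 0 on the ball, giving the apex, and 1 on the boundary of the doubled ball,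
  -- giving back w.
  set s : ι → E → ℝ := fun i y => max 0 (dist y (x i) / r i - 1) with hsdef
  have hs0 : ∀ i y, dist y (x i) ≤ r i → s i y = 0 := by
    intro i y h
    exact max_eq_left (sub_nonpos.2 ((div_le_one (hr i)).2 h))
  have hs2 : ∀ i y, dist y (x i) ≤ 2 * r i → s i y ∈ Icc (0 : ℝ) 1 := by
    intro i y h
    refine ⟨le_max_left _ _, max_le zero_le_one ?_⟩
    have : dist y (x i) / r i ≤ 2 := (div_le_iff₀ (hr i)).2 h
    linarith
  have hslip : ∀ i y y', |s i y - s i y'| ≤ dist y y' / r i := by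
    intro i y y'
    have h0 : |s i y - s i y'| ≤ |dist y (x i) / r i - 1 - (dist y' (x i) / r i - 1)| := by
      simp only [hsdef, max_comm (0 : ℝ)]
      exact abs_max_sub_max_le_abs _ _ _
    refine h0.trans ?_
    rw [show dist y (x i) / r i - 1 - (dist y' (x i) / r i - 1)
      = (dist y (x i) - dist y' (x i)) / r i by ring, abs_div, abs_of_pos (hr i)]
    have := hr i
    gcongr
    exact abs_dist_sub_le _ _ _
  have hsout : ∀ i y y', 2 * r i < dist y' (x i) → 1 - s i y ≤ dist y y' / r i := by
    intro i y y' h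
    have h1 : dist y (x i) / r i - 1 ≤ s i y := le_max_right _ _
    have h2 : (dist y' (x i) - dist y (x i)) / r i ≤ dist y y' / r i := by
      have := hr i
      gcongr
      linarith [dist_triangle y' y (x i), dist_comm y y']
    rw [sub_div] at h2
    have h3 : 2 ≤ dist y' (x i) / r i := (le_div_iff₀ (hr i)).2 h.le
    linarith
  set w' : E → Y := fun y =>
    if h : ∃ i, col i = k ∧ dist y (x i) ≤ 2 * r i then
      if dist y (x h.choose) ≤ r h.choose then q h.choose
      else H h.choose (w y) (s h.choose y)
    else w y with hw'def
  have hw'in : ∀ i y, col i = k → dist y (x i) ≤ 2 * r i →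
      w' y = if dist y (x i) ≤ r i then q i else H i (w y) (s i y) := by
    intro i y h1 h2
    have h : ∃ i, col i = k ∧ dist y (x i) ≤ 2 * r i := ⟨i, h1, h2⟩
    have hi : h.choose = i :=
      huniq _ _ y (h.choose_spec.1.trans h1.symm) h.choose_spec.2 h2
    simp only [hw'def, dif_pos h, hi]
  have hw'out : ∀ y, (¬ ∃ i, col i = k ∧ dist y (x i) ≤ 2 * r i) → w' y = w y := by
    intro y h
    simp only [hw'def, dif_neg h]
  have hVout : ∀ y, y ∈ colorUnion x r col (k + 1) →
      (¬ ∃ i, col i = k ∧ dist y (x i) ≤ r i) → y ∈ colorUnion x r col k := by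
    rintro y ⟨i, hi, hyi⟩ h
    rcases Nat.lt_succ_iff_lt_or_eq.1 hi with h' | h'
    · exact ⟨i, h', hyi⟩
    · exact absurd ⟨i, h', hyi⟩ h
  -- In the shell of ball i the point lies in no ball of colour k, so it was covered by an earlier
  -- colour and w is meaningful there.
  have hVin : ∀ i y, col i = k → dist y (x i) ≤ 2 * r i → r i < dist y (x i) →
      y ∈ colorUnion x r col (k + 1) → y ∈ colorUnion x r col k := by
    intro i y h1 h2 h3 hy
    refine hVout y hy ?_
    rintro ⟨j, hj, hyj⟩
    have : j = i := huniq j i y (hj.trans h1.symm) (by linarith [hr j]) h2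
    rw [this] at hyj
    linarith
  refine ⟨w', fun x₀ τ O hloc => ?_⟩
  have hτ := hloc.pos
  have hO := hloc.nonneg
  have hcast : ((k + 1 : ℕ) : ℝ) = k + 1 := by push_cast; ring
  rw [hcast]
  have hrad : ∀ y, dist y x₀ ≤ ((M : ℝ) + 1 - (k + 1)) * τ → dist y x₀ ≤ ((M : ℝ) + 1) * τ := by
    intro y hy
    have : 0 ≤ ((k : ℝ) + 1) * τ := by positivity
    linarith
  -- the contractions used near `x₀` are those of sets of diameter at most `2 * K * O`
  have hnear : ∀ i y, dist y (x i) ≤ 2 * r i → dist y x₀ ≤ ((M : ℝ) + 1 - (k + 1)) * τ →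
      i ∈ nearIndices x r x₀ ((M + 1) * τ) := fun i y h1 h2 => ⟨y, h1, hrad y h2⟩
  have hDZ : ∀ i y, dist y (x i) ≤ 2 * r i → dist y x₀ ≤ ((M : ℝ) + 1 - (k + 1)) * τ →
      ∀ z ∈ Z i, dist z (p i) ≤ K * O := by
    intro i y h1 h2 z hz
    rcases hz with rfl | ⟨y', ⟨hy', hy'i⟩, rfl⟩
    · rw [dist_self]; positivity
    -- A point of the doubled ball is within 4 r i ≤ τ of y. This is why each colour shrinks the
    -- radius of control by τ.
    · refine (hw x₀ τ O hloc y' hy' ?_).1 i (hnear i y h1 h2)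
      have h4 := hloc.four_mul_le i (hnear i y h1 h2)
      have := dist_triangle4 y' (x i) y x₀
      rw [dist_comm (x i) y] at this
      linarith
  have hcontr : ∀ i y, dist y (x i) ≤ 2 * r i → dist y x₀ ≤ ((M : ℝ) + 1 - (k + 1)) * τ →
      (∀ z ∈ Z i, H i z 1 = z) ∧ (∀ z ∈ Z i, H i z 0 = q i) ∧
        ∀ z ∈ Z i, ∀ z' ∈ Z i, ∀ t ∈ Icc (0 : ℝ) 1, ∀ t' ∈ Icc (0 : ℝ) 1,
          dist (H i z t) (H i z' t') ≤ C * (2 * K * O * |t - t'| + dist z z') := by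
    intro i y h1 h2
    refine hHq i (2 * K * O) (by positivity) fun z hz z' hz' => ?_
    have := dist_triangle_right z z' (p i)
    linarith [hDZ i y h1 h2 z hz, hDZ i y h1 h2 z' hz']
  have hrτ : ∀ i y, dist y (x i) ≤ 2 * r i → dist y x₀ ≤ ((M : ℝ) + 1 - (k + 1)) * τ →
      ∀ d : ℝ, 0 ≤ d → O * (d / r i) ≤ 1 / b * (O / τ * d) := by
    intro i y h1 h2 d hd
    have h := hloc.le_radius i (hnear i y h1 h2)
    have : d / r i ≤ d / (b * τ) := by gcongr
    calc O * (d / r i) ≤ O * (d / (b * τ)) := by gcongr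
      _ = 1 / b * (O / τ * d) := by field_simp
  set K₁ := 2 * C * K + K + 1 with hK₁
  have hK₁0 : 0 ≤ K₁ := by positivity
  have hsmall : ∀ y, dist y x₀ ≤ ((M : ℝ) + 1 - (k + 1)) * τ → dist y x₀ ≤ (M + 1 - k) * τ := by
    intro y hy; linarith
  have hbound : ∀ y ∈ colorUnion x r col (k + 1), dist y x₀ ≤ ((M : ℝ) + 1 - (k + 1)) * τ →
      ∀ j ∈ nearIndices x r x₀ ((M + 1) * τ), dist (w' y) (p j) ≤ K₁ * O := by
    intro y hyV hy j hj
    by_cases h : ∃ i, col i = k ∧ dist y (x i) ≤ 2 * r i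
    · obtain ⟨i, hik, hyi⟩ := h
      obtain ⟨h1, h0, hL⟩ := hcontr i y hyi hy
      have hs := hs2 i y hyi
      have hbd : ∀ z ∈ Z i, dist z (p j) ≤ (K + 1) * O →
          dist (H i z (s i y)) (p j) ≤ K₁ * O := by
        intro z hz hzj
        have h2 := hL z hz z hz _ hs 1 ⟨zero_le_one, le_rfl⟩
        rw [h1 z hz, dist_self, add_zero] at h2
        have h3 : |s i y - 1| ≤ 1 := abs_le.2 ⟨by linarith [hs.1], by linarith [hs.2]⟩
        have h4 : C * (2 * K * O * |s i y - 1|) ≤ C * (2 * K * O * 1) := by gcongr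
        have := dist_triangle (H i z (s i y)) z (p j)
        rw [hK₁]
        linarith
      rw [hw'in i y hik hyi]
      split_ifs with hin
      · rw [← h0 _ (hpZ i), ← hs0 i y hin]
        refine hbd _ (hpZ i) ((hloc.dist_le i (hnear i y hyi hy) j hj).trans ?_)
        nlinarith [mul_nonneg hK hO]
      · have hyk := hVin i y hik hyi (not_le.1 hin) hyV
        refine hbd _ (hwZ i y hyk hyi) (((hw x₀ τ O hloc y hyk (hsmall y hy)).1 j hj).trans ?_)
        nlinarith
    · rw [hw'out y h]
      have hyk := hVout y hyV fun ⟨i, h1, h2⟩ => h ⟨i, h1, by linarith [hr i]⟩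
      refine ((hw x₀ τ O hloc y hyk (hsmall y hy)).1 j hj).trans ?_
      rw [hK₁]
      nlinarith [mul_nonneg hC hK, mul_nonneg (mul_nonneg hC hK) hO]
  have hextra : 0 ≤ (2 * C * K / b + C * K) + 2 * K₁ / b + (4 * C * K / b + K) := by positivity
  refine fun y hyV hy => ⟨fun j hj => (hbound y hyV hy j hj).trans ?_, fun y' hyV' hy' => ?_⟩
  · nlinarith [mul_nonneg hextra hO]
  set X := O / τ * dist y y' with hX
  have hX0 : 0 ≤ X := by positivity
  rw [mul_assoc, ← hX]
  by_cases hcommon : ∃ i, col i = k ∧ dist y (x i) ≤ 2 * r i ∧ dist y' (x i) ≤ 2 * r i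
  · obtain ⟨i, hik, hyi, hyi'⟩ := hcommon
    obtain ⟨h1, h0, hL⟩ := hcontr i y hyi hy
    -- The apex is `H i z 0` for every z in `Z i`. So if one of the two points lies in the inner
    -- ball, both values are written with the same z, and only the change of the cone parameter is
    -- left.
    obtain ⟨z, hz, z', hz', e1, e2, hzz⟩ : ∃ z ∈ Z i, ∃ z' ∈ Z i, w' y = H i z (s i y) ∧
        w' y' = H i z' (s i y') ∧ dist z z' ≤ K * X := by
      rw [hw'in i y hik hyi, hw'in i y' hik hyi']
      split_ifs with h h' h'
      · refine ⟨_, hpZ i, _, hpZ i, ?_, ?_, by rw [dist_self]; positivity⟩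
        · rw [hs0 i y h, h0 _ (hpZ i)]
        · rw [hs0 i y' h', h0 _ (hpZ i)]
      · have hz := hwZ i y' (hVin i y' hik hyi' (not_le.1 h') hyV') hyi'
        exact ⟨_, hz, _, hz, by rw [hs0 i y h, h0 _ hz], rfl, by rw [dist_self]; positivity⟩
      · have hz := hwZ i y (hVin i y hik hyi (not_le.1 h) hyV) hyi
        exact ⟨_, hz, _, hz, rfl, by rw [hs0 i y' h', h0 _ hz], by rw [dist_self]; positivity⟩
      · have hk := hVin i y hik hyi (not_le.1 h) hyV
        have hk' := hVin i y' hik hyi' (not_le.1 h') hyV'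
        refine ⟨_, hwZ i y hk hyi, _, hwZ i y' hk' hyi', rfl, rfl, ?_⟩
        have := (hw x₀ τ O hloc y hk (hsmall y hy)).2 y' hk' (hsmall y' hy')
        rwa [mul_assoc] at this
    rw [e1, e2]
    refine (hL z hz z' hz' _ (hs2 i y hyi) _ (hs2 i y' hyi')).trans ?_
    have h2 : O * |s i y - s i y'| ≤ 1 / b * X :=
      (mul_le_mul_of_nonneg_left (hslip i y y') hO).trans (hrτ i y hyi hy _ dist_nonneg)
    have h3 : C * (2 * K * O * |s i y - s i y'| + dist z z')
        ≤ C * (2 * K * (1 / b * X) + K * X) := by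
      have : 2 * K * O * |s i y - s i y'| ≤ 2 * K * (1 / b * X) := by
        rw [mul_assoc]; gcongr
      gcongr
    refine h3.trans ?_
    have : 0 ≤ (K₁ + 2 * K₁ / b + (4 * C * K / b + K)) * X := by positivity
    have e : C * (2 * K * (1 / b * X) + K * X) = (2 * C * K / b + C * K) * X := by ring
    rw [e]
    linarith
  -- Points at distance at least bτ: both values are within K₁ O of the same `p j`, and O is at most
  -- the wanted bound divided by b.
  · have hfar : b * τ ≤ dist y y' → dist (w' y) (w' y') ≤ 2 * K₁ / b * X := by
      intro hd
      have ⟨j, _, hyj⟩ := hyV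
      have hj : j ∈ nearIndices x r x₀ ((M + 1) * τ) :=
        hnear j y (by linarith [hr j]) hy
      have h1 := hbound y hyV hy j hj
      have h2 := hbound y' hyV' hy' j hj
      have h3 := dist_triangle_right (w' y) (w' y') (p j)
      have h4 : O ≤ 1 / b * X := by
        calc O = O / τ * (b * τ) / b := by field_simp
          _ ≤ O / τ * dist y y' / b := by gcongr
          _ = 1 / b * X := by rw [hX]; ring
      calc dist (w' y) (w' y') ≤ 2 * K₁ * O := by linarith
        _ ≤ 2 * K₁ * (1 / b * X) := by gcongr
        _ = _ := by ring
    -- If u is in a doubled ball that v is not in, then either u is in the inner ball, and the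
    -- distance is at least r i ≥ bτ, or u is in the shell, with cone parameter within dist u v / r
    -- i of 1, so that the new value at u is close to the old one. In the second case for both
    -- points the old Lipschitz bound is used.
    have hone : ∀ u ∈ colorUnion x r col (k + 1), dist u x₀ ≤ ((M : ℝ) + 1 - (k + 1)) * τ →
        ∀ v, dist u v = dist y y' →
        (¬ ∃ i, col i = k ∧ dist u (x i) ≤ 2 * r i ∧ dist v (x i) ≤ 2 * r i) →
        b * τ ≤ dist y y' ∨
          (u ∈ colorUnion x r col k ∧ dist (w' u) (w u) ≤ 2 * C * K / b * X) := by
      intro u huV hu v huv hno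
      by_cases h : ∃ i, col i = k ∧ dist u (x i) ≤ 2 * r i
      · obtain ⟨i, hik, hui⟩ := h
        have hvi : 2 * r i < dist v (x i) := by
          by_contra! hv
          exact hno ⟨i, hik, hui, hv⟩
        by_cases hin : dist u (x i) ≤ r i
        · left
          have := hloc.le_radius i (hnear i u hui hu)
          rw [← huv]
          linarith [dist_triangle v u (x i), dist_comm u v]
        · right
          have huk := hVin i u hik hui (not_le.1 hin) huV
          refine ⟨huk, ?_⟩
          obtain ⟨h1, h0, hL⟩ := hcontr i u hui hu
          have hz := hwZ i u huk hui
          have h2 := hL _ hz _ hz _ (hs2 i u hui) 1 ⟨zero_le_one, le_rfl⟩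
          rw [h1 _ hz, dist_self, add_zero] at h2
          rw [hw'in i u hik hui, if_neg hin]
          refine h2.trans ?_
          have h3 : |s i u - 1| ≤ dist y y' / r i := by
            rw [abs_sub_comm, abs_of_nonneg (by linarith [(hs2 i u hui).2]), ← huv]
            exact hsout i u v hvi
          have h4 : O * |s i u - 1| ≤ 1 / b * X :=
            (mul_le_mul_of_nonneg_left h3 hO).trans (hrτ i u hui hu _ dist_nonneg)
          calc C * (2 * K * O * |s i u - 1|) = 2 * C * K * (O * |s i u - 1|) := by ring
            _ ≤ 2 * C * K * (1 / b * X) := by gcongr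
            _ = _ := by ring
      · right
        refine ⟨hVout u huV fun ⟨i, h1, h2⟩ => h ⟨i, h1, by linarith [hr i]⟩, ?_⟩
        rw [hw'out u h, dist_self]
        positivity
    have hA : 0 ≤ (K₁ + (2 * C * K / b + C * K)) * X := by positivity
    have hB : 0 ≤ 2 * K₁ / b * X := by positivity
    have hE : 0 ≤ (4 * C * K / b + K) * X := by positivity
    rcases hone y hyV hy y' rfl hcommon with h | ⟨hk, h1⟩
    · linarith [hfar h]
    rcases hone y' hyV' hy' y (dist_comm _ _)
      (fun ⟨i, h1, h2, h3⟩ => hcommon ⟨i, h1, h3, h2⟩) with h | ⟨hk', h2⟩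
    · linarith [hfar h]
    have h3 := (hw x₀ τ O hloc y hk (hsmall y hy)).2 y' hk' (hsmall y' hy')
    rw [mul_assoc, ← hX] at h3
    have h4 := dist_triangle4 (w' y) (w y) (w y') (w' y')
    rw [dist_comm (w y') (w' y')] at h4
    have e : 4 * C * K / b = 2 * C * K / b + 2 * C * K / b := by ring
    rw [e] at hE ⊢
    linarith

/-- The constant is fixed before the balls and values are given, so it serves all Whitney families
at once. With no colour treated the union is empty and every map qualifies. -/
theorem exists_gluing [Nonempty Y] (hY : ConeContractible Y) (M : ℕ) {b : ℝ} (hb : 0 < b)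
    (k : ℕ) :
    ∃ K : ℝ, 0 ≤ K ∧ ∀ {ι : Type} (x : ι → E) (r : ι → ℝ) (col : ι → ℕ) (p : ι → Y),
      (∀ i, 0 < r i) →
      (∀ i j y, col i = col j → dist y (x i) ≤ 2 * r i → dist y (x j) ≤ 2 * r j → i = j) →
      ∃ w : E → Y, IsGluing M b x r col p k K w := by
  obtain ⟨C, hC, hH⟩ := hY.exists_contraction
  induction k with
  | zero =>
    refine ⟨0, le_rfl, fun x r col p _ _ => ⟨fun _ => Classical.arbitrary Y, ?_⟩⟩
    rintro x₀ τ O - y ⟨i, hi, -⟩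
    exact absurd hi (Nat.not_lt_zero _)
  | succ k ih =>
    obtain ⟨K, hK, h⟩ := ih
    refine ⟨(2 * C * K + K + 1) + (2 * C * K / b + C * K) + 2 * (2 * C * K + K + 1) / b
      + (4 * C * K / b + K), by positivity, fun x r col p hr huniq => ?_⟩
    obtain ⟨w, hw⟩ := h x r col p hr huniq
    exact hw.exists_succ hC hH hb hK hr huniq

end Gluing

theorem ENNReal.add_sq_le_two_mul (a b : ℝ≥0∞) : (a + b) ^ 2 ≤ 2 * (a ^ 2 + b ^ 2) := by
  induction a using ENNReal.recTopCoe with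
  | top => simp
  | coe a =>
    induction b using ENNReal.recTopCoe with
    | top => simp
    | coe b => exact_mod_cast add_sq_le (a := a) (b := b)

theorem edist_sq_le_two_mul {Y : Type} [PseudoEMetricSpace Y] (a b c : Y) :
    edist a c ^ 2 ≤ 2 * (edist a b ^ 2 + edist b c ^ 2) :=
  (pow_le_pow_left' (edist_triangle a b c) 2).trans (ENNReal.add_sq_le_two_mul _ _)

theorem MeasureTheory.StronglyMeasurable.measurable_edist_sq {X Y : Type} [PseudoMetricSpace Y]
    [MeasurableSpace X] {U : X → Y} (h : StronglyMeasurable U) :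
    Measurable (fun p : X × X => edist (U p.1) (U p.2) ^ 2) :=
  ((h.comp_measurable measurable_fst).edist (h.comp_measurable measurable_snd)).measurable.pow_const
    2

/-! ### Dyadic Whitney cells and their colouring -/

section Grid

variable {N : ℕ}

/-- The type of colours of the cells of the dyadic grid. -/
abbrev GridColor (N : ℕ) : Type := ZMod 6 × (Fin N → ZMod (4 * N + 1))

instance (N : ℕ) : Fintype (GridColor N) :=
  haveI : NeZero (4 * N + 1) := ⟨by omega⟩
  inferInstanceAs (Fintype (ZMod 6 × (Fin N → ZMod (4 * N + 1))))

/-- The number of colours. -/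
def gridColors (N : ℕ) : ℕ := Fintype.card (GridColor N)

/-- The radius of the cells of unit size. -/
noncomputable def gridRadius (N : ℕ) : ℝ := 1 / (320 * (gridColors N + 1))

/-- The centre of the grid cell of size `2 ^ k` with integer coordinates `z`. -/
noncomputable def gridPoint (i : ℤ × (Fin N → ℤ)) : Euc N :=
  WithLp.toLp 2 fun l => gridRadius N / N * 2 ^ i.1 * i.2 l

/-- The Whitney cells of `{t > 0}`: those whose size is comparable to `t`. -/
abbrev WhitneyIndex (t : Euc N → ℝ) : Type :=
  {i : ℤ × (Fin N → ℤ) // 2 ^ i.1 ≤ 2 * t (gridPoint i) ∧ t (gridPoint i) ≤ 4 * 2 ^ i.1}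

/-- The colour of a cell. -/
noncomputable def gridColor (i : ℤ × (Fin N → ℤ)) : ℕ :=
  (Fintype.equivFin (GridColor N) (i.1, fun l => i.2 l)).val

theorem gridColor_lt (i : ℤ × (Fin N → ℤ)) : gridColor i < gridColors N := Fin.is_lt _

theorem gridRadius_pos : 0 < gridRadius N := by unfold gridRadius; positivity

theorem gridRadius_le : gridRadius N ≤ 1 / 320 := by
  unfold gridRadius
  gcongr
  have : (0 : ℝ) ≤ gridColors N := Nat.cast_nonneg _
  linarith

theorem EuclideanSpace.norm_le_card_mul {v : Euc N} {a : ℝ} (ha : 0 ≤ a)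
    (h : ∀ l, |v l| ≤ a) : ‖v‖ ≤ N * a := by
  rw [EuclideanSpace.norm_eq]
  refine Real.sqrt_le_iff.2 ⟨by positivity, ?_⟩
  refine (Finset.sum_le_sum fun l _ => pow_le_pow_left₀ (norm_nonneg _) (h l) 2).trans ?_
  rw [Finset.sum_const, Finset.card_univ, Fintype.card_fin, nsmul_eq_mul]
  have hN : (N : ℝ) ≤ (N : ℝ) ^ 2 := by exact_mod_cast Nat.le_self_pow two_ne_zero N
  nlinarith [mul_le_mul_of_nonneg_right hN (sq_nonneg a)]

/-- Size of a cell against the value of `t` at a point of the doubled cell. -/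
theorem whitney_size {t : Euc N → ℝ} (ht : LipschitzWith 1 t) (i : WhitneyIndex t) {y : Euc N}
    (hy : dist y (gridPoint i.1) ≤ 2 * (gridRadius N * 2 ^ i.1.1)) :
    (2 : ℝ) ^ i.1.1 ≤ 4 * t y ∧ t y ≤ 17 / 4 * 2 ^ i.1.1 := by
  have h1 := ht.dist_le_mul y (gridPoint i.1)
  rw [NNReal.coe_one, one_mul, Real.dist_eq] at h1
  have h2 := abs_le.1 (h1.trans hy)
  have h3 : (0 : ℝ) < 2 ^ i.1.1 := by positivity
  have h4 := mul_le_mul_of_nonneg_right (gridRadius_le (N := N)) h3.le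
  have := i.2
  constructor <;> linarith

/-- At a common point of two doubled cells t y is comparable to both sizes within a total factor 17
< 32, so the exponents differ by at most 4 and are equal once congruent mod 6. The centres are then
at most 4 radii apart, so the integer coordinates differ by at most 4N and are equal once congruent
mod 4N + 1. -/
theorem whitney_unique {t : Euc N → ℝ} (ht : LipschitzWith 1 t) (i j : WhitneyIndex t)
    {y : Euc N} (hc : gridColor i.1 = gridColor j.1)
    (hi : dist y (gridPoint i.1) ≤ 2 * (gridRadius N * 2 ^ i.1.1))
    (hj : dist y (gridPoint j.1) ≤ 2 * (gridRadius N * 2 ^ j.1.1)) : i = j := by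
  have hc' := (Fintype.equivFin (GridColor N)).injective (Fin.val_injective hc)
  rw [Prod.mk.injEq] at hc'
  obtain ⟨h1, h2⟩ := hc'
  obtain ⟨hi1, hi2⟩ := whitney_size ht i hi
  obtain ⟨hj1, hj2⟩ := whitney_size ht j hj
  have key : ∀ k l : ℤ, (2 : ℝ) ^ k ≤ 4 * t y → t y ≤ 17 / 4 * 2 ^ l → k < l + 5 := by
    intro k l hk hl
    have : (2 : ℝ) ^ k < 2 ^ (l + 5) := by
      rw [zpow_add₀ two_ne_zero]
      have : (0 : ℝ) < 2 ^ l := by positivity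
      norm_num
      linarith
    exact (zpow_lt_zpow_iff_right₀ one_lt_two).1 this
  have hk : i.1.1 = j.1.1 := by
    rw [ZMod.intCast_eq_intCast_iff, Int.modEq_iff_dvd] at h1
    have := Int.eq_zero_of_abs_lt_dvd h1
      (abs_lt.2 ⟨by have := key _ _ hi1 hj2; push_cast; omega,
        by have := key _ _ hj1 hi2; push_cast; omega⟩)
    omega
  refine Subtype.ext (Prod.ext hk ?_)
  funext l
  have h3 := congrFun h2 l
  rw [ZMod.intCast_eq_intCast_iff, Int.modEq_iff_dvd] at h3
  have hN : 0 < N := l.pos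
  have hN' : (0 : ℝ) < N := by exact_mod_cast hN
  have hβ := gridRadius_pos (N := N)
  have h4 : dist (gridPoint i.1) (gridPoint j.1) ≤ 4 * (gridRadius N * 2 ^ i.1.1) := by
    rw [← hk] at hj
    linarith [dist_triangle_left (gridPoint i.1) (gridPoint j.1) y]
  rw [dist_eq_norm] at h4
  have h5 := (PiLp.norm_apply_le (gridPoint i.1 - gridPoint j.1) l).trans h4
  have h6 : (gridPoint i.1 - gridPoint j.1).ofLp l
      = gridRadius N * 2 ^ i.1.1 / N * ((i.1.2 l : ℝ) - j.1.2 l) := by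
    simp only [PiLp.sub_apply, gridPoint, ← hk]
    ring
  have h7 : (0 : ℝ) < gridRadius N * 2 ^ i.1.1 := by positivity
  rw [h6, norm_mul, Real.norm_eq_abs, Real.norm_eq_abs, abs_of_pos (by positivity)] at h5
  have h8 : |(i.1.2 l : ℝ) - j.1.2 l| ≤ 4 * N := by
    by_contra! hcon
    have := mul_lt_mul_of_pos_left hcon (show 0 < gridRadius N * 2 ^ i.1.1 / N by positivity)
    have e : gridRadius N * 2 ^ i.1.1 / N * (4 * N) = 4 * (gridRadius N * 2 ^ i.1.1) := by
      field_simp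
    linarith
  have h9 : |i.1.2 l - j.1.2 l| ≤ 4 * (N : ℤ) := by exact_mod_cast h8
  have := Int.eq_zero_of_abs_lt_dvd h3 (by rw [abs_sub_comm]; push_cast; omega)
  omega

/-- Take 2^k ≤ t y < 2^(k+1) and round the coordinates of y to the grid of mesh radius/N. The radius
is so small against 2^k that t at the grid point still satisfies the conditions of a Whitney cell.
-/
theorem exists_whitney_mem {t : Euc N → ℝ} (ht : LipschitzWith 1 t) {y : Euc N} (hy : 0 < t y) :
    ∃ i : WhitneyIndex t, dist y (gridPoint i.1) ≤ gridRadius N * 2 ^ i.1.1 := by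
  obtain ⟨k, hk1, hk2⟩ := exists_mem_Ico_zpow hy one_lt_two
  have hβ := gridRadius_pos (N := N)
  have h2k : (0 : ℝ) < 2 ^ k := by positivity
  set a := gridRadius N / N * 2 ^ k with ha
  let z : Fin N → ℤ := fun l => round (y l / a)
  have hd : dist y (gridPoint (k, z)) ≤ gridRadius N * 2 ^ k := by
    rcases Nat.eq_zero_or_pos N with h0 | hN
    · subst h0
      rw [Subsingleton.elim y (gridPoint (k, z)), dist_self]
      positivity
    have hN' : (0 : ℝ) < N := by exact_mod_cast hN
    have hapos : 0 < a := by positivity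
    rw [dist_eq_norm]
    refine (EuclideanSpace.norm_le_card_mul hapos.le fun l => ?_).trans (le_of_eq ?_)
    · have e : (y - gridPoint (k, z)).ofLp l = a * (y l / a - z l) := by
        have : a * (y l / a) = y l := by field_simp
        rw [mul_sub, this]
        rfl
      rw [e, abs_mul, abs_of_pos hapos]
      have := abs_sub_round (y l / a)
      have h1 : |y l / a - z l| ≤ 1 := this.trans (by norm_num)
      exact mul_le_of_le_one_right hapos.le h1
    · rw [ha]; field_simp
  have h1 := ht.dist_le_mul y (gridPoint (k, z))
  rw [NNReal.coe_one, one_mul, Real.dist_eq] at h1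
  have h2 := abs_le.1 (h1.trans hd)
  have h4 := mul_le_mul_of_nonneg_right (gridRadius_le (N := N)) h2k.le
  rw [zpow_add_one₀ two_ne_zero] at hk2
  exact ⟨⟨(k, z), by constructor <;> simp only <;> linarith⟩, hd⟩

end Grid

/-! ### Substitutes for mean values in a metric space -/

section Average

variable {N : ℕ} {Y : Type} [PseudoMetricSpace Y]

/-- The mean square oscillation of `U` over the ball of radius `t x / 4` at `x`
(up to a constant factor). -/
noncomputable def oscSq (U : Euc N → Y) (t : Euc N → ℝ) (x : Euc N) : ℝ≥0∞ :=
  ENNReal.ofReal (t x)⁻¹ ^ (2 * N) * ∫⁻ z in Metric.ball x (t x / 4),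
    ∫⁻ z' in Metric.ball x (t x / 4), edist (U z) (U z') ^ 2

/-- Instead of a mean, which Y may lack, p is the value of U at a point where the mean square
distance to U is at most its average over the ball. -/
theorem exists_mean {U : Euc N → Y} (hU : StronglyMeasurable U) (c : Euc N) {r : ℝ}
    (hr : 0 < r) :
    ∃ p : Y, ∫⁻ z in Metric.closedBall c r, edist p (U z) ^ 2
      ≤ (volume (Metric.closedBall c r))⁻¹ * ∫⁻ z in Metric.closedBall c r,
        ∫⁻ z' in Metric.closedBall c r, edist (U z) (U z') ^ 2 := by
  have h0 : volume (Metric.closedBall c r) ≠ 0 := (Metric.measure_closedBall_pos _ _ hr).ne'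
  have h1 : volume (Metric.closedBall c r) ≠ ∞ := measure_closedBall_lt_top.ne
  obtain ⟨z, -, hz⟩ := exists_le_setLAverage h0 h1
    (f := fun z => ∫⁻ z' in Metric.closedBall c r, edist (U z) (U z') ^ 2)
    (hU.measurable_edist_sq.lintegral_prod_right').aemeasurable
  refine ⟨U z, hz.trans (le_of_eq ?_)⟩
  rw [setLAverage_eq, ENNReal.div_eq_inv_mul]

theorem edist_mean_sq_le {U : Euc N → Y} (hU : StronglyMeasurable U) {c : Euc N} {r : ℝ}
    (hr : 0 < r) {p : Y} {A : ℝ≥0∞}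
    (hp : ∫⁻ z in Metric.closedBall c r, edist p (U z) ^ 2 ≤ A) (y : Y) :
    edist p y ^ 2 ≤ (volume (Metric.closedBall c r))⁻¹ * (2 * A)
      + (volume (Metric.closedBall c r))⁻¹ *
        (2 * ∫⁻ z in Metric.closedBall c r, edist (U z) y ^ 2) := by
  have h0 : volume (Metric.closedBall c r) ≠ 0 := (Metric.measure_closedBall_pos _ _ hr).ne'
  have h1 : volume (Metric.closedBall c r) ≠ ∞ := measure_closedBall_lt_top.ne
  have h2 : volume (Metric.closedBall c r) * edist p y ^ 2
      ≤ 2 * A + 2 * ∫⁻ z in Metric.closedBall c r, edist (U z) y ^ 2 := by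
    calc volume (Metric.closedBall c r) * edist p y ^ 2
        = ∫⁻ z in Metric.closedBall c r, edist p y ^ 2 := by
          rw [setLIntegral_const, mul_comm]
      _ ≤ ∫⁻ z in Metric.closedBall c r, (2 * edist p (U z) ^ 2 + 2 * edist (U z) y ^ 2) := by
          refine lintegral_mono fun z => ?_
          rw [← mul_add]
          exact edist_sq_le_two_mul _ _ _
      _ = 2 * (∫⁻ z in Metric.closedBall c r, edist p (U z) ^ 2)
          + 2 * ∫⁻ z in Metric.closedBall c r, edist (U z) y ^ 2 := by
          have hm : Measurable fun z => edist p (U z) ^ 2 :=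
            (stronglyMeasurable_const.edist hU).measurable.pow_const 2
          rw [lintegral_add_left (hm.const_mul 2), lintegral_const_mul _ hm,
            lintegral_const_mul' _ _ ENNReal.ofNat_ne_top]
      _ ≤ _ := by gcongr
  rw [← mul_add]
  calc edist p y ^ 2 = (volume (Metric.closedBall c r))⁻¹ *
        (volume (Metric.closedBall c r) * edist p y ^ 2) := by
        rw [← mul_assoc, ENNReal.inv_mul_cancel h0 h1, one_mul]
    _ ≤ _ := by gcongr

/-- The triangle inequality is averaged over both balls by two uses of `edist_mean_sq_le`. All
double integrals are bounded by the one over the ball that contains both, and 10 = 2 + 4 + 4. -/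
theorem edist_mean_mean_sq_le {U : Euc N → Y} (hU : StronglyMeasurable U) {c c' x : Euc N}
    {r r' ρ : ℝ} (hr : 0 < r) (hr' : 0 < r') {p p' : Y} {W : ℝ≥0∞}
    (hp : ∫⁻ z in Metric.closedBall c r, edist p (U z) ^ 2
      ≤ (volume (Metric.closedBall c r))⁻¹ * ∫⁻ z in Metric.closedBall c r,
        ∫⁻ z' in Metric.closedBall c r, edist (U z) (U z') ^ 2)
    (hp' : ∫⁻ z in Metric.closedBall c' r', edist p' (U z) ^ 2
      ≤ (volume (Metric.closedBall c' r'))⁻¹ * ∫⁻ z in Metric.closedBall c' r',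
        ∫⁻ z' in Metric.closedBall c' r', edist (U z) (U z') ^ 2)
    (hc : Metric.closedBall c r ⊆ Metric.ball x ρ)
    (hc' : Metric.closedBall c' r' ⊆ Metric.ball x ρ)
    (hW : (volume (Metric.closedBall c r))⁻¹ ≤ W)
    (hW' : (volume (Metric.closedBall c' r'))⁻¹ ≤ W) :
    edist p p' ^ 2 ≤ 10 * W ^ 2 * ∫⁻ z in Metric.ball x ρ, ∫⁻ z' in Metric.ball x ρ,
      edist (U z) (U z') ^ 2 := by
  have h0 : volume (Metric.closedBall c r) ≠ 0 := (Metric.measure_closedBall_pos _ _ hr).ne'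
  have h1 : volume (Metric.closedBall c r) ≠ ∞ := measure_closedBall_lt_top.ne
  set S := ∫⁻ z in Metric.ball x ρ, ∫⁻ z' in Metric.ball x ρ, edist (U z) (U z') ^ 2
  have hmono : ∀ s s' : Set (Euc N), s ⊆ Metric.ball x ρ → s' ⊆ Metric.ball x ρ →
      ∫⁻ z in s, ∫⁻ z' in s', edist (U z) (U z') ^ 2 ≤ S := fun s s' h h' =>
    (lintegral_mono fun z => lintegral_mono_set h').trans (lintegral_mono_set h)
  have hA : ∫⁻ z in Metric.closedBall c r, edist p (U z) ^ 2 ≤ W * S :=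
    hp.trans (mul_le_mul' hW (hmono _ _ hc hc))
  have hA' : ∫⁻ z in Metric.closedBall c' r', edist p' (U z) ^ 2
      ≤ (volume (Metric.closedBall c' r'))⁻¹ * S :=
    hp'.trans (mul_le_mul' le_rfl (hmono _ _ hc' hc'))
  have hB : ∫⁻ z in Metric.closedBall c r, edist (U z) p' ^ 2
      ≤ volume (Metric.closedBall c r) * (2 * W ^ 2 * S) + 2 * W * S := by
    calc ∫⁻ z in Metric.closedBall c r, edist (U z) p' ^ 2
        ≤ ∫⁻ z in Metric.closedBall c r, (W * (2 * (W * S))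
          + W * (2 * ∫⁻ z' in Metric.closedBall c' r', edist (U z) (U z') ^ 2)) := by
          refine lintegral_mono fun z => ?_
          rw [edist_comm]
          refine (edist_mean_sq_le hU hr' hA' (U z)).trans ?_
          simp only [edist_comm (U z)]
          gcongr
      _ = volume (Metric.closedBall c r) * (2 * W ^ 2 * S) + 2 * W *
          ∫⁻ z in Metric.closedBall c r, ∫⁻ z' in Metric.closedBall c' r',
            edist (U z) (U z') ^ 2 := by
          have hm : Measurable fun z => ∫⁻ z' in Metric.closedBall c' r', edist (U z) (U z') ^ 2 :=
            hU.measurable_edist_sq.lintegral_prod_right'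
          rw [lintegral_add_left measurable_const, setLIntegral_const,
            lintegral_const_mul _ (hm.const_mul 2), lintegral_const_mul _ hm]
          ring
      _ ≤ _ := by gcongr; exact hmono _ _ hc hc'
  refine (edist_mean_sq_le hU hr hA p').trans ?_
  calc (volume (Metric.closedBall c r))⁻¹ * (2 * (W * S)) + (volume (Metric.closedBall c r))⁻¹ *
        (2 * ∫⁻ z in Metric.closedBall c r, edist (U z) p' ^ 2)
      ≤ (volume (Metric.closedBall c r))⁻¹ * (2 * (W * S)) + (volume (Metric.closedBall c r))⁻¹ *
        (2 * (volume (Metric.closedBall c r) * (2 * W ^ 2 * S) + 2 * W * S)) := by gcongr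
    _ = (volume (Metric.closedBall c r))⁻¹ * (2 * (W * S))
        + ((volume (Metric.closedBall c r))⁻¹ * volume (Metric.closedBall c r)) * (4 * W ^ 2 * S)
        + (volume (Metric.closedBall c r))⁻¹ * (4 * (W * S)) := by ring
    _ ≤ W * (2 * (W * S)) + 1 * (4 * W ^ 2 * S) + W * (4 * (W * S)) := by
        rw [ENNReal.inv_mul_cancel h0 h1]; gcongr
    _ = 10 * W ^ 2 * S := by ring

end Average

/-! ### The Whitney approximation of a map at the scale of the distance to the boundary -/

section Whitney

variable {N : ℕ} {Y : Type} [PseudoMetricSpace Y]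

/-- The ratio between the radius of the balls on which the Whitney approximation is controlled
and the distance to the boundary. -/
noncomputable def whitneyScale (N : ℕ) : ℝ := 1 / (16 * (gridColors N + 1))

theorem whitneyScale_pos : 0 < whitneyScale N := by unfold whitneyScale; positivity

/-- The factor 20 = 4 · 5 combines the requirement 4 r i ≤ τ of `LocalControl` with the bound 2^k ≤
5 t for cells near the centre. -/
theorem gridRadius_eq : gridRadius N = whitneyScale N / 20 := by
  unfold gridRadius whitneyScale
  field_simp
  norm_num

theorem gridColors_mul_whitneyScale (a : ℝ) :
    (gridColors N + 1) * (whitneyScale N * a) = a / 16 := by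
  unfold whitneyScale
  field_simp

theorem whitneyScale_le : whitneyScale N ≤ 1 / 16 := by
  have := gridRadius_le (N := N)
  rw [gridRadius_eq] at this
  linarith

/-- The scale τ makes the control ball of radius (M+1)τ equal to the ball of radius t x₀ / 16. There
t hardly varies, so the sizes of the cells lie between t x₀ / 5 and 5 t x₀. This yields the
requirements of `LocalControl` with b = 1/100, and places the cells in the ball over which `oscSq`
is taken. -/
theorem whitney_near {t : Euc N → ℝ} (ht : LipschitzWith 1 t) {x₀ : Euc N} (hx₀ : 0 < t x₀)
    {i : WhitneyIndex t}
    (hi : i ∈ nearIndices (fun i : WhitneyIndex t => gridPoint i.1)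
      (fun i => gridRadius N * 2 ^ i.1.1) x₀ ((gridColors N + 1) * (whitneyScale N * t x₀))) :
    4 * (gridRadius N * 2 ^ i.1.1) ≤ whitneyScale N * t x₀ ∧
      1 / 100 * (whitneyScale N * t x₀) ≤ gridRadius N * 2 ^ i.1.1 ∧
      Metric.closedBall (gridPoint i.1) (gridRadius N * 2 ^ i.1.1)
        ⊆ Metric.ball x₀ (t x₀ / 4) := by
  obtain ⟨y, hy, hyx⟩ := hi
  rw [gridColors_mul_whitneyScale] at hyx
  obtain ⟨h1, h2⟩ := whitney_size ht i hy
  have h3 := ht.dist_le_mul y x₀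
  rw [NNReal.coe_one, one_mul, Real.dist_eq] at h3
  have h4 := abs_le.1 (h3.trans hyx)
  have hs := whitneyScale_pos (N := N)
  have hs' := whitneyScale_le (N := N)
  have h5 : (2 : ℝ) ^ i.1.1 ≤ 5 * t x₀ := by linarith
  have h6 : t x₀ / 5 ≤ (2 : ℝ) ^ i.1.1 := by linarith
  have h7 := mul_le_mul_of_nonneg_left h5 hs.le
  have h8 := mul_le_mul_of_nonneg_left h6 hs.le
  have h9 := mul_le_mul_of_nonneg_right hs' hx₀.le
  rw [gridRadius_eq] at hy ⊢
  refine ⟨by linarith, by linarith, fun z hz => ?_⟩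
  rw [Metric.mem_closedBall] at hz
  rw [Metric.mem_ball]
  have := dist_triangle4 z (gridPoint i.1) y x₀
  rw [dist_comm _ y] at this
  linarith

/-- A constant bounding the inverse volumes of Whitney cells. -/
noncomputable def whitneyVol (N : ℕ) : ℝ≥0∞ :=
  ENNReal.ofReal (100 / whitneyScale N) ^ N * (volume (Metric.ball (0 : Euc N) 1))⁻¹

theorem whitneyVol_ne_top : whitneyVol N ≠ ∞ :=
  ENNReal.mul_ne_top (ENNReal.pow_ne_top ENNReal.ofReal_ne_top)
    (ENNReal.inv_ne_top.2 (Metric.measure_ball_pos _ _ one_pos).ne')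

theorem inv_volume_closedBall_le {c : Euc N} {r a : ℝ} (ha : 0 < a)
    (h : 1 / 100 * (whitneyScale N * a) ≤ r) :
    (volume (Metric.closedBall c r))⁻¹ ≤ whitneyVol N * ENNReal.ofReal a⁻¹ ^ N := by
  have hs := whitneyScale_pos (N := N)
  have hr : 0 < r := lt_of_lt_of_le (by positivity) h
  rw [Measure.addHaar_closedBall volume c hr.le, finrank_euclideanSpace_fin,
    ENNReal.mul_inv (Or.inl (by positivity)) (Or.inl ENNReal.ofReal_ne_top),
    ENNReal.ofReal_pow hr.le, ENNReal.inv_pow, ← ENNReal.ofReal_inv_of_pos hr, whitneyVol,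
    mul_right_comm, ← mul_pow, ← ENNReal.ofReal_mul (by positivity)]
  gcongr
  calc r⁻¹ ≤ (1 / 100 * (whitneyScale N * a))⁻¹ := inv_anti₀ (by positivity) h
    _ = _ := by field_simp

/-- Whitney approximation: a map `U` with values in a contractible space is replaced by a map `w`
which is locally Lipschitz in `{t > 0}`, and controlled by the mean oscillation of `U` over balls
of radius comparable to `t`. -/
theorem exists_whitney_approximation [Nonempty Y] (hY : ConeContractible Y) (N : ℕ) :
    ∃ K : ℝ, 0 ≤ K ∧ ∀ t : Euc N → ℝ, LipschitzWith 1 t → ∀ U : Euc N → Y, StronglyMeasurable U →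
      (∀ x, 0 < t x → oscSq U t x ≠ ∞) → ∃ w : Euc N → Y, ∀ x, 0 < t x →
        (∀ y y', dist y x ≤ whitneyScale N * t x → dist y' x ≤ whitneyScale N * t x →
          dist (w y) (w y') ≤ K * (√(oscSq U t x).toReal / t x) * dist y y') ∧
        edist (w x) (U x) ^ 2 ≤ ENNReal.ofReal K * (oscSq U t x + ENNReal.ofReal (t x)⁻¹ ^ N *
          ∫⁻ z in Metric.ball x (t x / 4), edist (U z) (U x) ^ 2) := by
  set M := gridColors N with hM
  have hs := whitneyScale_pos (N := N)
  have hβ := gridRadius_pos (N := N)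
  obtain ⟨K, hK, hglue⟩ := exists_gluing (E := Euc N) hY M (b := 1 / 100) (by norm_num) M
  set W := whitneyVol N with hW
  have hWtop : W ≠ ∞ := whitneyVol_ne_top
  set K₁ := (10 * W ^ 2).toReal with hK₁
  have hK₁e : ENNReal.ofReal K₁ = 10 * W ^ 2 :=
    ENNReal.ofReal_toReal (ENNReal.mul_ne_top (by norm_num) (ENNReal.pow_ne_top hWtop))
  have hK₁0 : 0 ≤ K₁ := ENNReal.toReal_nonneg
  set K₂ := (2 * (2 * W + 2 * W ^ 2)).toReal with hK₂
  have hK₂e : ENNReal.ofReal K₂ = 2 * (2 * W + 2 * W ^ 2) :=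
    ENNReal.ofReal_toReal (ENNReal.mul_ne_top (by norm_num) (ENNReal.add_ne_top.2
      ⟨ENNReal.mul_ne_top (by norm_num) hWtop, ENNReal.mul_ne_top (by norm_num)
        (ENNReal.pow_ne_top hWtop)⟩))
  have hK₂0 : 0 ≤ K₂ := ENNReal.toReal_nonneg
  refine ⟨K * √K₁ / whitneyScale N + (2 * K ^ 2 * K₁ + K₂), by positivity,
    fun t ht U hU hosc => ?_⟩
  let r : WhitneyIndex t → ℝ := fun i => gridRadius N * 2 ^ i.1.1
  have hr : ∀ i, 0 < r i := fun i => by simp only [r]; positivity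
  choose p hp using fun i : WhitneyIndex t => exists_mean hU (gridPoint i.1) (hr i)
  obtain ⟨w, hw⟩ := hglue (fun i : WhitneyIndex t => gridPoint i.1) r
    (fun i => gridColor i.1) p hr fun i j y hc hi hj => whitney_unique ht i j hc hi hj
  have hunion : ∀ y, 0 < t y → ∃ i : WhitneyIndex t, dist y (gridPoint i.1) ≤ r i ∧
      y ∈ colorUnion (fun i : WhitneyIndex t => gridPoint i.1) r (fun i => gridColor i.1) M := by
    intro y hy
    obtain ⟨i, hi⟩ := exists_whitney_mem ht hy
    exact ⟨i, hi, i, gridColor_lt _, hi⟩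
  refine ⟨w, fun x hx => ?_⟩
  set τ := whitneyScale N * t x with hτ
  have hτ0 : 0 < τ := by positivity
  set o := (oscSq U t x).toReal with ho
  have ho0 : 0 ≤ o := ENNReal.toReal_nonneg
  have hoe : ENNReal.ofReal o = oscSq U t x := ENNReal.ofReal_toReal (hosc x hx)
  -- The selected values near x differ by at most a multiple of the root mean square oscillation of
  -- U over the ball of radius t x / 4.
  have hloc : LocalControl M (1 / 100) (fun i : WhitneyIndex t => gridPoint i.1) r p x τ
      √(K₁ * o) := by
    refine ⟨hτ0, by positivity, fun i hi => (whitney_near ht hx hi).1,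
      fun i hi => (whitney_near ht hx hi).2.1, fun i hi j hj => Real.le_sqrt_of_sq_le ?_⟩
    have h := edist_mean_mean_sq_le hU (hr i) (hr j) (hp i) (hp j)
      (whitney_near ht hx hi).2.2 (whitney_near ht hx hj).2.2
      (inv_volume_closedBall_le hx (whitney_near ht hx hi).2.1)
      (inv_volume_closedBall_le hx (whitney_near ht hx hj).2.1)
    rw [edist_dist, ← ENNReal.ofReal_pow dist_nonneg] at h
    refine (ENNReal.ofReal_le_ofReal_iff (by positivity)).1 (h.trans (le_of_eq ?_))
    rw [ENNReal.ofReal_mul hK₁0, hoe, hK₁e, oscSq]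
    ring
  have hball : ∀ y, dist y x ≤ τ → 0 < t y := by
    intro y hy
    have h1 := ht.dist_le_mul y x
    rw [NNReal.coe_one, one_mul, Real.dist_eq] at h1
    have h2 := abs_le.1 (h1.trans hy)
    have h3 := mul_le_mul_of_nonneg_right (whitneyScale_le (N := N)) hx.le
    rw [hτ] at h2
    linarith
  refine ⟨fun y y' hy hy' => ?_, ?_⟩
  · obtain ⟨-, -, hyV⟩ := hunion y (hball y hy)
    obtain ⟨-, -, hyV'⟩ := hunion y' (hball y' hy')
    -- All M colours have been used, and the radius of control left is (M + 1 - M)τ = τ.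
    have h := (hw x τ _ hloc y hyV (by rw [add_sub_cancel_left, one_mul]; exact hy)).2 y' hyV'
      (by rw [add_sub_cancel_left, one_mul]; exact hy')
    refine h.trans ?_
    rw [Real.sqrt_mul hK₁0]
    gcongr ?_ * _
    calc K * (√K₁ * √o / τ) = K * √K₁ / whitneyScale N * (√o / t x) := by
          rw [hτ]; field_simp
      _ ≤ _ := by
          gcongr
          linarith [show 0 ≤ 2 * K ^ 2 * K₁ + K₂ by positivity]
  · obtain ⟨i, hi, hxV⟩ := hunion x hx
    have hnear : i ∈ nearIndices (fun i : WhitneyIndex t => gridPoint i.1) r x ((M + 1) * τ) :=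
      ⟨x, by linarith [hr i], by rw [dist_self]; positivity⟩
    have h := (hw x τ _ hloc x hxV (by rw [dist_self, add_sub_cancel_left, one_mul]
                                       exact hτ0.le)).1 i hnear
    have h1 : edist (w x) (p i) ^ 2 ≤ ENNReal.ofReal (K ^ 2 * K₁) * oscSq U t x := by
      rw [edist_dist, ← ENNReal.ofReal_pow dist_nonneg, ← hoe, ← ENNReal.ofReal_mul (by positivity)]
      refine ENNReal.ofReal_le_ofReal ((pow_le_pow_left₀ dist_nonneg h 2).trans (le_of_eq ?_))
      rw [mul_pow, Real.sq_sqrt (by positivity)]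
      ring
    have hV := inv_volume_closedBall_le (c := gridPoint i.1) hx (whitney_near ht hx hnear).2.1
    have hsub := (whitney_near ht hx hnear).2.2
    set V := ENNReal.ofReal (t x)⁻¹ ^ N with hVdef
    set S := ∫⁻ z in Metric.ball x (t x / 4), ∫⁻ z' in Metric.ball x (t x / 4),
      edist (U z) (U z') ^ 2 with hS
    set S' := ∫⁻ z in Metric.ball x (t x / 4), edist (U z) (U x) ^ 2 with hS'
    have hoscS : oscSq U t x = V ^ 2 * S := by
      rw [oscSq, hVdef, ← pow_mul, mul_comm N 2]
    have h2 : edist (p i) (U x) ^ 2 ≤ (2 * W + 2 * W ^ 2) * (oscSq U t x + V * S') := by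
      have hA : ∫⁻ z in Metric.closedBall (gridPoint i.1) (r i), edist (p i) (U z) ^ 2
          ≤ W * V * S :=
        (hp i).trans (mul_le_mul' hV ((lintegral_mono fun z => lintegral_mono_set hsub).trans
          (lintegral_mono_set hsub)))
      have hB : ∫⁻ z in Metric.closedBall (gridPoint i.1) (r i), edist (U z) (U x) ^ 2 ≤ S' :=
        lintegral_mono_set hsub
      refine (edist_mean_sq_le hU (hr i) hA (U x)).trans ?_
      calc (volume (Metric.closedBall (gridPoint i.1) (r i)))⁻¹ * (2 * (W * V * S))
            + (volume (Metric.closedBall (gridPoint i.1) (r i)))⁻¹ *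
              (2 * ∫⁻ z in Metric.closedBall (gridPoint i.1) (r i), edist (U z) (U x) ^ 2)
          ≤ W * V * (2 * (W * V * S)) + W * V * (2 * S') := by gcongr
        _ = 2 * W ^ 2 * oscSq U t x + 2 * W * (V * S') := by rw [hoscS]; ring
        _ ≤ (2 * W + 2 * W ^ 2) * oscSq U t x + (2 * W + 2 * W ^ 2) * (V * S') := by
            gcongr
            · exact le_add_self
            · exact le_self_add
        _ = _ := by ring
    calc edist (w x) (U x) ^ 2 ≤ 2 * (edist (w x) (p i) ^ 2 + edist (p i) (U x) ^ 2) :=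
          edist_sq_le_two_mul _ _ _
      _ ≤ 2 * (ENNReal.ofReal (K ^ 2 * K₁) * oscSq U t x
          + (2 * W + 2 * W ^ 2) * (oscSq U t x + V * S')) := by gcongr
      _ ≤ 2 * (ENNReal.ofReal (K ^ 2 * K₁) * (oscSq U t x + V * S')
          + (2 * W + 2 * W ^ 2) * (oscSq U t x + V * S')) := by gcongr; exact le_self_add
      _ = ENNReal.ofReal (2 * K ^ 2 * K₁ + K₂) * (oscSq U t x + V * S') := by
          rw [ENNReal.ofReal_add (by positivity) hK₂0, hK₂e, mul_assoc 2,
            ENNReal.ofReal_mul zero_le_two, ENNReal.ofReal_ofNat]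
          ring
      _ ≤ _ := mul_le_mul' (ENNReal.ofReal_le_ofReal
          (le_add_of_nonneg_left (by positivity))) le_rfl

end Whitney

/-! ### Integrated bounds for the oscillation -/

section Energy

variable {N : ℕ} {Y : Type} [PseudoMetricSpace Y]

/-- The scale invariant double integral which controls the energy of the Whitney approximation
of `U` in `{t > 0}`. -/
noncomputable def whitneyEnergy (U : Euc N → Y) (t : Euc N → ℝ) : ℝ≥0∞ :=
  ∫⁻ z in {z | 0 < t z}, ENNReal.ofReal (t z)⁻¹ ^ (N + 2) *
    ∫⁻ z' in Metric.ball z (2 / 3 * t z), edist (U z) (U z') ^ 2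

theorem measurable_setLIntegral_ball {f : Euc N × Euc N → ℝ≥0∞} (hf : Measurable f)
    {ρ : Euc N → ℝ} (hρ : Measurable ρ) :
    Measurable fun z => ∫⁻ z' in Metric.ball z (ρ z), f (z, z') := by
  have hS : MeasurableSet {p : Euc N × Euc N | dist p.2 p.1 < ρ p.1} :=
    measurableSet_lt (measurable_snd.dist measurable_fst) (hρ.comp measurable_fst)
  have : (fun z => ∫⁻ z' in Metric.ball z (ρ z), f (z, z'))
      = fun z => ∫⁻ z', {p : Euc N × Euc N | dist p.2 p.1 < ρ p.1}.indicator f (z, z') := by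
    funext z
    rw [← lintegral_indicator measurableSet_ball]
    rfl
  rw [this]
  exact (hf.indicator hS).lintegral_prod_right'

theorem measurable_oscSq {U : Euc N → Y} (hU : StronglyMeasurable U) {t : Euc N → ℝ}
    (ht : Measurable t) : Measurable (oscSq U t) := by
  refine (ht.inv.ennreal_ofReal.pow_const _).mul ?_
  have hm : Measurable fun q : Euc N × Euc N => ∫⁻ z' in Metric.ball q.1 (t q.1 / 4),
      edist (U q.2) (U z') ^ 2 := by
    have hS : MeasurableSet {p : (Euc N × Euc N) × Euc N | dist p.2 p.1.1 < t p.1.1 / 4} :=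
      measurableSet_lt (measurable_snd.dist (measurable_fst.comp measurable_fst))
        ((ht.comp (measurable_fst.comp measurable_fst)).div_const 4)
    have hf : Measurable fun p : (Euc N × Euc N) × Euc N => edist (U p.1.2) (U p.2) ^ 2 :=
      hU.measurable_edist_sq.comp ((measurable_snd.comp measurable_fst).prodMk measurable_snd)
    have : (fun q : Euc N × Euc N => ∫⁻ z' in Metric.ball q.1 (t q.1 / 4),
        edist (U q.2) (U z') ^ 2) = fun q => ∫⁻ z',
          {p : (Euc N × Euc N) × Euc N | dist p.2 p.1.1 < t p.1.1 / 4}.indicator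
            (fun p => edist (U p.1.2) (U p.2) ^ 2) (q, z') := by
      funext q
      rw [← lintegral_indicator measurableSet_ball]
      rfl
    rw [this]
    exact (hf.indicator hS).lintegral_prod_right'
  exact measurable_setLIntegral_ball hm (ht.div_const 4)

/-- The Lipschitz bounds for w involve `oscSq` through `toReal`, which would turn an infinite value
into 0; finiteness is therefore needed at every point. -/
theorem oscSq_ne_top {U : Euc N → Y} {t : Euc N → ℝ} {x : Euc N} {y₀ : Y}
    (h : ∫⁻ z in Metric.ball x (t x / 4), edist (U z) y₀ ^ 2 ≠ ∞)
    (hU : StronglyMeasurable U) : oscSq U t x ≠ ∞ := by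
  refine ENNReal.mul_ne_top (ENNReal.pow_ne_top ENNReal.ofReal_ne_top) ?_
  have hm : Measurable fun z => edist (U z) y₀ ^ 2 :=
    (hU.edist stronglyMeasurable_const).measurable.pow_const 2
  have hv : volume (Metric.ball x (t x / 4)) ≠ ∞ := measure_ball_lt_top.ne
  refine ne_top_of_le_ne_top (b := 2 * ((∫⁻ z in Metric.ball x (t x / 4), edist (U z) y₀ ^ 2) *
    volume (Metric.ball x (t x / 4)) + (∫⁻ z in Metric.ball x (t x / 4), edist (U z) y₀ ^ 2) *
    volume (Metric.ball x (t x / 4)))) ?_ ?_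
  · exact ENNReal.mul_ne_top (by norm_num) (ENNReal.add_ne_top.2
      ⟨ENNReal.mul_ne_top h hv, ENNReal.mul_ne_top h hv⟩)
  · calc ∫⁻ z in Metric.ball x (t x / 4), ∫⁻ z' in Metric.ball x (t x / 4),
          edist (U z) (U z') ^ 2
        ≤ ∫⁻ z in Metric.ball x (t x / 4), ∫⁻ z' in Metric.ball x (t x / 4),
          2 * (edist (U z) y₀ ^ 2 + edist (U z') y₀ ^ 2) := by
          refine lintegral_mono fun z => lintegral_mono fun z' => ?_
          rw [edist_comm (U z') y₀]
          exact edist_sq_le_two_mul _ _ _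
      _ = _ := by
          simp_rw [lintegral_const_mul' 2 _ ENNReal.ofNat_ne_top, lintegral_add_left
            measurable_const, setLIntegral_const]
          rw [lintegral_add_right _ measurable_const, setLIntegral_const,
            lintegral_mul_const _ hm]

/-- Fubini in x and z. If |z - x| < t x / 4 then t x ≤ 4/3 t z and t z ≤ 5/4 t x, so x lies in the
ball of radius t z / 3 at z, and the ball of radius t x / 4 at x lies in that of radius 2/3 t z at
z. Integrating out x gains the volume of order (t z)^N, which reduces the weight from 2N + 2 to N +
2. -/
theorem lintegral_oscSq_le {U : Euc N → Y} (hU : StronglyMeasurable U) {t : Euc N → ℝ}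
    (ht : LipschitzWith 1 t) :
    ∫⁻ x in {x | 0 < t x}, ENNReal.ofReal (t x)⁻¹ ^ 2 * oscSq U t x
      ≤ ENNReal.ofReal (5 / 4) ^ (2 * N + 2) * volume (Metric.ball (0 : Euc N) 1) *
        whitneyEnergy U t := by
  have htm : Measurable t := ht.continuous.measurable
  have hA : MeasurableSet {x | 0 < t x} := measurableSet_lt measurable_const htm
  set c := ENNReal.ofReal (5 / 4) ^ (2 * N + 2) with hc
  set g : Euc N → ℝ≥0∞ := fun z => c * (ENNReal.ofReal (t z)⁻¹ ^ (2 * N + 2) *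
    ∫⁻ z' in Metric.ball z (2 / 3 * t z), edist (U z) (U z') ^ 2) with hg
  have hinner : Measurable fun z => ∫⁻ z' in Metric.ball z (2 / 3 * t z),
      edist (U z) (U z') ^ 2 :=
    measurable_setLIntegral_ball hU.measurable_edist_sq (htm.const_mul _)
  have hgm : Measurable g :=
    ((htm.inv.ennreal_ofReal.pow_const _).mul hinner).const_mul c
  set S : Set (Euc N × Euc N) := {p | dist p.1 p.2 < t p.2 / 3 ∧ 0 < t p.2} with hS
  have hSm : MeasurableSet S :=
    (measurableSet_lt (measurable_fst.dist measurable_snd)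
      ((htm.comp measurable_snd).div_const 3)).inter
      (measurableSet_lt measurable_const (htm.comp measurable_snd))
  have hfm : Measurable (S.indicator fun p => g p.2) := (hgm.comp measurable_snd).indicator hSm
  calc ∫⁻ x in {x | 0 < t x}, ENNReal.ofReal (t x)⁻¹ ^ 2 * oscSq U t x
      ≤ ∫⁻ x in {x | 0 < t x}, ∫⁻ z, S.indicator (fun p => g p.2) (x, z) := by
        refine setLIntegral_mono' hA fun x (hx : 0 < t x) => ?_
        rw [oscSq, ← mul_assoc, ← pow_add, ← lintegral_const_mul' _ _
          (ENNReal.pow_ne_top ENNReal.ofReal_ne_top), ← lintegral_indicator measurableSet_ball]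
        refine lintegral_mono fun z => ?_
        by_cases hz : z ∈ Metric.ball x (t x / 4)
        · rw [Set.indicator_of_mem hz]
          rw [Metric.mem_ball] at hz
          have h1 := ht.dist_le_mul z x
          rw [NNReal.coe_one, one_mul, Real.dist_eq] at h1
          have h2 := abs_le.1 h1
          have hzpos : 0 < t z := by linarith
          have hmem : (x, z) ∈ S := ⟨by rw [dist_comm]; simp only; linarith, hzpos⟩
          rw [Set.indicator_of_mem hmem]
          simp only [hg, hc]
          rw [← mul_assoc, ← mul_pow, ← ENNReal.ofReal_mul (by norm_num), add_comm 2 (2 * N)]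
          gcongr
          · rw [inv_le_iff_one_le_mul₀ hx, mul_right_comm, ← div_eq_mul_inv,
              one_le_div hzpos]
            linarith
          · intro z' hz'
            rw [Metric.mem_ball] at hz' ⊢
            have := dist_triangle_right z' z x
            linarith
        · rw [Set.indicator_of_notMem hz]
          exact zero_le
    _ ≤ ∫⁻ x, ∫⁻ z, S.indicator (fun p => g p.2) (x, z) := setLIntegral_le_lintegral _ _
    _ = ∫⁻ z, ∫⁻ x, S.indicator (fun p => g p.2) (x, z) :=
        lintegral_lintegral_swap (f := fun x z => S.indicator (fun p => g p.2) (x, z))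
          hfm.aemeasurable
    _ = ∫⁻ z in {z | 0 < t z}, g z * volume (Metric.ball z (t z / 3)) := by
        rw [← lintegral_indicator hA]
        refine lintegral_congr fun z => ?_
        by_cases hz : 0 < t z
        · rw [Set.indicator_of_mem (by exact hz), ← setLIntegral_const,
            ← lintegral_indicator measurableSet_ball]
          refine lintegral_congr fun x => ?_
          by_cases hx : x ∈ Metric.ball z (t z / 3)
          · rw [Set.indicator_of_mem hx, Set.indicator_of_mem (by exact ⟨hx, hz⟩)]
          · rw [Set.indicator_of_notMem hx, Set.indicator_of_notMem (by exact fun h => hx h.1)]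
        · rw [Set.indicator_of_notMem (by exact hz)]
          refine (lintegral_congr fun x => ?_).trans lintegral_zero
          rw [Set.indicator_of_notMem (by exact fun h => hz h.2)]
    _ ≤ ∫⁻ z in {z | 0 < t z}, c * volume (Metric.ball (0 : Euc N) 1) *
          (ENNReal.ofReal (t z)⁻¹ ^ (N + 2) *
            ∫⁻ z' in Metric.ball z (2 / 3 * t z), edist (U z) (U z') ^ 2) := by
        refine setLIntegral_mono' hA fun z (hz : 0 < t z) => ?_
        rw [Measure.addHaar_ball_of_pos volume z (by positivity), finrank_euclideanSpace_fin]
        have h1 : ENNReal.ofReal (t z)⁻¹ ^ (2 * N + 2) * ENNReal.ofReal ((t z / 3) ^ N)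
            ≤ ENNReal.ofReal (t z)⁻¹ ^ (N + 2) := by
          rw [show 2 * N + 2 = (N + 2) + N by ring, pow_add, mul_assoc,
            ENNReal.ofReal_pow (by positivity) N, ← mul_pow, ← ENNReal.ofReal_mul (by positivity)]
          refine mul_le_of_le_one_right zero_le (pow_le_one₀ zero_le ?_)
          rw [ENNReal.ofReal_le_one, mul_div_assoc', inv_mul_cancel₀ hz.ne']
          norm_num
        simp only [hg]
        calc _ = c * volume (Metric.ball (0 : Euc N) 1) *
              ((ENNReal.ofReal (t z)⁻¹ ^ (2 * N + 2) * ENNReal.ofReal ((t z / 3) ^ N)) *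
                ∫⁻ z' in Metric.ball z (2 / 3 * t z), edist (U z) (U z') ^ 2) := by ring
          _ ≤ _ := by gcongr
    _ = _ := by
        rw [lintegral_const_mul' _ _ (ENNReal.mul_ne_top
          (ENNReal.pow_ne_top ENNReal.ofReal_ne_top) measure_ball_lt_top.ne), whitneyEnergy]

/-- Together with `lintegral_oscSq_le` this bounds the integral of d(w,U)²/t², on which the
existence of traces rests. -/
theorem lintegral_ball_edist_le (U : Euc N → Y) {t : Euc N → ℝ} (ht : Measurable t) :
    ∫⁻ x in {x | 0 < t x}, ENNReal.ofReal (t x)⁻¹ ^ 2 * (ENNReal.ofReal (t x)⁻¹ ^ N *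
      ∫⁻ z in Metric.ball x (t x / 4), edist (U z) (U x) ^ 2) ≤ whitneyEnergy U t := by
  refine setLIntegral_mono' (measurableSet_lt measurable_const ht) fun x (hx : 0 < t x) => ?_
  rw [← mul_assoc, ← pow_add, add_comm 2 N]
  simp only [edist_comm _ (U x)]
  gcongr
  linarith

end Energy

/-! ### Polar coordinates -/

section Polar

variable {N : ℕ}

/-- The measure `r ^ (N - 1) dr` on the half-line. -/
noncomputable def radialMeas (N : ℕ) : Measure ℝ :=
  (volume.restrict (Ioi 0)).withDensity fun r => ENNReal.ofReal (r ^ (N - 1))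

instance : SFinite (radialMeas N) := by unfold radialMeas; infer_instance

theorem measurePreserving_val_volumeIoiPow (n : ℕ) :
    MeasurePreserving (Subtype.val : Ioi (0 : ℝ) → ℝ) (Measure.volumeIoiPow n)
      ((volume.restrict (Ioi 0)).withDensity fun r => ENNReal.ofReal (r ^ n)) := by
  refine ⟨measurable_subtype_coe, ?_⟩
  ext s hs
  rw [Measure.map_apply measurable_subtype_coe hs, Measure.volumeIoiPow,
    withDensity_apply _ (measurable_subtype_coe hs), withDensity_apply _ hs,
    Measure.restrict_restrict hs, setLIntegral_subtype measurableSet_Ioi _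
      fun a : ℝ => ENNReal.ofReal (a ^ n), Subtype.image_preimage_coe, inter_comm]

theorem measurePreserving_polar (hN : 0 < N) :
    MeasurePreserving (fun p : USphere N × ℝ => p.2 • (p.1 : Euc N))
      ((sphMeas N).prod (radialMeas N)) volume := by
  have : Nontrivial (Euc N) := by
    have : Nonempty (Fin N) := ⟨⟨0, hN⟩⟩
    infer_instance
  have hm : Measurable fun p : USphere N × ℝ => p.2 • (p.1 : Euc N) :=
    measurable_snd.smul (measurable_subtype_coe.comp measurable_fst)
  have h1 : MeasurePreserving (Prod.map id (Subtype.val : Ioi (0 : ℝ) → ℝ))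
      ((sphMeas N).prod (Measure.volumeIoiPow (N - 1)))
      ((sphMeas N).prod (radialMeas N)) :=
    (MeasurePreserving.id _).prod (measurePreserving_val_volumeIoiPow (N - 1))
  have h2 := (volume : Measure (Euc N)).measurePreserving_homeomorphUnitSphereProd
  rw [finrank_euclideanSpace_fin] at h2
  have h3 := h2.symm (homeomorphUnitSphereProd (Euc N)).toMeasurableEquiv
  have h4 : MeasurePreserving (Subtype.val : ({0}ᶜ : Set (Euc N)) → Euc N)
      (Measure.comap Subtype.val volume) volume := by
    refine ⟨measurable_subtype_coe, ?_⟩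
    rw [(MeasurableEmbedding.subtype_coe (measurableSet_singleton _).compl).map_comap,
      Subtype.range_coe, restrict_compl_singleton]
  refine ⟨hm, ?_⟩
  rw [← h1.map_eq, Measure.map_map hm h1.measurable]
  exact (h4.comp h3).map_eq

theorem lintegral_radialMeas {f : ℝ → ℝ≥0∞} (hf : Measurable f) :
    ∫⁻ r, f r ∂(radialMeas N) = ∫⁻ r in Ioi 0, ENNReal.ofReal (r ^ (N - 1)) * f r := by
  rw [radialMeas, lintegral_withDensity_eq_lintegral_mul _ (by fun_prop) hf]
  rfl

theorem integral_radialMeas (f : ℝ → ℝ) :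
    ∫ r, f r ∂(radialMeas N) = ∫ r in Ioi 0, r ^ (N - 1) * f r := by
  have hm : Measurable fun r : ℝ => ENNReal.ofReal (r ^ (N - 1)) := by fun_prop
  rw [radialMeas, integral_withDensity_eq_integral_toReal_smul hm
    (ae_of_all _ fun _ => ENNReal.ofReal_lt_top)]
  refine setIntegral_congr_fun measurableSet_Ioi fun r (hr : 0 < r) => ?_
  simp only [smul_eq_mul]
  rw [ENNReal.toReal_ofReal (by positivity)]

theorem lintegral_polar (hN : 0 < N) {F : Euc N → ℝ≥0∞} (hF : Measurable F) :
    ∫⁻ x, F x = ∫⁻ ω : USphere N,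
      (∫⁻ r in Ioi (0 : ℝ), ENNReal.ofReal (r ^ (N - 1)) * F (r • (ω : Euc N))) ∂(sphMeas N) := by
  have h := measurePreserving_polar hN
  have hm : Measurable fun p : USphere N × ℝ => F (p.2 • (p.1 : Euc N)) := hF.comp h.measurable
  rw [← h.lintegral_comp hF, lintegral_prod _ hm.aemeasurable]
  refine lintegral_congr fun ω => lintegral_radialMeas ?_
  exact hm.comp measurable_prodMk_left

theorem integral_polar (hN : 0 < N) {F : Euc N → ℝ} (hF : Integrable F) :
    ∫ x, F x = ∫ ω : USphere N,
      (∫ r in Ioi (0 : ℝ), r ^ (N - 1) * F (r • (ω : Euc N))) ∂(sphMeas N) := by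
  have h := measurePreserving_polar hN
  have h1 : Integrable (fun p : USphere N × ℝ => F (p.2 • (p.1 : Euc N)))
      ((sphMeas N).prod (radialMeas N)) := (h.integrable_comp hF.aestronglyMeasurable).2 hF
  rw [← h.map_eq, integral_map h.measurable.aemeasurable
    (by rw [h.map_eq]; exact hF.aestronglyMeasurable), integral_prod _ h1]
  exact integral_congr_ae (ae_of_all _ fun ω => integral_radialMeas _)

end Polar

/-! ### Radial cut-off functions and one-dimensional integration by parts -/

section Cutoff

/-- Radial cut-off functions for the annulus `R < r < 1`. -/
theorem exists_cutoff (R : ℝ) :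
    ∃ (k : ℕ → ℝ → ℝ) (δ : ℕ → ℝ) (M : ℝ), (∀ n, ContDiff ℝ 1 (k n)) ∧
      (∀ n, ∃ L, LipschitzWith L (k n)) ∧ (∀ n, 0 < δ n) ∧
      (∀ n r, 0 ≤ k n r ∧ k n r ≤ 1) ∧
      (∀ n r, k n r ≠ 0 → R + δ n ≤ r ∧ r ≤ 1 - δ n) ∧
      (∀ r ∈ Ioo R 1, ∀ᶠ n in atTop, ∀ᶠ r' in nhds r, k n r' = 1) ∧
      (∀ n, ∀ r ∈ Ioo R 1, |deriv (k n) r| ≤ M * (min (1 - r) (r - R))⁻¹) := by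
  -- η is 0 up to 1 and 1 from 2 on, so its derivative at d/δ vanishes unless δ ≤ d ≤ 2δ, and there
  -- 1/δ ≤ 2/d. The two factors of the cut-off together give the constant 4M, independent of δ.
  set η : ℝ → ℝ := fun s => Real.smoothTransition (s - 1) with hη
  have hηC : ContDiff ℝ 1 η := Real.smoothTransition.contDiff.comp (contDiff_id.sub contDiff_const)
  have hη0 : ∀ s ≤ 1, η s = 0 := fun s hs =>
    Real.smoothTransition.zero_of_nonpos (by linarith)
  have hη1 : ∀ s, 2 ≤ s → η s = 1 := fun s hs =>
    Real.smoothTransition.one_of_one_le (by linarith)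
  have hdη : ∀ s, s ∉ Icc (1 : ℝ) 2 → deriv η s = 0 := by
    intro s hs
    rw [mem_Icc, not_and_or, not_le, not_le] at hs
    rcases hs with hs | hs
    · have : η =ᶠ[nhds s] fun _ => 0 := by
        filter_upwards [Iio_mem_nhds hs] with y hy using hη0 y (le_of_lt hy)
      rw [this.deriv_eq, deriv_const]
    · have : η =ᶠ[nhds s] fun _ => 1 := by
        filter_upwards [Ioi_mem_nhds hs] with y hy using hη1 y (le_of_lt hy)
      rw [this.deriv_eq, deriv_const]
  have hdηC : Continuous (deriv η) := hηC.continuous_deriv le_rfl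
  obtain ⟨M, hM⟩ : ∃ M, ∀ s, |deriv η s| ≤ M := by
    obtain ⟨M, hM⟩ := isCompact_Icc.exists_bound_of_continuousOn
      (s := Icc (1 : ℝ) 2) hdηC.continuousOn
    refine ⟨max M 0, fun s => ?_⟩
    by_cases hs : s ∈ Icc (1 : ℝ) 2
    · exact (hM s hs).trans (le_max_left _ _)
    · rw [hdη s hs, abs_zero]; exact le_max_right _ _
  have hM0 : 0 ≤ M := (abs_nonneg _).trans (hM 0)
  set δ : ℕ → ℝ := fun n => 1 / ((n : ℝ) + 1) with hδ
  have hδ0 : ∀ n, 0 < δ n := fun n => by simp only [hδ]; positivity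
  have hd1 : ∀ n r, HasDerivAt (fun r => η ((1 - r) / δ n)) (deriv η ((1 - r) / δ n) * (-1 / δ n))
      r := by
    intro n r
    have h1 : HasDerivAt (fun r : ℝ => (1 - r) / δ n) (-1 / δ n) r :=
      ((hasDerivAt_id r).const_sub 1).div_const _
    exact ((hηC.differentiable one_ne_zero) _).hasDerivAt.comp r h1
  have hd2 : ∀ n r, HasDerivAt (fun r => η ((r - R) / δ n)) (deriv η ((r - R) / δ n) * (1 / δ n))
      r := by
    intro n r
    have h1 : HasDerivAt (fun r : ℝ => (r - R) / δ n) (1 / δ n) r :=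
      ((hasDerivAt_id r).sub_const R).div_const _
    exact ((hηC.differentiable one_ne_zero) _).hasDerivAt.comp r h1
  have hη01 : ∀ s, 0 ≤ η s ∧ η s ≤ 1 := fun s =>
    ⟨Real.smoothTransition.nonneg _, Real.smoothTransition.le_one _⟩
  have hder : ∀ n r, deriv (fun r => η ((1 - r) / δ n) * η ((r - R) / δ n)) r
      = deriv η ((1 - r) / δ n) * (-1 / δ n) * η ((r - R) / δ n)
        + η ((1 - r) / δ n) * (deriv η ((r - R) / δ n) * (1 / δ n)) := fun n r =>
    ((hd1 n r).mul (hd2 n r)).deriv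
  have hbd : ∀ n r, |deriv (fun r => η ((1 - r) / δ n) * η ((r - R) / δ n)) r|
      ≤ |deriv η ((1 - r) / δ n)| / δ n + |deriv η ((r - R) / δ n)| / δ n := by
    intro n r
    rw [hder]
    refine (abs_add_le _ _).trans (add_le_add ?_ ?_)
    · rw [abs_mul, abs_mul, abs_div, abs_neg, abs_one, abs_of_pos (hδ0 n), ← div_eq_mul_one_div,
        abs_of_nonneg (hη01 _).1]
      exact mul_le_of_le_one_right (div_nonneg (abs_nonneg _) (hδ0 n).le) (hη01 _).2
    · rw [abs_mul, abs_mul, abs_div, abs_one, abs_of_pos (hδ0 n), ← div_eq_mul_one_div,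
        abs_of_nonneg (hη01 _).1]
      exact mul_le_of_le_one_left (div_nonneg (abs_nonneg _) (hδ0 n).le) (hη01 _).2
  refine ⟨fun n r => η ((1 - r) / δ n) * η ((r - R) / δ n), δ, 4 * M, fun n => ?_, fun n => ?_,
    hδ0, fun n r => ?_, fun n r hr => ?_, fun r hr => ?_, fun n r hr => ?_⟩
  · exact (hηC.comp ((contDiff_const.sub contDiff_id).div_const _)).mul
      (hηC.comp ((contDiff_id.sub contDiff_const).div_const _))
  · refine ⟨Real.toNNReal (M / δ n + M / δ n), lipschitzWith_of_nnnorm_deriv_le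
      (fun r => ((hd1 n r).mul (hd2 n r)).differentiableAt) fun r => ?_⟩
    rw [← NNReal.coe_le_coe, coe_nnnorm, Real.norm_eq_abs,
      Real.coe_toNNReal _ (by have := hδ0 n; positivity)]
    refine (hbd n r).trans ?_
    have := hδ0 n
    gcongr <;> exact hM _
  · exact ⟨mul_nonneg (hη01 _).1 (hη01 _).1, mul_le_one₀ (hη01 _).2 (hη01 _).1 (hη01 _).2⟩
  · have h1 : 1 < (1 - r) / δ n := by
      by_contra! h
      exact hr (by simp only; rw [hη0 _ h, zero_mul])
    have h2 : 1 < (r - R) / δ n := by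
      by_contra! h
      exact hr (by simp only; rw [hη0 _ h, mul_zero])
    rw [one_lt_div (hδ0 n)] at h1 h2
    constructor <;> linarith
  · have hlim : Tendsto δ atTop (nhds 0) := tendsto_one_div_add_atTop_nhds_zero_nat
    have hpos : 0 < min (1 - r) (r - R) := lt_min (by linarith [hr.2]) (by linarith [hr.1])
    filter_upwards [hlim.eventually (gt_mem_nhds (show 0 < min (1 - r) (r - R) / 4 by linarith))]
      with n hn
    have h1 := min_le_left (1 - r) (r - R)
    have h2 := min_le_right (1 - r) (r - R)
    filter_upwards [Ioo_mem_nhds (show r - min (1 - r) (r - R) / 4 < r by linarith)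
      (show r < r + min (1 - r) (r - R) / 4 by linarith)] with r' hr'
    rw [hη1 _ ((le_div_iff₀ (hδ0 n)).2 (by linarith [hr'.1, hr'.2])),
      hη1 _ ((le_div_iff₀ (hδ0 n)).2 (by linarith [hr'.1, hr'.2])), one_mul]
  · refine (hbd n r).trans ?_
    have hpos : 0 < min (1 - r) (r - R) := lt_min (by linarith [hr.2]) (by linarith [hr.1])
    have key : ∀ d, min (1 - r) (r - R) ≤ d → |deriv η (d / δ n)| / δ n
        ≤ 2 * M * (min (1 - r) (r - R))⁻¹ := by
      intro d hd
      by_cases hs : d / δ n ∈ Icc (1 : ℝ) 2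
      · have h2 := (div_le_iff₀ (hδ0 n)).1 hs.2
        have h3 : 1 / δ n ≤ 2 * (min (1 - r) (r - R))⁻¹ := by
          rw [← div_eq_mul_inv, div_le_div_iff₀ (hδ0 n) hpos]
          linarith
        calc |deriv η (d / δ n)| / δ n = |deriv η (d / δ n)| * (1 / δ n) := by ring
          _ ≤ M * (2 * (min (1 - r) (r - R))⁻¹) :=
            mul_le_mul (hM _) h3 (by have := hδ0 n; positivity) hM0
          _ = _ := by ring
      · rw [hdη _ hs, abs_zero, zero_div]
        positivity
    have h1 := key _ (min_le_left _ _)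
    have h2 := key _ (min_le_right _ _)
    linarith

/-- Integration by parts in one variable, against cut-off functions converging to `1`. -/
theorem tendsto_integral_mul_deriv_cutoff {p q : ℝ} (hpq : p ≤ q) {ψ ψ' : ℝ → ℝ}
    (hψ : ∀ r, HasDerivAt ψ (ψ' r) r) (hψ' : Continuous ψ') {k : ℕ → ℝ → ℝ}
    (hk : ∀ n, ContDiff ℝ 1 (k n)) (hk1 : ∀ n r, |k n r| ≤ 1)
    (hlim : ∀ r ∈ Ioo p q, Tendsto (fun n => k n r) atTop (nhds 1)) {a b : ℝ}
    (ha : Tendsto (fun n => k n p) atTop (nhds a)) (hb : Tendsto (fun n => k n q) atTop (nhds b)) :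
    Tendsto (fun n => ∫ r in p..q, ψ r * deriv (k n) r) atTop
      (nhds (ψ q * b - ψ p * a - (ψ q - ψ p))) := by
  have hdk : ∀ n, Continuous (deriv (k n)) := fun n => (hk n).continuous_deriv le_rfl
  have h1 : ∀ n, ∫ r in p..q, ψ r * deriv (k n) r
      = ψ q * k n q - ψ p * k n p - ∫ r in p..q, ψ' r * k n r := fun n =>
    intervalIntegral.integral_mul_deriv_eq_deriv_mul (fun r _ => hψ r)
      (fun r _ => ((hk n).differentiable one_ne_zero r).hasDerivAt)
      (hψ'.intervalIntegrable _ _) ((hdk n).intervalIntegrable _ _)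
  have h2 : ∫ r in p..q, ψ' r * 1 = ψ q - ψ p := by
    simp only [mul_one]
    exact intervalIntegral.integral_eq_sub_of_hasDerivAt (fun r _ => hψ r)
      (hψ'.intervalIntegrable _ _)
  simp only [h1]
  rw [← h2]
  refine ((tendsto_const_nhds.mul hb).sub (tendsto_const_nhds.mul ha)).sub ?_
  refine intervalIntegral.tendsto_integral_filter_of_dominated_convergence (fun r => |ψ' r|)
    (Eventually.of_forall fun n => (hψ'.mul (hk n).continuous).aestronglyMeasurable)
    (Eventually.of_forall fun n => ae_of_all _ fun r _ => ?_)
    (hψ'.abs.intervalIntegrable _ _) ?_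
  · rw [Real.norm_eq_abs, abs_mul]
    exact mul_le_of_le_one_right (abs_nonneg _) (hk1 n r)
  · have hq : ∀ᵐ r : ℝ, r ≠ q := Measure.ae_ne volume q
    filter_upwards [hq] with r hr hmem
    rw [uIoc_of_le hpq] at hmem
    exact tendsto_const_nhds.mul (hlim r ⟨hmem.1, lt_of_le_of_ne hmem.2 hr⟩)

/-- The bound does not involve the size of the derivative of k, which blows up along the sequence of
cut-offs. It provides the domination for the limit on the sphere. -/
theorem abs_integral_mul_deriv_cutoff_le {p q : ℝ} (hpq : p ≤ q) {ψ ψ' : ℝ → ℝ}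
    (hψ : ∀ r, HasDerivAt ψ (ψ' r) r) (hψ' : Continuous ψ') {k : ℝ → ℝ}
    (hk : ContDiff ℝ 1 k) (hk1 : ∀ r, |k r| ≤ 1) {B : ℝ} (hB : ∀ r ∈ Icc p q, |ψ r| ≤ B)
    (hB' : ∀ r ∈ Icc p q, |ψ' r| ≤ B) :
    |∫ r in p..q, ψ r * deriv k r| ≤ B * (2 + (q - p)) := by
  have hdk : Continuous (deriv k) := hk.continuous_deriv le_rfl
  have h1 : ∫ r in p..q, ψ r * deriv k r
      = ψ q * k q - ψ p * k p - ∫ r in p..q, ψ' r * k r :=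
    intervalIntegral.integral_mul_deriv_eq_deriv_mul (fun r _ => hψ r)
      (fun r _ => (hk.differentiable one_ne_zero r).hasDerivAt)
      (hψ'.intervalIntegrable _ _) (hdk.intervalIntegrable _ _)
  have hB0 : 0 ≤ B := (abs_nonneg _).trans (hB p ⟨le_rfl, hpq⟩)
  have h2 : |∫ r in p..q, ψ' r * k r| ≤ B * |q - p| := by
    refine intervalIntegral.norm_integral_le_of_norm_le_const (f := fun r => ψ' r * k r)
      fun r hr => ?_
    rw [uIoc_of_le hpq] at hr
    rw [Real.norm_eq_abs, abs_mul]
    exact (mul_le_of_le_one_right (abs_nonneg _) (hk1 r)).trans (hB' r ⟨hr.1.le, hr.2⟩)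
  rw [abs_of_nonneg (sub_nonneg.2 hpq)] at h2
  have h3 : |ψ q * k q| ≤ B := by
    rw [abs_mul]
    exact (mul_le_of_le_one_right (abs_nonneg _) (hk1 q)).trans (hB q ⟨hpq, le_rfl⟩)
  have h4 : |ψ p * k p| ≤ B := by
    rw [abs_mul]
    exact (mul_le_of_le_one_right (abs_nonneg _) (hk1 p)).trans (hB p ⟨le_rfl, hpq⟩)
  rw [h1]
  have h5 := abs_sub (ψ q * k q - ψ p * k p) (∫ r in p..q, ψ' r * k r)
  have h6 := abs_sub (ψ q * k q) (ψ p * k p)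
  linarith

end Cutoff

/-! ### Products of locally Lipschitz functions with cut-offs -/

section CutoffProduct

variable {N : ℕ} {R : ℝ}

theorem isOpen_annulus : IsOpen (annulus N R) :=
  (isOpen_lt continuous_const continuous_norm).inter (isOpen_lt continuous_norm continuous_const)

theorem isCompact_shell (a b : ℝ) : IsCompact {x : Euc N | a ≤ ‖x‖ ∧ ‖x‖ ≤ b} := by
  refine (isCompact_closedBall (0 : Euc N) b).of_isClosed_subset
    ((isClosed_le continuous_const continuous_norm).inter
      (isClosed_le continuous_norm continuous_const)) fun x hx => ?_
  rw [mem_closedBall_zero_iff]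
  exact hx.2

/-- On K the usual product estimate holds. Between a point of K and a zero of χ, the Lipschitz bound
of χ and the bound of f on K suffice, however badly f behaves off K. -/
theorem exists_lipschitzWith_mul {E : Type} [PseudoMetricSpace E] {f χ : E → ℝ} {s K : Set E}
    (hf : LocallyLipschitzOn s f) {L : NNReal} (hχ : LipschitzWith L χ) (h1 : ∀ x, |χ x| ≤ 1)
    (hK : IsCompact K) (hKs : K ⊆ s) (hsupp : ∀ x, χ x ≠ 0 → x ∈ K) :
    ∃ L', LipschitzWith L' fun x => f x * χ x := by
  obtain ⟨C, hC⟩ := (hf.mono hKs).exists_lipschitzOnWith_of_compact hK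
  obtain ⟨B, hB⟩ := hK.exists_bound_of_continuousOn hC.continuousOn
  have hB' : ∀ x ∈ K, |f x| ≤ max B 0 := fun x hx => (hB x hx).trans (le_max_left _ _)
  have hBL : 0 ≤ max B 0 := le_max_right _ _
  have hχ' : ∀ x y, |χ x - χ y| ≤ L * dist x y := fun x y => by
    rw [← Real.dist_eq]; exact hχ.dist_le_mul x y
  have hone : ∀ x y, x ∈ K → χ y = 0 → |f x * χ x| ≤ max B 0 * L * dist x y := by
    intro x y hx hy
    have := hχ' x y
    rw [hy, sub_zero] at this
    rw [abs_mul, mul_assoc]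
    exact mul_le_mul (hB' x hx) this (abs_nonneg _) hBL
  refine ⟨C + Real.toNNReal (max B 0) * L, LipschitzWith.of_dist_le_mul fun x y => ?_⟩
  have hC0 : 0 ≤ (C : ℝ) * dist x y := by positivity
  rw [NNReal.coe_add, NNReal.coe_mul, Real.coe_toNNReal _ hBL, Real.dist_eq, add_mul]
  by_cases hx : χ x = 0
  · by_cases hy : χ y = 0
    · rw [hx, hy, mul_zero, mul_zero, sub_zero, abs_zero]
      positivity
    · rw [hx, mul_zero, zero_sub, abs_neg, dist_comm]
      rw [dist_comm] at hC0
      linarith [hone y x (hsupp y hy) hx]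
  · by_cases hy : χ y = 0
    · rw [hy, mul_zero, sub_zero]
      linarith [hone x y (hsupp x hx) hy]
    · have hxK := hsupp x hx
      have hyK := hsupp y hy
      have e : f x * χ x - f y * χ y = (f x - f y) * χ x + f y * (χ x - χ y) := by ring
      rw [e]
      refine (abs_add_le _ _).trans (add_le_add ?_ ?_)
      · rw [abs_mul, ← Real.dist_eq]
        exact (mul_le_of_le_one_right dist_nonneg (h1 x)).trans (hC.dist_le_mul x hxK y hyK)
      · rw [abs_mul, mul_assoc]
        exact mul_le_mul (hB' y hyK) (hχ' x y) (abs_nonneg _) hBL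

theorem hasLineDerivAt_radial {k : ℝ → ℝ} {x : Euc N} (hx : x ≠ 0)
    (hk : DifferentiableAt ℝ k ‖x‖) (j : Fin N) :
    HasLineDerivAt ℝ (fun y : Euc N => k ‖y‖) (deriv k ‖x‖ * (x j / ‖x‖)) x (stdVec j) := by
  have hn : HasDerivAt (fun s : ℝ => x + s • (stdVec j : Euc N)) (stdVec j) 0 := by
    simpa using ((hasDerivAt_id (0 : ℝ)).smul_const (stdVec j : Euc N)).const_add x
  have hn2 := hn.norm_sq
  have hx2 : ‖x + (0 : ℝ) • (stdVec j : Euc N)‖ ^ 2 ≠ 0 := by simpa using hx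
  have h3 := hn2.sqrt hx2
  simp only [Real.sqrt_sq (norm_nonneg _), zero_smul, add_zero] at h3
  have h4 : inner ℝ x (stdVec j) = x j := by
    rw [stdVec, EuclideanSpace.inner_single_right]; simp
  rw [h4, mul_div_mul_left _ _ two_ne_zero] at h3
  have h5 : HasDerivAt k (deriv k ‖x‖) ‖x + (0 : ℝ) • (stdVec j : Euc N)‖ := by
    simpa using hk.hasDerivAt
  exact h5.comp (0 : ℝ) h3

/-- Locally Lipschitz functions on the annulus are a.e. differentiable in each direction. -/
theorem ae_lineDifferentiableAt_annulus {f : Euc N → ℝ}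
    (hf : LocallyLipschitzOn (annulus N R) f) (v : Euc N) :
    (∀ᵐ x, x ∈ annulus N R → LineDifferentiableAt ℝ f x v) ∧
      AEStronglyMeasurable (fun x => lineDeriv ℝ f x v) (volume.restrict (annulus N R)) := by
  obtain ⟨k, δ, M, hkC, hkL, hδ, hk01, hksupp, hkone, -⟩ := exists_cutoff R
  choose L hL using hkL
  have hlip : ∀ n, ∃ L', LipschitzWith L' fun x : Euc N => f x * k n ‖x‖ := fun n =>
    exists_lipschitzWith_mul hf ((hL n).comp lipschitzWith_one_norm)
      (fun x => abs_le.2 ⟨by linarith [(hk01 n ‖x‖).1], (hk01 n ‖x‖).2⟩)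
      (isCompact_shell (R + δ n) (1 - δ n))
      (fun x hx => ⟨by linarith [hx.1, hδ n], by linarith [hx.2, hδ n]⟩)
      fun x hx => hksupp n ‖x‖ hx
  choose L' hL' using hlip
  have heq : ∀ x ∈ annulus N R, ∀ᶠ n in atTop, (fun x : Euc N => f x * k n ‖x‖) =ᶠ[nhds x] f := by
    intro x hx
    filter_upwards [hkone ‖x‖ ⟨hx.1, hx.2⟩] with n hn
    filter_upwards [continuous_norm.continuousAt.eventually hn] with y hy
    rw [hy, mul_one]
  constructor
  · have h := ae_all_iff.2 fun n => (hL' n).ae_lineDifferentiableAt v (μ := volume)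
    filter_upwards [h] with x hx hxA
    obtain ⟨n, hn⟩ := (heq x hxA).exists
    exact hn.lineDifferentiableAt_iff.1 (hx n)
  · refine aestronglyMeasurable_of_tendsto_ae atTop
      (f := fun n x => lineDeriv ℝ (fun x : Euc N => f x * k n ‖x‖) x v)
      (fun n => (measurable_lineDeriv (hL' n).continuous).aestronglyMeasurable) ?_
    filter_upwards [ae_restrict_mem isOpen_annulus.measurableSet] with x hx
    refine tendsto_const_nhds.congr' ?_
    filter_upwards [heq x hx] with n hn
    exact hn.lineDeriv_eq.symm

/-- The product of f with the cut-off is Lipschitz on the whole space with compact support, so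
integration by parts for Lipschitz functions applies; the derivative of the cut-off produces the
right-hand side, which will converge to the boundary terms. -/
theorem integral_mul_cutoff {f : Euc N → ℝ} (hR : 0 ≤ R)
    (hf : LocallyLipschitzOn (annulus N R) f) (hfi : IntegrableOn f (annulus N R)) (j : Fin N)
    (hgi : IntegrableOn (fun x => lineDeriv ℝ f x (stdVec j)) (annulus N R))
    {k : ℝ → ℝ} {δ : ℝ} (hkC : ContDiff ℝ 1 k) {L : NNReal} (hL : LipschitzWith L k)
    (hδ : 0 < δ) (hk01 : ∀ r, 0 ≤ k r ∧ k r ≤ 1) (hksupp : ∀ r, k r ≠ 0 → R + δ ≤ r ∧ r ≤ 1 - δ)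
    {φ : Euc N → ℝ} (hφ : ContDiff ℝ (⊤ : ℕ∞) φ) (hφc : HasCompactSupport φ) :
    (∫ x in annulus N R, f x * k ‖x‖ * fderiv ℝ φ x (stdVec j))
      + ∫ x in annulus N R, k ‖x‖ * lineDeriv ℝ f x (stdVec j) * φ x
      = -∫ x in annulus N R, f x * (deriv k ‖x‖ * (x j / ‖x‖)) * φ x := by
  have hA : MeasurableSet (annulus N R) := isOpen_annulus.measurableSet
  have hK := isCompact_shell (N := N) (R + δ) (1 - δ)
  have hKA : {x : Euc N | R + δ ≤ ‖x‖ ∧ ‖x‖ ≤ 1 - δ} ⊆ annulus N R :=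
    fun x hx => ⟨by linarith [hx.1], by linarith [hx.2]⟩
  have hk1 : ∀ r, |k r| ≤ 1 := fun r => abs_le.2 ⟨by linarith [(hk01 r).1], (hk01 r).2⟩
  obtain ⟨L', hL'⟩ := exists_lipschitzWith_mul hf (hL.comp lipschitzWith_one_norm)
    (fun x => hk1 ‖x‖) hK hKA fun x hx => hksupp ‖x‖ hx
  simp only [Function.comp_apply] at hL'
  have hzero : ∀ x ∉ {x : Euc N | R + δ ≤ ‖x‖ ∧ ‖x‖ ≤ 1 - δ}, k ‖x‖ = 0 := fun x hx => by
    by_contra h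
    exact hx (hksupp _ h)
  have hcs : HasCompactSupport fun x => f x * k ‖x‖ :=
    HasCompactSupport.intro hK fun x hx => by rw [hzero x hx, mul_zero]
  obtain ⟨Cφ, hCφ⟩ := ContDiff.lipschitzWith_of_hasCompactSupport hφc hφ (by simp)
  have hibp := hCφ.integral_lineDeriv_mul_eq (μ := volume) hL' hcs (stdVec j)
  have hlhs : ∫ x, lineDeriv ℝ φ x (stdVec j) * (f x * k ‖x‖)
      = ∫ x in annulus N R, f x * k ‖x‖ * fderiv ℝ φ x (stdVec j) := by
    rw [setIntegral_eq_integral_of_forall_compl_eq_zero]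
    · refine integral_congr_ae (ae_of_all _ fun x => ?_)
      simp only
      rw [((hφ.differentiable (by simp)) x).lineDeriv_eq_fderiv]
      ring
    · intro x hx
      rw [hzero x fun h => hx (hKA h), mul_zero, zero_mul]
  have hrhs : ∫ x, lineDeriv ℝ (fun x => f x * k ‖x‖) x (-stdVec j) * φ x
      = -∫ x in annulus N R, (k ‖x‖ * lineDeriv ℝ f x (stdVec j) * φ x
        + f x * (deriv k ‖x‖ * (x j / ‖x‖)) * φ x) := by
    rw [← integral_neg, ← integral_indicator hA]
    refine integral_congr_ae ?_
    filter_upwards [(ae_lineDifferentiableAt_annulus hf (stdVec j)).1] with x hx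
    by_cases hxA : x ∈ annulus N R
    · rw [Set.indicator_of_mem hxA, lineDeriv_neg]
      have hx0 : x ≠ 0 := by
        rintro rfl
        have := hxA.1
        rw [norm_zero] at this
        linarith
      have h1 := (hx hxA).hasLineDerivAt
      have h2 := hasLineDerivAt_radial hx0 ((hkC.differentiable one_ne_zero) _) j
      have h3 : HasLineDerivAt ℝ (fun x => f x * k ‖x‖) _ x (stdVec j) := HasDerivAt.mul h1 h2
      rw [h3.lineDeriv]
      simp only [zero_smul, add_zero]
      ring
    · rw [Set.indicator_of_notMem hxA]
      have h0 : (fun x => f x * k ‖x‖) =ᶠ[nhds x] fun _ => 0 := by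
        filter_upwards [hK.isClosed.isOpen_compl.mem_nhds fun h => hxA (hKA h)] with y hy
        rw [hzero y hy, mul_zero]
      rw [h0.lineDeriv_eq]
      simp [lineDeriv]
  obtain ⟨B, hB⟩ := hφc.exists_bound_of_continuous hφ.continuous
  have hkm : Continuous fun x : Euc N => k ‖x‖ := hkC.continuous.comp continuous_norm
  have hdk : ∀ r, |deriv k r| ≤ L := fun r => norm_deriv_le_of_lipschitz hL
  have hdkm : Measurable fun x : Euc N => deriv k ‖x‖ :=
    (hkC.continuous_deriv le_rfl).measurable.comp measurable_norm
  have hcoord : ∀ x : Euc N, |x j / ‖x‖| ≤ 1 := fun x => by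
    rw [abs_div, abs_norm]
    exact div_le_one_of_le₀ (PiLp.norm_apply_le x j) (norm_nonneg _)
  have hcoordm : Measurable fun x : Euc N => x j / ‖x‖ := by fun_prop
  have hi1 : IntegrableOn (fun x => k ‖x‖ * lineDeriv ℝ f x (stdVec j) * φ x) (annulus N R) := by
    have h1 : IntegrableOn (fun x => k ‖x‖ * lineDeriv ℝ f x (stdVec j)) (annulus N R) :=
      Integrable.bdd_mul (c := 1) hgi hkm.aestronglyMeasurable (ae_of_all _ fun x => hk1 _)
    exact (Integrable.bdd_mul (c := B) h1 hφ.continuous.aestronglyMeasurable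
      (ae_of_all _ hB)).congr (ae_of_all _ fun x => mul_comm _ _)
  have hi2 : IntegrableOn (fun x => f x * (deriv k ‖x‖ * (x j / ‖x‖)) * φ x) (annulus N R) := by
    have h1 : IntegrableOn (fun x => (deriv k ‖x‖ * (x j / ‖x‖) * φ x) * f x) (annulus N R) := by
      refine Integrable.bdd_mul (c := L * 1 * B) hfi
        ((hdkm.mul hcoordm).mul hφ.continuous.measurable).aestronglyMeasurable
        (ae_of_all _ fun x => ?_)
      rw [norm_mul, norm_mul]
      refine mul_le_mul (mul_le_mul (hdk _) (hcoord x) (norm_nonneg _) L.coe_nonneg) (hB x)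
        (norm_nonneg _) (by positivity)
    exact h1.congr (ae_of_all _ fun x => by simp only; ring)
  rw [hlhs, hrhs, integral_add hi1 hi2] at hibp
  rw [hibp]
  ring

end CutoffProduct

/-! ### The Gauss-Green formula on the annulus -/

section GaussGreen

variable {N : ℕ} {R : ℝ}

/-- The distance to the boundary of the annulus. -/
noncomputable def annDist (N : ℕ) (R : ℝ) (x : Euc N) : ℝ := min (1 - ‖x‖) (‖x‖ - R)

theorem annulus_eq : annulus N R = {x | 0 < annDist N R x} := by
  ext x
  simp only [annulus, annDist, mem_ofPred_eq, lt_min_iff, sub_pos, and_comm]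

theorem norm_smul_sphere {r : ℝ} (hr : 0 ≤ r) (ω : USphere N) : ‖r • (ω : Euc N)‖ = r := by
  rw [norm_smul, Real.norm_of_nonneg hr, norm_eq_of_mem_sphere, mul_one]

theorem abs_coord_le_one (ω : USphere N) (j : Fin N) : |(ω : Euc N) j| ≤ 1 := by
  have := PiLp.norm_apply_le (ω : Euc N) j
  rwa [norm_eq_of_mem_sphere] at this

theorem setIntegral_annulus_polar (hN : 0 < N) (hR : 0 ≤ R) {m : ℝ} (hm : m ∈ Ioo R 1)
    {F : Euc N → ℝ} {a b : USphere N → ℝ} (hFa : ∀ ω : USphere N, ∀ r ∈ Ico m 1,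
      F (r • (ω : Euc N)) = a ω)
    (hFb : ∀ ω : USphere N, ∀ r ∈ Ioo R m, F (r • (ω : Euc N)) = b ω)
    {φ : Euc N → ℝ} (hφ : Continuous φ) {κ : ℝ → ℝ} (hκ : Continuous κ) (j : Fin N)
    (hint : IntegrableOn (fun x => F x * (κ ‖x‖ * (x j / ‖x‖)) * φ x) (annulus N R)) :
    ∫ x in annulus N R, F x * (κ ‖x‖ * (x j / ‖x‖)) * φ x
      = ∫ ω : USphere N, (ω : Euc N) j *
        (b ω * (∫ r in R..m, r ^ (N - 1) * φ (r • (ω : Euc N)) * κ r)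
          + a ω * (∫ r in m..1, r ^ (N - 1) * φ (r • (ω : Euc N)) * κ r)) ∂(sphMeas N) := by
  have hA : MeasurableSet (annulus N R) := isOpen_annulus.measurableSet
  rw [← integral_indicator hA, integral_polar hN ((integrable_indicator_iff hA).2 hint)]
  refine integral_congr_ae (ae_of_all _ fun ω => ?_)
  simp only
  set h : ℝ → ℝ := fun r => r ^ (N - 1) * φ (r • (ω : Euc N)) * κ r with hh
  have hhc : Continuous h := by
    simp only [hh]
    exact ((continuous_pow _).mul (hφ.comp (by fun_prop))).mul hκ
  have h1 : ∫ r in Ioi (0 : ℝ), r ^ (N - 1) * (annulus N R).indicator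
      (fun x => F x * (κ ‖x‖ * (x j / ‖x‖)) * φ x) (r • (ω : Euc N))
      = ∫ r in Ioo R 1, F (r • (ω : Euc N)) * ((ω : Euc N) j * h r) := by
    rw [← integral_indicator measurableSet_Ioi, ← integral_indicator measurableSet_Ioo]
    refine integral_congr_ae (ae_of_all _ fun r => ?_)
    simp only
    by_cases hr : 0 < r
    · rw [Set.indicator_of_mem (by exact hr)]
      by_cases hr1 : r ∈ Ioo R 1
      · rw [Set.indicator_of_mem hr1, Set.indicator_of_mem
          (by simp only [annulus, mem_ofPred_eq, norm_smul_sphere hr.le]; exact hr1),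
          norm_smul_sphere hr.le]
        have : (r • (ω : Euc N)).ofLp j / r = (ω : Euc N) j := by
          rw [PiLp.smul_apply, smul_eq_mul, mul_div_cancel_left₀ _ hr.ne']
        rw [this, hh]
        ring
      · rw [Set.indicator_of_notMem hr1, Set.indicator_of_notMem
          (by simp only [annulus, mem_ofPred_eq, norm_smul_sphere hr.le]; exact hr1), mul_zero]
    · rw [Set.indicator_of_notMem (by exact hr), Set.indicator_of_notMem]
      exact fun h => hr (by linarith [h.1])
  have hib : IntegrableOn (fun r => F (r • (ω : Euc N)) * ((ω : Euc N) j * h r)) (Ioo R m) := by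
    have : IntegrableOn (fun r => b ω * ((ω : Euc N) j * h r)) (Ioo R m) :=
      ((continuous_const.mul (continuous_const.mul hhc)).integrableOn_Icc).mono_set Ioo_subset_Icc_self
    exact this.congr_fun (fun r hr => by simp only; rw [hFb ω r hr]) measurableSet_Ioo
  have hia : IntegrableOn (fun r => F (r • (ω : Euc N)) * ((ω : Euc N) j * h r)) (Ico m 1) := by
    have : IntegrableOn (fun r => a ω * ((ω : Euc N) j * h r)) (Ico m 1) :=
      ((continuous_const.mul (continuous_const.mul hhc)).integrableOn_Icc).mono_set Ico_subset_Icc_self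
    exact this.congr_fun (fun r hr => by simp only; rw [hFa ω r hr]) measurableSet_Ico
  have hdisj : Disjoint (Ioo R m) (Ico m 1) := by
    rw [Set.disjoint_left]
    exact fun r h1 h2 => absurd h1.2 (not_lt.2 h2.1)
  rw [h1, ← Ioo_union_Ico_eq_Ioo hm.1 hm.2.le, setIntegral_union hdisj measurableSet_Ico hib hia,
    setIntegral_congr_fun (g := fun r => (ω : Euc N) j * b ω * h r) measurableSet_Ioo
      (fun r hr => by simp only; rw [hFb ω r hr]; ring),
    setIntegral_congr_fun (g := fun r => (ω : Euc N) j * a ω * h r) measurableSet_Ico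
      (fun r hr => by simp only; rw [hFa ω r hr]; ring),
    integral_Ico_eq_integral_Ioo, ← integral_Ioc_eq_integral_Ioo, ← integral_Ioc_eq_integral_Ioo,
    integral_const_mul, integral_const_mul, ← intervalIntegral.integral_of_le hm.1.le,
    ← intervalIntegral.integral_of_le hm.2.le]
  ring

/-- The Gauss-Green formula on the annulus, for locally Lipschitz functions which approach
`L²` boundary values in the mean. -/
theorem gauss_green_annulus (hN : 0 < N) (hR : 0 ≤ R) {m : ℝ} (hm : m ∈ Ioo R 1)
    {f F : Euc N → ℝ} {a b : USphere N → ℝ} (ha : Integrable a (sphMeas N))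
    (hb : Integrable b (sphMeas N))
    (hFa : ∀ ω : USphere N, ∀ r ∈ Ico m 1, F (r • (ω : Euc N)) = a ω)
    (hFb : ∀ ω : USphere N, ∀ r ∈ Ioo R m, F (r • (ω : Euc N)) = b ω)
    (hf : LocallyLipschitzOn (annulus N R) f) (hfi : IntegrableOn f (annulus N R))
    (hFi : IntegrableOn F (annulus N R)) (j : Fin N)
    (hgi : IntegrableOn (fun x => lineDeriv ℝ f x (stdVec j)) (annulus N R))
    (hfF : IntegrableOn (fun x => (annDist N R x)⁻¹ * (f x - F x)) (annulus N R))
    {φ : Euc N → ℝ} (hφ : ContDiff ℝ (⊤ : ℕ∞) φ) (hφc : HasCompactSupport φ) :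
    (∫ x in annulus N R, f x * fderiv ℝ φ x (stdVec j))
      + ∫ x in annulus N R, lineDeriv ℝ f x (stdVec j) * φ x
      = (∫ ω : USphere N, a ω * φ (ω : Euc N) * (ω : Euc N) j ∂(sphMeas N))
        - R ^ (N - 1) * ∫ ω : USphere N, b ω * φ (R • (ω : Euc N)) * (ω : Euc N) j
          ∂(sphMeas N) := by
  have hA : MeasurableSet (annulus N R) := isOpen_annulus.measurableSet
  obtain ⟨k, δ, M, hkC, hkL, hδ, hk01, hksupp, hkone, hkd⟩ := exists_cutoff R
  have hk1 : ∀ n r, |k n r| ≤ 1 := fun n r => abs_le.2 ⟨by linarith [(hk01 n r).1], (hk01 n r).2⟩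
  have hklim : ∀ r ∈ Ioo R 1, Tendsto (fun n => k n r) atTop (nhds 1) := fun r hr => by
    refine tendsto_const_nhds.congr' ?_
    filter_upwards [hkone r hr] with n hn using hn.self_of_nhds.symm
  have hdlim : ∀ r ∈ Ioo R 1, ∀ᶠ n in atTop, deriv (k n) r = 0 := fun r hr => by
    filter_upwards [hkone r hr] with n hn
    have hn' : k n =ᶠ[nhds r] fun _ => 1 := hn
    rw [hn'.deriv_eq, deriv_const]
  choose L hL using hkL
  have hid := fun n =>
    integral_mul_cutoff hR hf hfi j hgi (hkC n) (hL n) (hδ n) (hk01 n) (hksupp n) hφ hφc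
  obtain ⟨B, hB⟩ := hφc.exists_bound_of_continuous hφ.continuous
  have hB0 : 0 ≤ B := (norm_nonneg _).trans (hB 0)
  have hdφ : Continuous fun x => fderiv ℝ φ x (stdVec j) :=
    (hφ.continuous_fderiv (by simp)).clm_apply continuous_const
  obtain ⟨B', hB'⟩ := (hφc.fderiv ℝ).exists_bound_of_continuous (hφ.continuous_fderiv (by simp))
  have hB'0 : 0 ≤ B' := (norm_nonneg _).trans (hB' 0)
  have hB'' : ∀ x, ‖fderiv ℝ φ x (stdVec j)‖ ≤ B' := fun x => by
    refine ((fderiv ℝ φ x).le_opNorm _).trans ?_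
    have : ‖(stdVec j : Euc N)‖ = 1 := by simp [stdVec]
    rw [this, mul_one]
    exact hB' x
  have hkm : ∀ n, Continuous fun x : Euc N => k n ‖x‖ := fun n =>
    (hkC n).continuous.comp continuous_norm
  have hdk : ∀ n, Continuous (deriv (k n)) := fun n => (hkC n).continuous_deriv le_rfl
  have hcoord : ∀ x : Euc N, |x j / ‖x‖| ≤ 1 := fun x => by
    rw [abs_div, abs_norm]
    exact div_le_one_of_le₀ (PiLp.norm_apply_le x j) (norm_nonneg _)
  have hcoordm : Measurable fun x : Euc N => x j / ‖x‖ := by fun_prop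
  -- limits of the volume terms
  have hlim1 : Tendsto (fun n => ∫ x in annulus N R, f x * k n ‖x‖ * fderiv ℝ φ x (stdVec j)) atTop
      (nhds (∫ x in annulus N R, f x * fderiv ℝ φ x (stdVec j))) := by
    refine tendsto_integral_of_dominated_convergence (fun x => |f x| * B')
      (fun n => (hfi.aestronglyMeasurable.mul (hkm n).aestronglyMeasurable).mul
        hdφ.aestronglyMeasurable) (hfi.abs.mul_const _) (fun n => ae_of_all _ fun x => ?_) ?_
    · rw [norm_mul, norm_mul]
      refine mul_le_mul ?_ (hB'' x) (norm_nonneg _) (abs_nonneg _)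
      exact mul_le_of_le_one_right (abs_nonneg _) (hk1 n _)
    · filter_upwards [ae_restrict_mem hA] with x hx
      have := ((hklim ‖x‖ ⟨hx.1, hx.2⟩).const_mul (f x)).mul_const (fderiv ℝ φ x (stdVec j))
      rwa [mul_one] at this
  have hlim2 : Tendsto (fun n => ∫ x in annulus N R, k n ‖x‖ * lineDeriv ℝ f x (stdVec j) * φ x)
      atTop (nhds (∫ x in annulus N R, lineDeriv ℝ f x (stdVec j) * φ x)) := by
    refine tendsto_integral_of_dominated_convergence (fun x => |lineDeriv ℝ f x (stdVec j)| * B)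
      (fun n => ((hkm n).aestronglyMeasurable.mul hgi.aestronglyMeasurable).mul
        hφ.continuous.aestronglyMeasurable) (hgi.abs.mul_const _)
      (fun n => ae_of_all _ fun x => ?_) ?_
    · rw [norm_mul, norm_mul]
      refine mul_le_mul ?_ (hB x) (norm_nonneg _) (abs_nonneg _)
      exact mul_le_of_le_one_left (abs_nonneg _) (hk1 n _)
    · filter_upwards [ae_restrict_mem hA] with x hx
      have := ((hklim ‖x‖ ⟨hx.1, hx.2⟩).mul_const (lineDeriv ℝ f x (stdVec j))).mul_const (φ x)
      rwa [one_mul] at this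
  -- the error made by replacing `f` by its boundary values
  have hdkm : ∀ n, Measurable fun x : Euc N => deriv (k n) ‖x‖ := fun n =>
    (hdk n).measurable.comp measurable_norm
  -- The derivative of the cut-off is at most M/t, so the integrand is dominated by a multiple of |f
  -- - F|/t, which is integrable, and at each point of the annulus the derivative is eventually 0.
  have hlim3 : Tendsto (fun n => ∫ x in annulus N R,
      (f x - F x) * (deriv (k n) ‖x‖ * (x j / ‖x‖)) * φ x) atTop (nhds 0) := by
    rw [← integral_zero (Euc N) ℝ (μ := volume.restrict (annulus N R))]
    refine tendsto_integral_of_dominated_convergence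
      (fun x => M * |(annDist N R x)⁻¹ * (f x - F x)| * B)
      (fun n => ((hfi.sub hFi).aestronglyMeasurable.mul
        ((hdkm n).mul hcoordm).aestronglyMeasurable).mul hφ.continuous.aestronglyMeasurable)
      ((hfF.abs.const_mul _).mul_const _) (fun n => ?_) ?_
    · filter_upwards [ae_restrict_mem hA] with x hx
      rw [norm_mul, norm_mul, norm_mul]
      have h1 := hkd n ‖x‖ ⟨hx.1, hx.2⟩
      have h2 : ‖deriv (k n) ‖x‖‖ * ‖x j / ‖x‖‖ ≤ M * (annDist N R x)⁻¹ :=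
        (mul_le_of_le_one_right (norm_nonneg _) (hcoord x)).trans h1
      have h3 : 0 < annDist N R x := by rw [annulus_eq] at hx; exact hx
      have key : ‖f x - F x‖ * (‖deriv (k n) ‖x‖‖ * ‖x j / ‖x‖‖)
          ≤ M * |(annDist N R x)⁻¹ * (f x - F x)| := by
        rw [abs_mul, abs_of_pos (inv_pos.2 h3)]
        calc ‖f x - F x‖ * (‖deriv (k n) ‖x‖‖ * ‖x j / ‖x‖‖)
            ≤ ‖f x - F x‖ * (M * (annDist N R x)⁻¹) := by gcongr
          _ = M * ((annDist N R x)⁻¹ * |f x - F x|) := by rw [Real.norm_eq_abs]; ring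
      exact mul_le_mul key (hB x) (norm_nonneg _) (le_trans (by positivity) key)
    · filter_upwards [ae_restrict_mem hA] with x hx
      refine tendsto_const_nhds.congr' ?_
      filter_upwards [hdlim ‖x‖ ⟨hx.1, hx.2⟩] with n hn
      rw [hn, zero_mul, mul_zero, zero_mul]
  have hFint : ∀ n, IntegrableOn (fun x => F x * (deriv (k n) ‖x‖ * (x j / ‖x‖)) * φ x)
      (annulus N R) := fun n => by
    have h1 : IntegrableOn (fun x => (deriv (k n) ‖x‖ * (x j / ‖x‖) * φ x) * F x)
        (annulus N R) := by
      refine Integrable.bdd_mul (c := L n * 1 * B) hFi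
        (((hdkm n).mul hcoordm).mul hφ.continuous.measurable).aestronglyMeasurable
        (ae_of_all _ fun x => ?_)
      rw [norm_mul, norm_mul]
      exact mul_le_mul (mul_le_mul (norm_deriv_le_of_lipschitz (hL n)) (hcoord x) (norm_nonneg _)
        (L n).coe_nonneg) (hB x) (norm_nonneg _) (by positivity)
    exact h1.congr (ae_of_all _ fun x => by simp only; ring)
  have hfFint : ∀ n, IntegrableOn (fun x => (f x - F x) * (deriv (k n) ‖x‖ * (x j / ‖x‖)) * φ x)
      (annulus N R) := fun n => by
    have h1 : IntegrableOn (fun x => (deriv (k n) ‖x‖ * (x j / ‖x‖) * φ x) * (f x - F x))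
        (annulus N R) := by
      refine Integrable.bdd_mul (c := L n * 1 * B) (hfi.sub hFi)
        (((hdkm n).mul hcoordm).mul hφ.continuous.measurable).aestronglyMeasurable
        (ae_of_all _ fun x => ?_)
      rw [norm_mul, norm_mul]
      exact mul_le_mul (mul_le_mul (norm_deriv_le_of_lipschitz (hL n)) (hcoord x) (norm_nonneg _)
        (L n).coe_nonneg) (hB x) (norm_nonneg _) (by positivity)
    exact h1.congr (ae_of_all _ fun x => by simp only; ring)
  -- the boundary terms
  let ψ : USphere N → ℝ → ℝ := fun ω r => r ^ (N - 1) * φ (r • (ω : Euc N))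
  let ψ' : USphere N → ℝ → ℝ := fun ω r => ((N - 1 : ℕ) : ℝ) * r ^ (N - 1 - 1) *
    φ (r • (ω : Euc N)) + r ^ (N - 1) * fderiv ℝ φ (r • (ω : Euc N)) (ω : Euc N)
  have hψ : ∀ ω r, HasDerivAt (ψ ω) (ψ' ω r) r := fun ω r => by
    have h1 : HasDerivAt (fun r : ℝ => r • (ω : Euc N)) (ω : Euc N) r := by
      simpa using (hasDerivAt_id r).smul_const (ω : Euc N)
    exact (hasDerivAt_pow (N - 1) r).mul
      (((hφ.differentiable (by simp)) _).hasFDerivAt.comp_hasDerivAt r h1)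
  have hψ'c : ∀ ω, Continuous (ψ' ω) := fun ω => by
    have h1 : Continuous fun r : ℝ => r • (ω : Euc N) := by fun_prop
    have h2 : Continuous fun r : ℝ => fderiv ℝ φ (r • (ω : Euc N)) (ω : Euc N) :=
      ((hφ.continuous_fderiv (by simp)).comp h1).clm_apply continuous_const
    exact ((continuous_const.mul (continuous_pow _)).mul (hφ.continuous.comp h1)).add
      ((continuous_pow _).mul h2)
  -- A common bound for ψ and its radial derivative on [R,1], uniform in ω.
  set D : ℝ := N * B + B' with hD
  have hD0 : 0 ≤ D := by positivity
  have hpow : ∀ i : ℕ, ∀ r ∈ Icc R 1, |r ^ i| ≤ 1 := fun i r hr => by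
    have h0 : 0 ≤ r := hR.trans hr.1
    rw [abs_of_nonneg (pow_nonneg h0 _)]
    exact pow_le_one₀ h0 hr.2
  have hψB : ∀ ω, ∀ r ∈ Icc R 1, |ψ ω r| ≤ D := fun ω r hr => by
    simp only [ψ]
    rw [abs_mul]
    have h1 : |r ^ (N - 1)| * |φ (r • (ω : Euc N))| ≤ 1 * B :=
      mul_le_mul (hpow _ r hr) (hB _) (abs_nonneg _) zero_le_one
    have h2 : (1 : ℝ) ≤ N := by exact_mod_cast hN
    rw [hD]
    nlinarith
  have hψ'B : ∀ ω, ∀ r ∈ Icc R 1, |ψ' ω r| ≤ D := fun ω r hr => by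
    simp only [ψ']
    refine (abs_add_le _ _).trans (add_le_add ?_ ?_)
    · rw [abs_mul, abs_mul, Nat.abs_cast]
      have h2 : ((N - 1 : ℕ) : ℝ) ≤ N := by exact_mod_cast Nat.sub_le N 1
      calc ((N - 1 : ℕ) : ℝ) * |r ^ (N - 1 - 1)| * |φ (r • (ω : Euc N))| ≤ N * 1 * B := by
            gcongr
            · exact hpow _ r hr
            · exact hB _
        _ = N * B := by ring
    · rw [abs_mul]
      have h3 : |fderiv ℝ φ (r • (ω : Euc N)) (ω : Euc N)| ≤ B' := by
        refine ((fderiv ℝ φ _).le_opNorm _).trans ?_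
        rw [norm_eq_of_mem_sphere, mul_one]
        exact hB' _
      calc |r ^ (N - 1)| * |fderiv ℝ φ (r • (ω : Euc N)) (ω : Euc N)| ≤ 1 * B' :=
            mul_le_mul (hpow _ r hr) h3 (abs_nonneg _) zero_le_one
        _ = B' := one_mul _
  have hkR : ∀ n, k n R = 0 := fun n => by
    by_contra h
    linarith [(hksupp n R h).1, hδ n]
  have hk1' : ∀ n, k n 1 = 0 := fun n => by
    by_contra h
    linarith [(hksupp n 1 h).2, hδ n]
  have hsphere : ∀ n, ∫ x in annulus N R, F x * (deriv (k n) ‖x‖ * (x j / ‖x‖)) * φ x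
      = ∫ ω : USphere N, (ω : Euc N) j * (b ω * (∫ r in R..m, ψ ω r * deriv (k n) r)
          + a ω * (∫ r in m..1, ψ ω r * deriv (k n) r)) ∂(sphMeas N) := fun n =>
    setIntegral_annulus_polar hN hR hm hFa hFb hφ.continuous (hdk n) j (hFint n)
  have hcj : Continuous fun ω : USphere N => (ω : Euc N) j := by fun_prop
  have hlim4 : Tendsto (fun n => ∫ x in annulus N R,
      F x * (deriv (k n) ‖x‖ * (x j / ‖x‖)) * φ x) atTop
      (nhds (∫ ω : USphere N, (ω : Euc N) j * (b ω * ψ ω R + a ω * (-ψ ω 1)) ∂(sphMeas N))) := by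
    simp only [hsphere]
    refine tendsto_integral_of_dominated_convergence
      (fun ω => |b ω| * (D * (2 + (m - R))) + |a ω| * (D * (2 + (1 - m)))) (fun n => ?_)
      ((hb.abs.mul_const _).add (ha.abs.mul_const _)) (fun n => ae_of_all _ fun ω => ?_)
      (ae_of_all _ fun ω => ?_)
    · have hpc : ∀ p q : ℝ, Continuous fun ω : USphere N =>
          ∫ r in p..q, ψ ω r * deriv (k n) r := fun p q => by
        refine intervalIntegral.continuous_parametric_intervalIntegral_of_continuous ?_
          continuous_const
        have h1 : Continuous fun p : USphere N × ℝ => p.2 • (p.1 : Euc N) := by fun_prop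
        exact ((continuous_snd.pow _).mul (hφ.continuous.comp h1)).mul
          ((hdk n).comp continuous_snd)
      exact hcj.aestronglyMeasurable.mul
        ((hb.aestronglyMeasurable.mul (hpc R m).aestronglyMeasurable).add
          (ha.aestronglyMeasurable.mul (hpc m 1).aestronglyMeasurable))
    · rw [norm_mul]
      refine (mul_le_of_le_one_left (norm_nonneg _) (abs_coord_le_one ω j)).trans ?_
      refine (norm_add_le _ _).trans (add_le_add ?_ ?_)
      · rw [norm_mul]
        refine mul_le_mul_of_nonneg_left ?_ (abs_nonneg _)
        exact abs_integral_mul_deriv_cutoff_le hm.1.le (hψ ω) (hψ'c ω) (hkC n) (hk1 n)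
          (fun r hr => hψB ω r ⟨hr.1, hr.2.trans hm.2.le⟩)
          (fun r hr => hψ'B ω r ⟨hr.1, hr.2.trans hm.2.le⟩)
      · rw [norm_mul]
        refine mul_le_mul_of_nonneg_left ?_ (abs_nonneg _)
        exact abs_integral_mul_deriv_cutoff_le hm.2.le (hψ ω) (hψ'c ω) (hkC n) (hk1 n)
          (fun r hr => hψB ω r ⟨hm.1.le.trans hr.1, hr.2⟩)
          (fun r hr => hψ'B ω r ⟨hm.1.le.trans hr.1, hr.2⟩)
    · have h1 := tendsto_integral_mul_deriv_cutoff hm.1.le (hψ ω) (hψ'c ω) hkC hk1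
        (fun r hr => hklim r ⟨hr.1, hr.2.trans hm.2⟩)
        (tendsto_const_nhds.congr fun n => (hkR n).symm) (hklim m hm)
      have h2 := tendsto_integral_mul_deriv_cutoff hm.2.le (hψ ω) (hψ'c ω) hkC hk1
        (fun r hr => hklim r ⟨hm.1.trans hr.1, hr.2⟩) (hklim m hm)
        (tendsto_const_nhds.congr fun n => (hk1' n).symm)
      -- The cut-offs vanish at R and 1 and tend to 1 at m. The interval [R,m] leaves ψ(R), the
      -- interval [m,1] leaves -ψ(1), and the contributions at m cancel within each interval, so the
      -- choice of m is immaterial.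
      rw [show ψ ω m * 1 - ψ ω R * 0 - (ψ ω m - ψ ω R) = ψ ω R by ring] at h1
      rw [show ψ ω 1 * 0 - ψ ω m * 1 - (ψ ω 1 - ψ ω m) = -ψ ω 1 by ring] at h2
      exact ((h1.const_mul _).add (h2.const_mul _)).const_mul _
  have hsplit : ∀ n, ∫ x in annulus N R, f x * (deriv (k n) ‖x‖ * (x j / ‖x‖)) * φ x
      = (∫ x in annulus N R, (f x - F x) * (deriv (k n) ‖x‖ * (x j / ‖x‖)) * φ x)
        + ∫ x in annulus N R, F x * (deriv (k n) ‖x‖ * (x j / ‖x‖)) * φ x := fun n => by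
    rw [← integral_add (hfFint n) (hFint n)]
    refine integral_congr_ae (ae_of_all _ fun x => ?_)
    simp only
    ring
  have hL := hlim1.add hlim2
  have hRt := (hlim3.add hlim4).neg
  simp only [hid, hsplit] at hL
  rw [tendsto_nhds_unique hL hRt, zero_add]
  have hφs : Continuous fun ω : USphere N => φ (ω : Euc N) :=
    hφ.continuous.comp continuous_subtype_val
  have hφR : Continuous fun ω : USphere N => φ (R • (ω : Euc N)) :=
    hφ.continuous.comp (by fun_prop)
  have hI : ∀ (c : USphere N → ℝ), Integrable c (sphMeas N) → ∀ h : USphere N → ℝ, Continuous h →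
      (∀ ω, |h ω| ≤ B) → Integrable (fun ω : USphere N => c ω * h ω * (ω : Euc N) j)
        (sphMeas N) := by
    intro c hc h hh hhB
    have : Integrable (fun ω : USphere N => (h ω * (ω : Euc N) j) * c ω) (sphMeas N) := by
      refine Integrable.bdd_mul (c := B * 1) hc (hh.mul hcj).aestronglyMeasurable
        (ae_of_all _ fun ω => ?_)
      rw [norm_mul]
      exact mul_le_mul (hhB ω) (abs_coord_le_one ω j) (norm_nonneg _) hB0
    exact this.congr (ae_of_all _ fun ω => by simp only; ring)
  have h1 := hI a ha _ hφs fun ω => hB _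
  have h2 := hI b hb _ hφR fun ω => hB _
  rw [← integral_const_mul, ← integral_sub h1 (h2.const_mul _), ← integral_neg]
  refine integral_congr_ae (ae_of_all _ fun ω => ?_)
  simp only [ψ, one_smul, one_pow]
  ring

end GaussGreen

/-! ### Homogeneous extensions, the Gagliardo semi-norm, and the jump map -/

section Homogeneous

variable {N : ℕ} {R : ℝ} {Y : Type} [PseudoMetricSpace Y]

/-- The radial projection onto the unit sphere. -/
noncomputable def sphProj (hN : 0 < N) (x : Euc N) : USphere N :=
  ⟨if x = 0 then stdVec ⟨0, hN⟩ else ‖x‖⁻¹ • x, by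
    rw [mem_sphere_zero_iff_norm]
    split_ifs with h
    · simp
    · rw [norm_smul, norm_inv, norm_norm, inv_mul_cancel₀ (norm_ne_zero_iff.2 h)]⟩

theorem measurable_sphProj (hN : 0 < N) : Measurable (sphProj hN) :=
  (Measurable.ite (measurableSet_singleton 0) measurable_const
    (measurable_norm.inv.smul measurable_id)).subtype_mk

theorem coe_sphProj (hN : 0 < N) {x : Euc N} (hx : x ≠ 0) : (sphProj hN x : Euc N) = ‖x‖⁻¹ • x := by
  simp [sphProj, hx]

theorem norm_smul_sphProj (hN : 0 < N) (x : Euc N) : ‖x‖ • (sphProj hN x : Euc N) = x := by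
  by_cases hx : x = 0
  · rw [hx, norm_zero, zero_smul]
  · rw [coe_sphProj hN hx, smul_smul, mul_inv_cancel₀ (norm_ne_zero_iff.2 hx), one_smul]

theorem sphProj_smul (hN : 0 < N) {r : ℝ} (hr : 0 < r) (ω : USphere N) :
    sphProj hN (r • (ω : Euc N)) = ω := by
  have hω : (ω : Euc N) ≠ 0 := ne_zero_of_mem_unit_sphere ω
  apply Subtype.ext
  rw [coe_sphProj hN (smul_ne_zero hr.ne' hω), norm_smul_sphere hr.le, smul_smul,
    inv_mul_cancel₀ hr.ne', one_smul]

theorem lipschitzWith_annDist : LipschitzWith 1 (annDist N R) := by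
  have h1 : LipschitzWith 1 fun x : Euc N => 1 - ‖x‖ := by
    refine LipschitzWith.of_dist_le_mul fun x y => ?_
    rw [Real.dist_eq, sub_sub_sub_cancel_left, NNReal.coe_one, one_mul, dist_comm, dist_eq_norm]
    exact abs_norm_sub_norm_le _ _
  have h2 : LipschitzWith 1 fun x : Euc N => ‖x‖ - R := by
    refine LipschitzWith.of_dist_le_mul fun x y => ?_
    rw [Real.dist_eq, sub_sub_sub_cancel_right, NNReal.coe_one, one_mul, dist_eq_norm]
    exact abs_norm_sub_norm_le _ _
  simpa [annDist] using! h1.min h2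

/-- In the unit ball the density r^(N-1) is at most 1, and the rest of the integrand is a product in
polar coordinates. -/
theorem lintegral_annulus_polar_le (hN : 0 < N) {κ : ℝ → ℝ≥0∞} (hκ : Measurable κ)
    {G : USphere N → ℝ≥0∞} (hG : Measurable G) :
    ∫⁻ x in annulus N R, κ ‖x‖ * G (sphProj hN x)
      ≤ (∫⁻ r in Ioo R 1, κ r) * ∫⁻ ω, G ω ∂(sphMeas N) := by
  have hA : MeasurableSet (annulus N R) := isOpen_annulus.measurableSet
  have hm : Measurable fun x : Euc N => κ ‖x‖ * G (sphProj hN x) :=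
    (hκ.comp measurable_norm).mul (hG.comp (measurable_sphProj hN))
  rw [← lintegral_indicator hA, lintegral_polar hN (hm.indicator hA), ← lintegral_const_mul _ hG]
  refine lintegral_mono fun ω => ?_
  simp only
  rw [← lintegral_mul_const _ hκ, ← lintegral_indicator measurableSet_Ioi,
    ← lintegral_indicator measurableSet_Ioo]
  refine lintegral_mono fun r => ?_
  by_cases hr : 0 < r
  · rw [Set.indicator_of_mem (by exact hr)]
    by_cases hr1 : r ∈ Ioo R 1
    · rw [Set.indicator_of_mem hr1, Set.indicator_of_mem
        (by simp only [annulus, mem_ofPred_eq, norm_smul_sphere hr.le]; exact hr1),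
        norm_smul_sphere hr.le, sphProj_smul hN hr]
      refine mul_le_of_le_one_left zero_le ?_
      rw [ENNReal.ofReal_le_one]
      exact pow_le_one₀ hr.le hr1.2.le
    · rw [Set.indicator_of_notMem (s := annulus N R)
        (by simp only [annulus, mem_ofPred_eq, norm_smul_sphere hr.le]; exact hr1), mul_zero]
      exact zero_le
  · rw [Set.indicator_of_notMem (by exact hr)]
    exact zero_le

theorem lintegral_annulus_sphProj_le (hN : 0 < N) (hR : 0 ≤ R) {G : USphere N → ℝ≥0∞}
    (hG : Measurable G) :
    ∫⁻ x in annulus N R, G (sphProj hN x) ≤ ∫⁻ ω, G ω ∂(sphMeas N) := by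
  have h := lintegral_annulus_polar_le hN (R := R) (κ := fun _ => 1) measurable_const hG
  simp only [one_mul, setLIntegral_const, Real.volume_Ioo] at h
  refine h.trans (mul_le_of_le_one_left zero_le ?_)
  rw [ENNReal.ofReal_le_one]
  linarith

/-- Here s > 1/2 is decisive: the exponent 2s - 2 exceeds -1, so the integral converges at both ends
and vanishes with the width 1 - R. -/
theorem lintegral_annDist_rpow_le {s : ℝ} (hs : 1 / 2 < s) (hR : R < 1) :
    ∫⁻ r in Ioo R 1, ENNReal.ofReal (min (1 - r) (r - R) ^ (2 * s - 2))
      ≤ ENNReal.ofReal (2 * (1 - R) ^ (2 * s - 1) / (2 * s - 1)) := by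
  have hint : ∀ h : ℝ, 0 < h → ∫⁻ r in Ioo 0 h, ENNReal.ofReal (r ^ (2 * s - 2))
      = ENNReal.ofReal (h ^ (2 * s - 1) / (2 * s - 1)) := by
    intro h hh
    have hii : IntervalIntegrable (fun r : ℝ => r ^ (2 * s - 2)) volume 0 h :=
      intervalIntegral.intervalIntegrable_rpow' (by linarith)
    rw [Measure.restrict_congr_set Ioo_ae_eq_Ioc, ← ofReal_integral_eq_lintegral_ofReal
      ((intervalIntegrable_iff_integrableOn_Ioc_of_le hh.le).1 hii) ?_,
      ← intervalIntegral.integral_of_le hh.le, integral_rpow (Or.inl (by linarith)),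
      Real.zero_rpow (by linarith), sub_zero, show 2 * s - 2 + 1 = 2 * s - 1 by ring]
    filter_upwards [ae_restrict_mem measurableSet_Ioc] with r hr
    exact Real.rpow_nonneg hr.1.le _
  have hpos : 0 < 1 - R := by linarith
  have hm : Measurable fun r : ℝ => ENNReal.ofReal (r ^ (2 * s - 2)) := by fun_prop
  have h1 : ∫⁻ r in Ioo R 1, ENNReal.ofReal ((1 - r) ^ (2 * s - 2))
      = ENNReal.ofReal ((1 - R) ^ (2 * s - 1) / (2 * s - 1)) := by
    rw [← hint _ hpos, ← lintegral_indicator measurableSet_Ioo,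
      ← lintegral_indicator measurableSet_Ioo, ← lintegral_sub_left_eq_self _ (1 : ℝ)]
    refine lintegral_congr fun r => ?_
    by_cases hr : r ∈ Ioo 0 (1 - R)
    · rw [Set.indicator_of_mem hr, Set.indicator_of_mem (by constructor <;> linarith [hr.1, hr.2]),
        sub_sub_cancel]
    · rw [Set.indicator_of_notMem hr, Set.indicator_of_notMem
        (fun h => hr (by constructor <;> linarith [h.1, h.2]))]
  have h2 : ∫⁻ r in Ioo R 1, ENNReal.ofReal ((r - R) ^ (2 * s - 2))
      = ENNReal.ofReal ((1 - R) ^ (2 * s - 1) / (2 * s - 1)) := by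
    rw [← hint _ hpos, ← lintegral_indicator measurableSet_Ioo,
      ← lintegral_indicator measurableSet_Ioo, ← lintegral_add_right_eq_self _ R]
    refine lintegral_congr fun r => ?_
    by_cases hr : r ∈ Ioo 0 (1 - R)
    · rw [Set.indicator_of_mem hr, Set.indicator_of_mem (by constructor <;> linarith [hr.1, hr.2]),
        add_sub_cancel_right]
    · rw [Set.indicator_of_notMem hr, Set.indicator_of_notMem
        (fun h => hr (by constructor <;> linarith [h.1, h.2]))]
  calc ∫⁻ r in Ioo R 1, ENNReal.ofReal (min (1 - r) (r - R) ^ (2 * s - 2))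
      ≤ ∫⁻ r in Ioo R 1, (ENNReal.ofReal ((1 - r) ^ (2 * s - 2))
          + ENNReal.ofReal ((r - R) ^ (2 * s - 2))) := by
        refine lintegral_mono fun r => ?_
        rcases min_choice (1 - r) (r - R) with h | h <;> simp only [h]
        · exact le_self_add
        · exact le_add_self
    _ = _ := by
        rw [lintegral_add_left (by fun_prop), h1, h2, ← ENNReal.ofReal_add
          (by have := Real.rpow_pos_of_pos hpos (2 * s - 1)
              exact div_nonneg this.le (by linarith))
          (by have := Real.rpow_pos_of_pos hpos (2 * s - 1)
              exact div_nonneg this.le (by linarith))]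
        congr 1
        ring

/-- Moving rω radially to the sphere through z costs less than 2τ/3, so |z| times the angular
distance is below 4τ/3; since |z| ≥ 1/2, the angular distance is below 8τ/3. -/
theorem dist_sphProj_lt (hN : 0 < N) {z : Euc N} (hz : 1 / 2 ≤ ‖z‖) {r τ : ℝ} (hr : 0 < r)
    {ω : USphere N} (h : dist (r • (ω : Euc N)) z < 2 / 3 * τ) :
    |r - ‖z‖| < τ ∧ dist (sphProj hN z) ω < 3 * τ := by
  have h1 : |r - ‖z‖| < 2 / 3 * τ := by
    have := abs_norm_sub_norm_le (r • (ω : Euc N)) z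
    rw [norm_smul_sphere hr.le, ← dist_eq_norm] at this
    linarith
  have hτ : 0 < τ := by linarith [abs_nonneg (r - ‖z‖)]
  refine ⟨by linarith, ?_⟩
  have h2 : dist z (‖z‖ • (ω : Euc N)) = ‖z‖ * dist (sphProj hN z) ω := by
    have := dist_smul₀ ‖z‖ (sphProj hN z : Euc N) (ω : Euc N)
    rw [norm_smul_sphProj, norm_norm] at this
    exact this
  have h3 : dist (r • (ω : Euc N)) (‖z‖ • (ω : Euc N)) = |r - ‖z‖| := by
    rw [dist_eq_norm, ← sub_smul, norm_smul, norm_eq_of_mem_sphere, mul_one, Real.norm_eq_abs]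
  have h4 := dist_triangle_left z (‖z‖ • (ω : Euc N)) (r • (ω : Euc N))
  have h5 : 1 / 2 * dist (sphProj hN z) ω ≤ ‖z‖ * dist (sphProj hN z) ω := by gcongr
  linarith

/-- With p = N - 1 + 2s, t^(-N-1) equals t^(2s-2) t^(-p), and d < 3t allows t^(-p) to be replaced by
3^p d^(-p), the Gagliardo kernel. The factor 2t is the length of the radial interval that the ball
meets. -/
theorem whitney_weight_le {s t d : ℝ} (hs : 1 / 2 < s) (hN : 0 < N) (ht : 0 < t)
    (hd : 0 < d) (h : d < 3 * t) :
    t⁻¹ ^ (N + 2) * (2 * t) ≤ 2 * 3 ^ ((N : ℝ) - 1 + 2 * s) * t ^ (2 * s - 2) *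
      (d ^ ((N : ℝ) - 1 + 2 * s))⁻¹ := by
  set p := (N : ℝ) - 1 + 2 * s with hp
  have hN' : (1 : ℝ) ≤ N := by exact_mod_cast hN
  have hp0 : 0 < p := by linarith
  have h1 : d ^ p ≤ 3 ^ p * t ^ p := by
    rw [← Real.mul_rpow (by norm_num) ht.le]
    exact Real.rpow_le_rpow hd.le h.le hp0.le
  have hdp : 0 < d ^ p := Real.rpow_pos_of_pos hd p
  have htp : 0 < t ^ p := Real.rpow_pos_of_pos ht p
  have h2 : t ^ (2 * s - 2) = t ^ p * t⁻¹ ^ (N + 1) := by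
    rw [inv_pow, ← Real.rpow_natCast, ← Real.rpow_neg ht.le, ← Real.rpow_add ht]
    congr 1
    rw [hp]; push_cast; ring
  have h3 : t⁻¹ ^ (N + 2) * (2 * t) = 2 * t⁻¹ ^ (N + 1) := by
    rw [pow_succ t⁻¹ (N + 1)]
    field_simp
  rw [h2, h3]
  have h4 : 1 ≤ 3 ^ p * t ^ p * (d ^ p)⁻¹ := by
    rw [← div_eq_mul_inv, one_le_div hdp]
    exact h1
  have h5 : 0 ≤ 2 * t⁻¹ ^ (N + 1) := by positivity
  calc 2 * t⁻¹ ^ (N + 1) ≤ 2 * t⁻¹ ^ (N + 1) * (3 ^ p * t ^ p * (d ^ p)⁻¹) :=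
        le_mul_of_one_le_right h5 h4
    _ = _ := by ring

/-- The contribution of one Whitney ball is controlled by one slice of the Gagliardo integral. -/
theorem whitney_slice_le (hN : 0 < N) {s : ℝ} (hs : 1 / 2 < s) {e : USphere N → ℝ≥0∞}
    (he : Measurable e) {z : Euc N} (hz : 1 / 2 ≤ ‖z‖) {t : ℝ} (ht : 0 < t) (ht1 : t ≤ 1 - ‖z‖)
    (he0 : e (sphProj hN z) = 0) :
    ENNReal.ofReal t⁻¹ ^ (N + 2) * ∫⁻ z' in Metric.ball z (2 / 3 * t), e (sphProj hN z')
      ≤ ENNReal.ofReal (2 * 3 ^ ((N : ℝ) - 1 + 2 * s) * t ^ (2 * s - 2)) *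
        ∫⁻ ω, e ω / edist (sphProj hN z) ω ^ ((N : ℝ) - 1 + 2 * s) ∂(sphMeas N) := by
  have hm : Measurable fun z' => e (sphProj hN z') := he.comp (measurable_sphProj hN)
  have hpol : ∀ ω : USphere N, ∫⁻ r in Ioi (0 : ℝ), ENNReal.ofReal (r ^ (N - 1)) *
      (Metric.ball z (2 / 3 * t)).indicator (fun z' => e (sphProj hN z')) (r • (ω : Euc N))
      ≤ if dist (sphProj hN z) ω < 3 * t then ENNReal.ofReal (2 * t) * e ω else 0 := by
    intro ω
    have hpt : ∀ r : ℝ, 0 < r → ENNReal.ofReal (r ^ (N - 1)) *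
        (Metric.ball z (2 / 3 * t)).indicator (fun z' => e (sphProj hN z')) (r • (ω : Euc N))
        ≤ if dist (sphProj hN z) ω < 3 * t then
          (Ioo (‖z‖ - t) (‖z‖ + t)).indicator (fun _ => e ω) r else 0 := by
      intro r hr
      by_cases hmem : r • (ω : Euc N) ∈ Metric.ball z (2 / 3 * t)
      · obtain ⟨h3, h4⟩ := dist_sphProj_lt hN hz hr hmem
        rw [abs_lt] at h3
        rw [if_pos h4, Set.indicator_of_mem hmem, Set.indicator_of_mem
          (by constructor <;> linarith), sphProj_smul hN hr]
        refine mul_le_of_le_one_left zero_le ?_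
        rw [ENNReal.ofReal_le_one]
        refine pow_le_one₀ hr.le ?_
        linarith
      · rw [Set.indicator_of_notMem hmem, mul_zero]
        exact zero_le
    refine (setLIntegral_mono' measurableSet_Ioi hpt).trans ?_
    split_ifs with h
    · refine (setLIntegral_le_lintegral _ _).trans (le_of_eq ?_)
      rw [lintegral_indicator measurableSet_Ioo, setLIntegral_const, Real.volume_Ioo, mul_comm]
      congr 2
      ring
    · simp
  rw [← lintegral_indicator measurableSet_ball,
    lintegral_polar hN (hm.indicator measurableSet_ball),
    ← lintegral_const_mul' _ _ (ENNReal.pow_ne_top ENNReal.ofReal_ne_top),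
    ← lintegral_const_mul' _ _ ENNReal.ofReal_ne_top]
  refine lintegral_mono fun ω => (mul_le_mul' le_rfl (hpol ω)).trans ?_
  split_ifs with h
  -- At distance 0 the Gagliardo kernel is singular, but there ω is the projection of z and e
  -- vanishes.
  · rcases eq_or_lt_of_le (dist_nonneg (x := sphProj hN z) (y := ω)) with hd | hd
    · rw [← eq_of_dist_eq_zero hd.symm, he0]
      simp
    · have hw := whitney_weight_le hs hN ht hd h
      have hdp := Real.rpow_pos_of_pos hd ((N : ℝ) - 1 + 2 * s)
      rw [← ENNReal.ofReal_pow (inv_nonneg.2 ht.le), ← mul_assoc,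
        ← ENNReal.ofReal_mul (by positivity), div_eq_mul_inv, mul_comm (e ω),
        edist_dist (sphProj hN z) ω, ENNReal.ofReal_rpow_of_pos hd,
        ← ENNReal.ofReal_inv_of_pos hdp, ← mul_assoc (ENNReal.ofReal (2 * _ * _)),
        ← ENNReal.ofReal_mul (by positivity)]
      exact mul_le_mul' (ENNReal.ofReal_le_ofReal hw) le_rfl
  · rw [mul_zero]; exact zero_le

/-- The Whitney energy of a homogeneous map is controlled by the Gagliardo semi-norm. -/
theorem whitneyEnergy_le_gagliardoSq (hN : 0 < N) {s : ℝ} (hs : 1 / 2 < s) (hR : 1 / 2 ≤ R)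
    (hR1 : R < 1) {u : USphere N → Y} (hu : StronglyMeasurable u) :
    whitneyEnergy (fun x => u (sphProj hN x)) (annDist N R)
      ≤ ENNReal.ofReal (2 * 3 ^ ((N : ℝ) - 1 + 2 * s)) *
        ENNReal.ofReal (2 * (1 - R) ^ (2 * s - 1) / (2 * s - 1)) * gagliardoSq s u := by
  have hc0 : 0 ≤ 2 * (3 : ℝ) ^ ((N : ℝ) - 1 + 2 * s) := by positivity
  have hgm : Measurable fun q : USphere N × USphere N =>
      edist (u q.1) (u q.2) ^ 2 / edist q.1 q.2 ^ ((N : ℝ) - 1 + 2 * s) :=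
    hu.measurable_edist_sq.div ((measurable_fst.edist measurable_snd).pow_const _)
  have hΓm : Measurable fun ω : USphere N => ∫⁻ ω', edist (u ω) (u ω') ^ 2 /
      edist ω ω' ^ ((N : ℝ) - 1 + 2 * s) ∂(sphMeas N) := hgm.lintegral_prod_right'
  have hA : MeasurableSet {z | 0 < annDist N R z} :=
    measurableSet_lt measurable_const lipschitzWith_annDist.continuous.measurable
  have hκm : Measurable fun r : ℝ => ENNReal.ofReal
      (2 * 3 ^ ((N : ℝ) - 1 + 2 * s) * min (1 - r) (r - R) ^ (2 * s - 2)) := by fun_prop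
  rw [gagliardoSq, lintegral_prod _ hgm.aemeasurable, whitneyEnergy]
  refine (setLIntegral_mono' hA fun z hz => whitney_slice_le hN hs
    (e := fun ω => edist (u (sphProj hN z)) (u ω) ^ 2)
    ((stronglyMeasurable_const.edist hu).measurable.pow_const 2) (hR.trans ?_) hz
    (min_le_left _ _) ?_).trans ?_
  · have h : z ∈ annulus N R := by rw [annulus_eq]; exact hz
    exact h.1.le
  · simp
  rw [← annulus_eq]
  refine (lintegral_annulus_polar_le hN hκm hΓm).trans (mul_le_mul' ?_ le_rfl)
  simp_rw [ENNReal.ofReal_mul hc0]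
  rw [lintegral_const_mul' _ _ ENNReal.ofReal_ne_top]
  exact mul_le_mul' le_rfl (lintegral_annDist_rpow_le hs hR1)

/-- The map on the annulus which is `u` in the outer half and `v` in the inner half. -/
noncomputable def annMap (hN : 0 < N) (R : ℝ) (u v : USphere N → Y) (x : Euc N) : Y :=
  if (1 + R) / 2 ≤ ‖x‖ then u (sphProj hN x) else v (sphProj hN x)

theorem stronglyMeasurable_annMap (hN : 0 < N) {u v : USphere N → Y} (hu : StronglyMeasurable u)
    (hv : StronglyMeasurable v) : StronglyMeasurable (annMap hN R u v) :=
  StronglyMeasurable.ite (measurableSet_le measurable_const measurable_norm)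
    (hu.comp_measurable (measurable_sphProj hN)) (hv.comp_measurable (measurable_sphProj hN))

/-- If the segment from z to z' crosses the middle sphere, then z is within 2/3 t of that sphere
while t is (1-R)/2 minus this distance, so t is at least (1-R)/10, with room to spare. The jump is
charged at z', which makes it an L² distance of u and v. -/
theorem edist_annMap_sq_le (hN : 0 < N) (u v : USphere N → Y) {z z' : Euc N}
    (hzz : dist z' z < 2 / 3 * annDist N R z) :
    edist (annMap hN R u v z) (annMap hN R u v z') ^ 2
      ≤ 2 * edist (u (sphProj hN z)) (u (sphProj hN z')) ^ 2
        + 2 * edist (v (sphProj hN z)) (v (sphProj hN z')) ^ 2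
        + if (1 - R) / 10 ≤ annDist N R z then
            2 * edist (u (sphProj hN z')) (v (sphProj hN z')) ^ 2 else 0 := by
  have hn : |‖z'‖ - ‖z‖| < 2 / 3 * annDist N R z := by
    have := abs_norm_sub_norm_le z' z
    rw [← dist_eq_norm] at this
    linarith
  rw [abs_lt] at hn
  unfold annMap
  have htwo : ∀ a : ℝ≥0∞, a ≤ 2 * a := fun a => le_mul_of_one_le_left zero_le (by norm_num)
  split_ifs with h1 h2 h3 h3 h2 h3 h3
  · exact (htwo _).trans ((le_self_add).trans le_self_add)
  · exact (htwo _).trans ((le_self_add).trans le_self_add)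
  · refine (edist_sq_le_two_mul _ (u (sphProj hN z')) _).trans ?_
    rw [mul_add]
    gcongr
    exact le_self_add
  · exfalso
    apply h3
    simp only [annDist, le_min_iff] at hn ⊢
    have h4 := min_le_left (1 - ‖z‖) (‖z‖ - R)
    have h5 := min_le_right (1 - ‖z‖) (‖z‖ - R)
    rcases min_choice (1 - ‖z‖) (‖z‖ - R) with h6 | h6 <;> rw [h6] at hn h4 h5 <;>
      constructor <;> linarith
  · refine (edist_sq_le_two_mul _ (v (sphProj hN z')) _).trans ?_
    rw [mul_add, edist_comm (v (sphProj hN z'))]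
    gcongr
    exact le_add_self
  · exfalso
    apply h3
    simp only [annDist, le_min_iff] at hn ⊢
    have h4 := min_le_left (1 - ‖z‖) (‖z‖ - R)
    have h5 := min_le_right (1 - ‖z‖) (‖z‖ - R)
    rcases min_choice (1 - ‖z‖) (‖z‖ - R) with h6 | h6 <;> rw [h6] at hn h4 h5 <;>
      constructor <;> linarith
  · exact (htwo _).trans ((le_add_self).trans le_self_add)
  · exact (htwo _).trans ((le_add_self).trans le_self_add)

/-- The jump term lives where t ≥ (1-R)/10, so its weight is bounded by a power of 10/(1-R); this is
the source of the constant C depending on R. -/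
theorem whitneyEnergy_annMap_le (hN : 0 < N) (hR : 0 ≤ R) (hR1 : R < 1) {u v : USphere N → Y}
    (hu : StronglyMeasurable u) (hv : StronglyMeasurable v) :
    whitneyEnergy (annMap hN R u v) (annDist N R)
      ≤ 2 * whitneyEnergy (fun x => u (sphProj hN x)) (annDist N R)
        + 2 * whitneyEnergy (fun x => v (sphProj hN x)) (annDist N R)
        + 2 * ENNReal.ofReal (10 / (1 - R)) ^ (N + 2) * volume (Metric.ball (0 : Euc N) 1) *
          sphDistSq u v := by
  have htm : Measurable (annDist N R) := lipschitzWith_annDist.continuous.measurable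
  have hA : MeasurableSet {z | 0 < annDist N R z} := measurableSet_lt measurable_const htm
  have hsm : ∀ {w : USphere N → Y}, StronglyMeasurable w → Measurable fun q : Euc N × Euc N =>
      edist (w (sphProj hN q.1)) (w (sphProj hN q.2)) ^ 2 := fun hw =>
    (hw.comp_measurable (measurable_sphProj hN)).measurable_edist_sq
  have hdm : Measurable fun ω => edist (u ω) (v ω) ^ 2 := (hu.edist hv).measurable.pow_const 2
  have hdm' : Measurable fun z => edist (u (sphProj hN z)) (v (sphProj hN z)) ^ 2 :=
    hdm.comp (measurable_sphProj hN)
  set D := ∫⁻ z in annulus N R, edist (u (sphProj hN z)) (v (sphProj hN z)) ^ 2 with hD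
  have hDle : D ≤ sphDistSq u v := lintegral_annulus_sphProj_le hN hR hdm
  set κ := ENNReal.ofReal (10 / (1 - R)) ^ (N + 2) with hκ
  have hpt : ∀ z, 0 < annDist N R z → ENNReal.ofReal (annDist N R z)⁻¹ ^ (N + 2) *
      ∫⁻ z' in Metric.ball z (2 / 3 * annDist N R z),
        edist (annMap hN R u v z) (annMap hN R u v z') ^ 2
      ≤ 2 * (ENNReal.ofReal (annDist N R z)⁻¹ ^ (N + 2) *
          ∫⁻ z' in Metric.ball z (2 / 3 * annDist N R z),
            edist (u (sphProj hN z)) (u (sphProj hN z')) ^ 2)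
        + 2 * (ENNReal.ofReal (annDist N R z)⁻¹ ^ (N + 2) *
          ∫⁻ z' in Metric.ball z (2 / 3 * annDist N R z),
            edist (v (sphProj hN z)) (v (sphProj hN z')) ^ 2) + 2 * κ * D := by
    intro z hz
    have h1 : ∫⁻ z' in Metric.ball z (2 / 3 * annDist N R z),
        edist (annMap hN R u v z) (annMap hN R u v z') ^ 2
        ≤ 2 * (∫⁻ z' in Metric.ball z (2 / 3 * annDist N R z),
            edist (u (sphProj hN z)) (u (sphProj hN z')) ^ 2)
          + 2 * (∫⁻ z' in Metric.ball z (2 / 3 * annDist N R z),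
            edist (v (sphProj hN z)) (v (sphProj hN z')) ^ 2)
          + if (1 - R) / 10 ≤ annDist N R z then 2 * D else 0 := by
      refine (setLIntegral_mono' measurableSet_ball fun z' hz' =>
        edist_annMap_sq_le hN u v hz').trans ?_
      have hmu : Measurable fun z' => 2 * edist (u (sphProj hN z)) (u (sphProj hN z')) ^ 2 :=
        ((hsm hu).comp measurable_prodMk_left).const_mul 2
      have hmv : Measurable fun z' => 2 * edist (v (sphProj hN z)) (v (sphProj hN z')) ^ 2 :=
        ((hsm hv).comp measurable_prodMk_left).const_mul 2
      have hmuv : Measurable fun z' => 2 * edist (u (sphProj hN z)) (u (sphProj hN z')) ^ 2 +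
          2 * edist (v (sphProj hN z)) (v (sphProj hN z')) ^ 2 := hmu.add hmv
      rw [lintegral_add_left hmuv, lintegral_add_left hmu,
        lintegral_const_mul' _ _ ENNReal.ofNat_ne_top,
        lintegral_const_mul' _ _ ENNReal.ofNat_ne_top]
      refine add_le_add le_rfl ?_
      split_ifs with h
      · rw [lintegral_const_mul' _ _ ENNReal.ofNat_ne_top]
        gcongr
        refine lintegral_mono_set fun z' hz' => ?_
        rw [annulus_eq]
        have h2 := lipschitzWith_annDist (R := R).dist_le_mul z' z
        rw [NNReal.coe_one, one_mul, Real.dist_eq] at h2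
        have h3 := abs_le.1 (h2.trans (le_of_lt hz'))
        have : 0 < annDist N R z' := by linarith
        exact this
      · simp
    refine (mul_le_mul' le_rfl h1).trans ?_
    rw [mul_add, mul_add, mul_left_comm _ 2, mul_left_comm _ 2]
    refine add_le_add le_rfl ?_
    split_ifs with h
    · rw [mul_left_comm, mul_assoc]
      gcongr
      rw [inv_eq_one_div, hκ]
      refine pow_le_pow_left' (ENNReal.ofReal_le_ofReal ?_) _
      refine (one_div_le_one_div_of_le ?_ h).trans (le_of_eq ?_)
      · linarith
      · rw [one_div_div]
    · rw [mul_zero]; exact zero_le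
  have hmE : ∀ {w : USphere N → Y}, StronglyMeasurable w → Measurable fun z =>
      ENNReal.ofReal (annDist N R z)⁻¹ ^ (N + 2) * ∫⁻ z' in Metric.ball z (2 / 3 * annDist N R z),
        edist (w (sphProj hN z)) (w (sphProj hN z')) ^ 2 := fun hw =>
    (htm.inv.ennreal_ofReal.pow_const _).mul
      (measurable_setLIntegral_ball (hsm hw) (htm.const_mul _))
  have hvol : volume {z | 0 < annDist N R z} ≤ volume (Metric.ball (0 : Euc N) 1) := by
    refine measure_mono fun z hz => ?_
    rw [← annulus_eq] at hz
    rw [mem_ball_zero_iff]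
    exact hz.2
  calc whitneyEnergy (annMap hN R u v) (annDist N R)
      ≤ ∫⁻ z in {z | 0 < annDist N R z}, _ := setLIntegral_mono' hA hpt
    _ = 2 * whitneyEnergy (fun x => u (sphProj hN x)) (annDist N R)
        + 2 * whitneyEnergy (fun x => v (sphProj hN x)) (annDist N R)
        + 2 * κ * D * volume {z | 0 < annDist N R z} := by
        rw [lintegral_add_right _ measurable_const, lintegral_add_left ((hmE hu).const_mul 2),
          lintegral_const_mul _ (hmE hu), lintegral_const_mul _ (hmE hv), setLIntegral_const]
        rfl
    _ ≤ _ := by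
        refine add_le_add le_rfl ?_
        calc 2 * κ * D * volume {z | 0 < annDist N R z}
            ≤ 2 * κ * sphDistSq u v * volume (Metric.ball (0 : Euc N) 1) := by gcongr
          _ = _ := by ring

end Homogeneous

/-! ### The Whitney energy of a map with an upper gradient -/

section Translation

variable {N : ℕ} {Y : Type} [PseudoMetricSpace Y]

theorem sq_setLIntegral_Ioo_le {f : ℝ → ℝ≥0∞} (hf : Measurable f) :
    (∫⁻ s in Ioo (0 : ℝ) 1, f s) ^ 2 ≤ ∫⁻ s in Ioo (0 : ℝ) 1, f s ^ 2 := by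
  have h := ENNReal.lintegral_mul_le_Lp_mul_Lq (volume.restrict (Ioo (0 : ℝ) 1))
    Real.HolderConjugate.two_two hf.aemeasurable (measurable_const (a := (1 : ℝ≥0∞))).aemeasurable
  simp only [Pi.mul_apply, mul_one, one_pow, ENNReal.one_rpow, lintegral_const, Measure.restrict_apply_univ,
    Real.volume_Ioo, sub_zero, ENNReal.ofReal_one, ENNReal.rpow_ofNat] at h
  refine (pow_le_pow_left' h 2).trans (le_of_eq ?_)
  rw [← ENNReal.rpow_natCast, ← ENNReal.rpow_mul]
  norm_num

/-- The Whitney energy is controlled by the square integral of an upper gradient. -/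
theorem whitneyEnergy_le_lintegral_sq {U : Euc N → Y} (hU : StronglyMeasurable U) {t : Euc N → ℝ}
    (ht : LipschitzWith 1 t) {Ψ : Euc N → ℝ≥0∞} (hΨ : Measurable Ψ)
    (h : ∀ y, ∀ᵐ z, ‖y‖ < t z →
      edist (U z) (U (z + y)) ≤ ‖y‖ₑ * ∫⁻ s in Ioo (0 : ℝ) 1, Ψ (z + s • y)) :
    whitneyEnergy U t ≤ ENNReal.ofReal (10 / 3) ^ N * volume (Metric.ball (0 : Euc N) 1) *
      ∫⁻ x in {x | 0 < t x}, Ψ x ^ 2 := by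
  have htm : Measurable t := ht.continuous.measurable
  have hA : MeasurableSet {z | 0 < t z} := measurableSet_lt measurable_const htm
  have htd : ∀ x y, |t x - t y| ≤ ‖x - y‖ := fun x y => by
    have := ht.dist_le_mul x y
    rwa [NNReal.coe_one, one_mul, Real.dist_eq, dist_eq_norm] at this
  have hPm : Measurable fun p : Euc N × Euc N => if ‖p.2‖ < 2 / 3 * t p.1 then
      ENNReal.ofReal (t p.1)⁻¹ ^ (N + 2) * edist (U p.1) (U (p.1 + p.2)) ^ 2 else 0 := by
    refine Measurable.ite (measurableSet_lt measurable_snd.norm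
      ((htm.comp measurable_fst).const_mul _)) ?_ measurable_const
    exact ((htm.comp measurable_fst).inv.ennreal_ofReal.pow_const _).mul
      (hU.measurable_edist_sq.comp (measurable_fst.prodMk (measurable_fst.add measurable_snd)))
  -- For |y| < 2/3 t z, every point x of the segment from z to z + y satisfies t z / 3 ≤ t x ≤ 5/3 t
  -- z. So |y| < 2 t x, and the weight at z is at most (5/3)^N times the weight at x.
  set Q : Euc N × Euc N → ℝ≥0∞ := fun p => if ‖p.1‖ < 2 * t p.2 then
      ENNReal.ofReal (5 / 3) ^ N * (ENNReal.ofReal (t p.2)⁻¹ ^ N * Ψ p.2 ^ 2) else 0 with hQ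
  have hQm : Measurable Q := by
    refine Measurable.ite (measurableSet_lt measurable_fst.norm
      ((htm.comp measurable_snd).const_mul _)) ?_ measurable_const
    exact (((htm.comp measurable_snd).inv.ennreal_ofReal.pow_const _).mul
      ((hΨ.comp measurable_snd).pow_const 2)).const_mul _
  have hpt : ∀ y, ∀ᵐ z, (if ‖y‖ < 2 / 3 * t z then
      ENNReal.ofReal (t z)⁻¹ ^ (N + 2) * edist (U z) (U (z + y)) ^ 2 else 0)
      ≤ ∫⁻ s in Ioo (0 : ℝ) 1, Q (y, z + s • y) := by
    intro y
    filter_upwards [h y] with z hz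
    split_ifs with hy
    · have htz : 0 < t z := by linarith [norm_nonneg y]
      have hm : Measurable fun s : ℝ => Ψ (z + s • y) := hΨ.comp (by fun_prop)
      calc ENNReal.ofReal (t z)⁻¹ ^ (N + 2) * edist (U z) (U (z + y)) ^ 2
          ≤ ENNReal.ofReal (t z)⁻¹ ^ (N + 2) *
            (ENNReal.ofReal (t z) ^ 2 * ∫⁻ s in Ioo (0 : ℝ) 1, Ψ (z + s • y) ^ 2) := by
            refine mul_le_mul' le_rfl ((pow_le_pow_left' (hz (by linarith)) 2).trans ?_)
            rw [mul_pow]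
            refine mul_le_mul' (pow_le_pow_left' ?_ 2) (sq_setLIntegral_Ioo_le hm)
            rw [← ofReal_norm]
            exact ENNReal.ofReal_le_ofReal (by linarith)
        _ = ∫⁻ s in Ioo (0 : ℝ) 1, ENNReal.ofReal (t z)⁻¹ ^ N * Ψ (z + s • y) ^ 2 := by
            rw [lintegral_const_mul' _ _ (ENNReal.pow_ne_top ENNReal.ofReal_ne_top), ← mul_assoc,
              pow_add, mul_assoc (_ ^ N), ← mul_pow, ← ENNReal.ofReal_mul (by positivity),
              inv_mul_cancel₀ htz.ne', ENNReal.ofReal_one, one_pow, mul_one]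
        _ ≤ _ := by
            refine setLIntegral_mono' measurableSet_Ioo fun s hs => ?_
            have h1 := htd z (z + s • y)
            rw [sub_add_cancel_left, norm_neg, norm_smul, Real.norm_of_nonneg hs.1.le] at h1
            have h2 : s * ‖y‖ ≤ ‖y‖ := mul_le_of_le_one_left (norm_nonneg _) hs.2.le
            have h3 := abs_le.1 (h1.trans h2)
            simp only [hQ]
            rw [if_pos (by linarith), ← mul_assoc, ← mul_pow,
              ← ENNReal.ofReal_mul (by norm_num)]
            refine mul_le_mul' (pow_le_pow_left' (ENNReal.ofReal_le_ofReal ?_) _) le_rfl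
            rw [← div_eq_mul_inv, le_div_iff₀ (by linarith), inv_mul_le_iff₀ htz]
            linarith
    · exact zero_le
  calc whitneyEnergy U t = ∫⁻ z, ∫⁻ y, if ‖y‖ < 2 / 3 * t z then
        ENNReal.ofReal (t z)⁻¹ ^ (N + 2) * edist (U z) (U (z + y)) ^ 2 else 0 := by
        rw [whitneyEnergy, ← lintegral_indicator hA]
        refine lintegral_congr fun z => ?_
        by_cases hz : 0 < t z
        · rw [Set.indicator_of_mem (by exact hz), ← lintegral_indicator measurableSet_ball,
            ← lintegral_add_left_eq_self _ z,
            ← lintegral_const_mul' _ _ (ENNReal.pow_ne_top ENNReal.ofReal_ne_top)]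
          refine lintegral_congr fun y => ?_
          by_cases hy : ‖y‖ < 2 / 3 * t z
          · rw [if_pos hy, Set.indicator_of_mem (by simpa using hy)]
          · rw [if_neg hy, Set.indicator_of_notMem (by simpa using hy), mul_zero]
        · rw [Set.indicator_of_notMem (by exact hz)]
          refine (lintegral_eq_zero_of_ae_eq_zero (ae_of_all _ fun y => ?_)).symm
          exact if_neg fun hy => hz (by linarith [norm_nonneg y])
    _ = ∫⁻ y, ∫⁻ z, if ‖y‖ < 2 / 3 * t z then
        ENNReal.ofReal (t z)⁻¹ ^ (N + 2) * edist (U z) (U (z + y)) ^ 2 else 0 :=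
        lintegral_lintegral_swap hPm.aemeasurable
    _ ≤ ∫⁻ y, ∫⁻ z, ∫⁻ s in Ioo (0 : ℝ) 1, Q (y, z + s • y) :=
        lintegral_mono fun y => lintegral_mono_ae (hpt y)
    -- For fixed y and s the shift by s • y preserves volume, so the parameter s disappears.
    -- Integrating over |y| < 2 t x will then cancel the weight (t x)^(-N).
    _ = ∫⁻ y, ∫⁻ x, Q (y, x) := by
        refine lintegral_congr fun y => ?_
        rw [lintegral_lintegral_swap (by
          exact (hQm.comp (measurable_const.prodMk (by fun_prop))).aemeasurable)]
        simp_rw [lintegral_add_right_eq_self (fun x => Q (y, x))]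
        rw [setLIntegral_const, Real.volume_Ioo, sub_zero, ENNReal.ofReal_one, mul_one]
    _ = ∫⁻ x, ∫⁻ y, Q (y, x) := lintegral_lintegral_swap hQm.aemeasurable
    _ = ∫⁻ x in {x | 0 < t x}, ENNReal.ofReal (10 / 3) ^ N *
          volume (Metric.ball (0 : Euc N) 1) * Ψ x ^ 2 := by
        rw [← lintegral_indicator hA]
        refine lintegral_congr fun x => ?_
        by_cases hx : 0 < t x
        · have h1 : (fun y => Q (y, x)) = (Metric.ball (0 : Euc N) (2 * t x)).indicator fun _ =>
              ENNReal.ofReal (5 / 3) ^ N * (ENNReal.ofReal (t x)⁻¹ ^ N * Ψ x ^ 2) := by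
            funext y
            simp only [hQ, Set.indicator, mem_ball_zero_iff]
          rw [h1, lintegral_indicator measurableSet_ball, setLIntegral_const,
            Measure.addHaar_ball_of_pos _ _ (by positivity), finrank_euclideanSpace_fin,
            Set.indicator_of_mem (by exact hx), ENNReal.ofReal_pow (by positivity)]
          have h2 : ENNReal.ofReal (10 / 3) = ENNReal.ofReal (5 / 3) * ENNReal.ofReal (t x)⁻¹ *
              ENNReal.ofReal (2 * t x) := by
            rw [← ENNReal.ofReal_mul (by norm_num), ← ENNReal.ofReal_mul (by positivity)]
            congr 1
            field_simp
            norm_num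
          rw [h2, mul_pow, mul_pow]
          ring
        · rw [Set.indicator_of_notMem (by exact hx)]
          refine lintegral_eq_zero_of_ae_eq_zero (ae_of_all _ fun y => ?_)
          exact if_neg fun hy => hx (by linarith [norm_nonneg y])
    _ = _ := lintegral_const_mul' _ _ (ENNReal.mul_ne_top
        (ENNReal.pow_ne_top ENNReal.ofReal_ne_top) measure_ball_lt_top.ne)

end Translation

/-! ### Differences of weakly differentiable functions along translated segments -/

section WeakTranslation

variable {N : ℕ}

theorem EuclideanSpace.sum_smul_stdVec (y : Euc N) : ∑ j, y j • (stdVec j : Euc N) = y := by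
  have := (EuclideanSpace.basisFun (Fin N) ℝ).sum_repr y
  simpa using this

theorem sum_mul_clm_stdVec (L : Euc N →L[ℝ] ℝ) (y : Euc N) : ∑ j, y j * L (stdVec j) = L y := by
  conv_rhs => rw [← EuclideanSpace.sum_smul_stdVec y]
  rw [map_sum]
  simp only [map_smul, smul_eq_mul]

theorem integrable_prod_translate {Γ : Euc N → ℝ} (hΓ : Integrable Γ) (hΓm : StronglyMeasurable Γ)
    (y : Euc N) : Integrable (fun p : Euc N × ℝ => Γ (p.1 + p.2 • y))
      (volume.prod (volume.restrict (Ioo (0 : ℝ) 1))) := by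
  have hm : StronglyMeasurable fun p : Euc N × ℝ => Γ (p.1 + p.2 • y) :=
    hΓm.comp_measurable (by fun_prop)
  refine (integrable_prod_iff' hm.aestronglyMeasurable).2 ⟨ae_of_all _ fun s => hΓ.comp_add_right (s • y), ?_⟩
  simp only
  have : ∀ s : ℝ, ∫ z, ‖Γ (z + s • y)‖ = ∫ z, ‖Γ z‖ := fun s =>
    integral_add_right_eq_self (fun z => ‖Γ z‖) (s • y)
  simp only [this]
  exact integrable_const _

/-- A function with a weak gradient is the integral of its gradient along almost all translates
of a given segment. -/
theorem ae_sub_eq_integral_of_weak {Ω O : Set (Euc N)} (hO : IsOpen O) {F : Euc N → ℝ}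
    {G : Fin N → Euc N → ℝ} (hF : Integrable F) (hG : ∀ j, Integrable (G j))
    (hGm : ∀ j, StronglyMeasurable (G j))
    (hw : ∀ j, ∀ φ : Euc N → ℝ, ContDiff ℝ (⊤ : ℕ∞) φ → HasCompactSupport φ → tsupport φ ⊆ Ω →
      ∫ x, F x * fderiv ℝ φ x (stdVec j) = -∫ x, G j x * φ x)
    (y : Euc N) (hy : ∀ z ∈ O, ∀ s ∈ Icc (0 : ℝ) 1, z + s • y ∈ Ω) :
    ∀ᵐ z, z ∈ O → F (z + y) - F z = ∫ s in Ioo (0 : ℝ) 1, ∑ j, y j * G j (z + s • y) := by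
  set Γ : Euc N → ℝ := fun x => ∑ j, y j * G j x with hΓ
  have hΓi : Integrable Γ := integrable_finsetSum _ fun j _ => (hG j).const_mul _
  have hΓm : StronglyMeasurable Γ :=
    Finset.stronglyMeasurable_fun_sum _ fun j _ => (hGm j).const_mul _
  have hΓp := integrable_prod_translate hΓi hΓm y
  have hΓs : Integrable fun z => ∫ s in Ioo (0 : ℝ) 1, Γ (z + s • y) := hΓp.integral_prod_left
  have hD : Integrable fun z => F (z + y) - F z - ∫ s in Ioo (0 : ℝ) 1, Γ (z + s • y) :=
    ((hF.comp_add_right y).sub hF).sub hΓs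
  -- By the fundamental lemma of the calculus of variations it suffices to test against smooth η
  -- supported in O. The translates of η by s • y are then supported in Ω and are admissible in the
  -- weak formula for each s.
  suffices key : ∀ η : Euc N → ℝ, ContDiff ℝ (⊤ : ℕ∞) η → HasCompactSupport η → tsupport η ⊆ O →
      ∫ z, η z • (F (z + y) - F z - ∫ s in Ioo (0 : ℝ) 1, Γ (z + s • y)) = 0 from
    (hO.ae_eq_zero_of_integral_contDiff_smul_eq_zero (hD.locallyIntegrable.locallyIntegrableOn O)
      key).mono fun z hz hzO => sub_eq_zero.1 (hz hzO)
  intro η hη hηc hηO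
  have hη1 : ContDiff ℝ 1 η := hη.of_le (by norm_cast)
  have hηb : ∃ B, ∀ x, ‖η x‖ ≤ B := hη.continuous.bounded_above_of_compact_support hηc
  have hdηc : Continuous (fderiv ℝ η) := hη1.continuous_fderiv one_ne_zero
  obtain ⟨B, hB⟩ := hηb
  obtain ⟨B', hB'⟩ := hdηc.bounded_above_of_compact_support (hηc.fderiv ℝ)
  have hmulη : ∀ {f : Euc N → ℝ}, Integrable f → ∀ a, Integrable fun z => f z * η (z - a) :=
    fun hf a => hf.mul_bdd (c := B) (hη.continuous.comp (by fun_prop)).aestronglyMeasurable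
      (ae_of_all _ fun z => hB _)
  have hweak : ∀ s ∈ Ioo (0 : ℝ) 1, ∫ z, Γ z * η (z - s • y)
      = -∫ z, F z * fderiv ℝ η (z - s • y) y := by
    intro s hs
    have hηs : ContDiff ℝ (⊤ : ℕ∞) fun z => η (z - s • y) :=
      hη.comp (contDiff_id.sub contDiff_const)
    have hηsc : HasCompactSupport fun z => η (z - s • y) :=
      hηc.comp_homeomorph (Homeomorph.subRight (s • y))
    have hsub : tsupport (fun z => η (z - s • y)) ⊆ Ω := by
      intro x hx
      have hx' : x - s • y ∈ tsupport η := by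
        have := tsupport_comp_eq_preimage η (Homeomorph.subRight (s • y))
        have hx2 : x ∈ tsupport (η ∘ (Homeomorph.subRight (s • y))) := hx
        rw [this] at hx2
        exact hx2
      have := hy _ (hηO hx') s ⟨hs.1.le, hs.2.le⟩
      rwa [sub_add_cancel] at this
    have hj : ∀ j, ∫ z, y j * G j z * η (z - s • y)
        = -∫ z, y j * (F z * fderiv ℝ η (z - s • y) (stdVec j)) := fun j => by
      have := hw j _ hηs hηsc hsub
      simp only [fderiv_comp_sub] at this
      simp only [mul_assoc]
      rw [integral_const_mul, integral_const_mul, this]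
      ring
    have hFd : ∀ j : Fin N, Integrable fun z =>
        y j * (F z * fderiv ℝ η (z - s • y) (stdVec j)) := fun j => by
      refine (hF.mul_bdd (c := B') ?_ (ae_of_all _ fun z => ?_)).const_mul _
      · exact ((hdηc.comp (by fun_prop)).clm_apply continuous_const).aestronglyMeasurable
      · refine (ContinuousLinearMap.le_opNorm _ _).trans ?_
        simpa using hB' (z - s • y)
    calc ∫ z, Γ z * η (z - s • y) = ∫ z, ∑ j, y j * G j z * η (z - s • y) := by
          simp only [hΓ, Finset.sum_mul]
      _ = ∑ j, -∫ z, y j * (F z * fderiv ℝ η (z - s • y) (stdVec j)) := by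
          rw [integral_finsetSum _ fun j _ => hmulη ((hG j).const_mul _) _]
          exact Finset.sum_congr rfl fun j _ => hj j
      _ = -∫ z, F z * fderiv ℝ η (z - s • y) y := by
          rw [Finset.sum_neg_distrib, ← integral_finsetSum _ fun j _ => hFd j]
          congr 1
          refine integral_congr_ae (ae_of_all _ fun z => ?_)
          simp only
          rw [← sum_mul_clm_stdVec, Finset.mul_sum]
          exact Finset.sum_congr rfl fun j _ => by ring
  have hFprod : Integrable (fun p : Euc N × ℝ => F p.1 * fderiv ℝ η (p.1 - p.2 • y) y)
      (volume.prod (volume.restrict (Ioo (0 : ℝ) 1))) := by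
    refine (hF.comp_fst _).mul_bdd (c := B' * ‖y‖) ?_ (ae_of_all _ fun p => ?_)
    · exact ((hdηc.comp (by fun_prop)).clm_apply continuous_const).aestronglyMeasurable
    · exact (ContinuousLinearMap.le_opNorm _ _).trans (by gcongr; exact hB' _)
  have hηΓ : Integrable (fun p : Euc N × ℝ => η p.1 * Γ (p.1 + p.2 • y))
      (volume.prod (volume.restrict (Ioo (0 : ℝ) 1))) :=
    hΓp.bdd_mul (c := B) (hη.continuous.comp continuous_fst).aestronglyMeasurable
      (ae_of_all _ fun p => hB _)
  -- The fundamental theorem of calculus is applied to the test function, along the segment.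
  have hseg : ∀ z, ∫ s in Ioo (0 : ℝ) 1, fderiv ℝ η (z - s • y) y = η z - η (z - y) := by
    intro z
    have hd : ∀ s : ℝ, HasDerivAt (fun s : ℝ => -η (z - s • y)) (fderiv ℝ η (z - s • y) y) s := by
      intro s
      have h1 : HasDerivAt (fun s : ℝ => z - s • y) (-y) s := by
        simpa using ((hasDerivAt_id s).smul_const y).const_sub z
      have h2 := ((hη1.differentiable one_ne_zero (z - s • y)).hasFDerivAt.comp_hasDerivAt s h1).neg
      simpa using! h2
    have := intervalIntegral.integral_eq_sub_of_hasDerivAt (a := 0) (b := 1) (fun s _ => hd s)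
      (((hdηc.comp (by fun_prop)).clm_apply continuous_const).intervalIntegrable _ _)
    rw [← integral_Ioc_eq_integral_Ioo, ← intervalIntegral.integral_of_le zero_le_one, this]
    simp only [one_smul, zero_smul, sub_zero]
    ring
  have hlast : ∫ z, η z * ∫ s in Ioo (0 : ℝ) 1, Γ (z + s • y)
      = ∫ z, F z * (η (z - y) - η z) := by
    calc ∫ z, η z * ∫ s in Ioo (0 : ℝ) 1, Γ (z + s • y)
        = ∫ z, ∫ s in Ioo (0 : ℝ) 1, η z * Γ (z + s • y) :=
          integral_congr_ae (ae_of_all _ fun z => (integral_const_mul _ _).symm)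
      _ = ∫ s in Ioo (0 : ℝ) 1, ∫ z, η z * Γ (z + s • y) := integral_integral_swap hηΓ
      _ = ∫ s in Ioo (0 : ℝ) 1, -∫ z, F z * fderiv ℝ η (z - s • y) y := by
          refine setIntegral_congr_fun measurableSet_Ioo fun s hs => ?_
          rw [← hweak s hs, ← integral_sub_right_eq_self _ (s • y)]
          refine integral_congr_ae (ae_of_all _ fun z => ?_)
          simp only
          rw [sub_add_cancel, mul_comm]
      _ = -∫ z, ∫ s in Ioo (0 : ℝ) 1, F z * fderiv ℝ η (z - s • y) y := by
          rw [integral_neg, integral_integral_swap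
            (f := fun z (s : ℝ) => F z * fderiv ℝ η (z - s • y) y) hFprod]
      _ = _ := by
          rw [← integral_neg]
          refine integral_congr_ae (ae_of_all _ fun z => ?_)
          simp only
          rw [integral_const_mul, hseg]
          ring
  have hi1 : Integrable fun z => η z * F (z + y) :=
    (hF.comp_add_right y).bdd_mul (c := B) hη.continuous.aestronglyMeasurable
      (ae_of_all _ fun z => hB _)
  have hi2 : Integrable fun z => η z * F z :=
    hF.bdd_mul (c := B) hη.continuous.aestronglyMeasurable (ae_of_all _ fun z => hB _)
  have hi3 : Integrable fun z => η z * ∫ s in Ioo (0 : ℝ) 1, Γ (z + s • y) :=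
    hΓs.bdd_mul (c := B) hη.continuous.aestronglyMeasurable (ae_of_all _ fun z => hB _)
  have hi12 : Integrable fun z => η z * F (z + y) - η z * F z := hi1.sub hi2
  have hi4 : Integrable fun z => F z * η z := by simpa using hmulη hF 0
  simp only [smul_eq_mul, mul_sub]
  rw [integral_sub hi12 hi3, integral_sub hi1 hi2, hlast]
  simp only [mul_sub]
  rw [integral_sub (hmulη hF y) hi4, ← integral_sub_right_eq_self (fun z => η z * F (z + y)) y]
  simp only [sub_add_cancel, mul_comm (η _)]
  ring

end WeakTranslation

/-! ### Weak gradient of a homogeneous extension -/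

section HomogeneousWeak

variable {N : ℕ} {R : ℝ}

theorem integrable_annulus_sphProj (hN : 0 < N) (hR : 0 ≤ R) {f : USphere N → ℝ}
    (hfm : StronglyMeasurable f) (hf : Integrable f (sphMeas N)) :
    IntegrableOn (fun x => f (sphProj hN x)) (annulus N R) := by
  refine ⟨(hfm.comp_measurable (measurable_sphProj hN)).aestronglyMeasurable, ?_⟩
  exact (lintegral_annulus_sphProj_le hN hR (G := fun ω => ‖f ω‖ₑ) hfm.measurable.enorm).trans_lt hf.2

theorem integral_annulus_polar (hN : 0 < N) (hR : 0 ≤ R) {H : Euc N → ℝ}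
    (hH : IntegrableOn H (annulus N R)) :
    ∫ x in annulus N R, H x
      = ∫ ω : USphere N, (∫ r in Ioo R 1, r ^ (N - 1) * H (r • (ω : Euc N))) ∂(sphMeas N) := by
  have hA : MeasurableSet (annulus N R) := isOpen_annulus.measurableSet
  rw [← integral_indicator hA, integral_polar hN ((integrable_indicator_iff hA).2 hH)]
  refine integral_congr_ae (ae_of_all _ fun ω => ?_)
  simp only
  rw [← integral_indicator measurableSet_Ioi, ← integral_indicator measurableSet_Ioo]
  refine integral_congr_ae (ae_of_all _ fun r => ?_)
  by_cases hr : 0 < r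
  · rw [Set.indicator_of_mem (by exact hr)]
    by_cases hr1 : r ∈ Ioo R 1
    · rw [Set.indicator_of_mem hr1, Set.indicator_of_mem
        (by simp only [annulus, mem_ofPred_eq, norm_smul_sphere hr.le]; exact hr1)]
    · rw [Set.indicator_of_notMem hr1, Set.indicator_of_notMem
        (by simp only [annulus, mem_ofPred_eq, norm_smul_sphere hr.le]; exact hr1), mul_zero]
  · rw [Set.indicator_of_notMem (by exact hr), Set.indicator_of_notMem]
    exact fun h => hr (by linarith [h.1])

/-- Integration by parts along a ray, for a test function supported in the annulus. -/
theorem integral_radial_deriv (hR : 0 < R) (hR1 : R < 1) {η : Euc N → ℝ} (hη : ContDiff ℝ 1 η)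
    (hηA : tsupport η ⊆ annulus N R) (hN : 0 < N) (ω : USphere N) :
    ∫ r in Ioo R 1, r ^ (N - 1) * fderiv ℝ η (r • (ω : Euc N)) ω
      = -(((N : ℝ) - 1) * ∫ r in Ioo R 1, r ^ (N - 1) * r⁻¹ * η (r • (ω : Euc N))) := by
  have h0 : ∀ r : ℝ, 0 ≤ r → r ∉ Ioo R 1 → η (r • (ω : Euc N)) = 0 := fun r hr0 hr =>
    image_eq_zero_of_notMem_tsupport fun h => by
      have h' := hηA h
      simp only [annulus, mem_ofPred_eq, norm_smul_sphere hr0] at h'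
      exact hr h'
  have hd : ∀ r : ℝ, HasDerivAt (fun r : ℝ => η (r • (ω : Euc N)))
      (fderiv ℝ η (r • (ω : Euc N)) ω) r := fun r => by
    have h1 : HasDerivAt (fun s : ℝ => s • (ω : Euc N)) (ω : Euc N) r := by
      simpa using (hasDerivAt_id r).smul_const (ω : Euc N)
    exact (hη.differentiable one_ne_zero (r • (ω : Euc N))).hasFDerivAt.comp_hasDerivAt r h1
  have h := intervalIntegral.integral_mul_deriv_eq_deriv_mul (a := R) (b := 1)
    (fun r _ => hasDerivAt_pow (N - 1) r) (fun r _ => hd r)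
    (Continuous.intervalIntegrable (by fun_prop) _ _)
    (Continuous.intervalIntegrable
      (((hη.continuous_fderiv one_ne_zero).comp (by fun_prop)).clm_apply continuous_const) _ _)
  rw [h0 1 zero_le_one (by simp), h0 R hR.le (by simp), mul_zero, mul_zero, sub_zero, zero_sub,
    intervalIntegral.integral_of_le hR1.le, intervalIntegral.integral_of_le hR1.le,
    integral_Ioc_eq_integral_Ioo, integral_Ioc_eq_integral_Ioo] at h
  rw [h, ← integral_const_mul]
  congr 1
  refine setIntegral_congr_fun measurableSet_Ioo fun r hr => ?_
  have hr0 : r ≠ 0 := by linarith [hr.1]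
  obtain ⟨k, rfl⟩ : ∃ k, N = k + 1 := ⟨N - 1, by omega⟩
  rcases k with _ | k
  · simp
  · simp only [Nat.add_sub_cancel]
    push_cast
    field_simp
    ring

/-- The homogeneous extension of a Sobolev function on the sphere has a weak gradient. -/
theorem weak_grad_homogeneous (hN : 0 < N) (hR : 0 < R) (hR1 : R < 1) {f g : USphere N → ℝ}
    (hfm : StronglyMeasurable f) (hf : Integrable f (sphMeas N)) (hgm : StronglyMeasurable g)
    (hg : Integrable g (sphMeas N)) {j : Fin N}
    (hw : ∀ φ : Euc N → ℝ, ContDiff ℝ (⊤ : ℕ∞) φ → HasCompactSupport φ →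
      ∫ x, f x * fderiv ℝ φ (x : Euc N) (stdVec j - (x : Euc N) j • (x : Euc N)) ∂(sphMeas N)
        = -(∫ x, g x * φ (x : Euc N) ∂(sphMeas N))
          + ((N : ℝ) - 1) * ∫ x, (x : Euc N) j * f x * φ (x : Euc N) ∂(sphMeas N))
    {η : Euc N → ℝ} (hη : ContDiff ℝ (⊤ : ℕ∞) η) (hηc : HasCompactSupport η)
    (hηA : tsupport η ⊆ annulus N R) :
    ∫ x in annulus N R, f (sphProj hN x) * fderiv ℝ η x (stdVec j)
      = -∫ x in annulus N R, ‖x‖⁻¹ * g (sphProj hN x) * η x := by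
  have hη1 : ContDiff ℝ 1 η := hη.of_le (by norm_cast)
  have hdηc : Continuous (fderiv ℝ η) := hη1.continuous_fderiv one_ne_zero
  obtain ⟨B, hB⟩ := hη.continuous.bounded_above_of_compact_support hηc
  obtain ⟨B', hB'⟩ := hdηc.bounded_above_of_compact_support (hηc.fderiv ℝ)
  set ν : Measure ℝ := volume.restrict (Ioo R 1) with hν
  have hprod : ∀ {a : USphere N → ℝ} {b : USphere N × ℝ → ℝ} (C : ℝ), Integrable a (sphMeas N) →
      Measurable b → (∀ ω, ∀ r ∈ Ioo R 1, ‖b (ω, r)‖ ≤ C) →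
      Integrable (fun p => a p.1 * b p) ((sphMeas N).prod ν) := by
    intro a b C ha hb hC
    refine (ha.comp_fst ν).mul_bdd (c := C) hb.aestronglyMeasurable ?_
    have h := (Measure.quasiMeasurePreserving_snd (μ := sphMeas N) (ν := ν)).ae
      (ae_restrict_mem measurableSet_Ioo)
    filter_upwards [h] with p hp using hC _ _ hp
  have hpow : ∀ r ∈ Ioo R 1, ‖r ^ (N - 1)‖ ≤ 1 := fun r hr => by
    have hr0 : 0 ≤ r := by linarith [hr.1]
    rw [norm_pow, Real.norm_of_nonneg hr0]
    exact pow_le_one₀ hr0 hr.2.le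
  have hinv : ∀ r ∈ Ioo R 1, ‖r⁻¹‖ ≤ R⁻¹ := fun r hr => by
    have hr0 : 0 ≤ r := by linarith [hr.1]
    rw [norm_inv, Real.norm_of_nonneg hr0]
    exact inv_anti₀ hR hr.1.le
  have hcm : Measurable fun p : USphere N × ℝ => p.2 • (p.1 : Euc N) :=
    measurable_snd.smul (measurable_subtype_coe.comp measurable_fst)
  have hcoord : Measurable fun p : USphere N × ℝ => (p.1 : Euc N) j := by
    have : Continuous fun p : USphere N × ℝ => (p.1 : Euc N) j := by fun_prop
    exact this.measurable
  -- The vector e_j is split into its tangential part e_j - ω_j ω (b1) and its radial part ω_j ω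
  -- (b2); b3 and b4 carry the gradient term and the curvature term.
  set b1 : USphere N × ℝ → ℝ := fun p => p.2 ^ (N - 1) *
    fderiv ℝ η (p.2 • (p.1 : Euc N)) (stdVec j - (p.1 : Euc N) j • (p.1 : Euc N)) with hb1
  set b2 : USphere N × ℝ → ℝ := fun p => (p.1 : Euc N) j * (p.2 ^ (N - 1) *
    fderiv ℝ η (p.2 • (p.1 : Euc N)) p.1) with hb2
  set b3 : USphere N × ℝ → ℝ := fun p => p.2 ^ (N - 1) * p.2⁻¹ * η (p.2 • (p.1 : Euc N)) with hb3
  set b4 : USphere N × ℝ → ℝ := fun p => (p.1 : Euc N) j *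
    (p.2 ^ (N - 1) * p.2⁻¹ * η (p.2 • (p.1 : Euc N))) with hb4
  have hb1m : Measurable b1 := by
    refine (measurable_snd.pow_const _).mul ?_
    have : Continuous fun p : USphere N × ℝ =>
      fderiv ℝ η (p.2 • (p.1 : Euc N)) (stdVec j - (p.1 : Euc N) j • (p.1 : Euc N)) :=
      (hdηc.comp (by fun_prop)).clm_apply (by fun_prop)
    exact this.measurable
  have hb2m : Measurable b2 := by
    refine hcoord.mul ((measurable_snd.pow_const _).mul ?_)
    have : Continuous fun p : USphere N × ℝ => fderiv ℝ η (p.2 • (p.1 : Euc N)) p.1 :=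
      (hdηc.comp (by fun_prop)).clm_apply (by fun_prop)
    exact this.measurable
  have hb3m : Measurable b3 :=
    ((measurable_snd.pow_const _).mul measurable_snd.inv).mul (hη.continuous.measurable.comp hcm)
  have hb4m : Measurable b4 := hcoord.mul hb3m
  have hi1 : Integrable (fun p => f p.1 * b1 p) ((sphMeas N).prod ν) := by
    refine hprod (1 * (B' * (1 + 1 * 1))) hf hb1m fun ω r hr => ?_
    simp only [hb1, norm_mul]
    refine mul_le_mul (hpow r hr) ((ContinuousLinearMap.le_opNorm _ _).trans ?_)
      (norm_nonneg _) zero_le_one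
    refine mul_le_mul (hB' _) ((norm_sub_le _ _).trans ?_) (norm_nonneg _)
      ((norm_nonneg _).trans (hB' 0))
    rw [norm_smul, norm_eq_of_mem_sphere, Real.norm_eq_abs]
    gcongr
    · simp
    · exact abs_coord_le_one ω j
  have hi2 : Integrable (fun p => f p.1 * b2 p) ((sphMeas N).prod ν) := by
    refine hprod (1 * (1 * (B' * 1))) hf hb2m fun ω r hr => ?_
    simp only [hb2, norm_mul]
    gcongr
    · exact abs_coord_le_one ω j
    · have := hpow r hr
      rwa [norm_pow] at this ⊢
    · refine (ContinuousLinearMap.le_opNorm _ _).trans ?_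
      rw [norm_eq_of_mem_sphere]
      gcongr
      exact hB' _
  have hb3b : ∀ ω, ∀ r ∈ Ioo R 1, ‖b3 (ω, r)‖ ≤ 1 * R⁻¹ * B := fun ω r hr => by
    simp only [hb3, norm_mul]
    gcongr
    · exact hpow r hr
    · exact hinv r hr
    · exact hB _
  have hi3 : Integrable (fun p => g p.1 * b3 p) ((sphMeas N).prod ν) := hprod _ hg hb3m hb3b
  have hi4 : Integrable (fun p => f p.1 * b4 p) ((sphMeas N).prod ν) := by
    refine hprod (1 * (1 * R⁻¹ * B)) hf hb4m fun ω r hr => ?_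
    have : ‖b4 (ω, r)‖ = ‖(ω : Euc N) j‖ * ‖b3 (ω, r)‖ := norm_mul _ _
    rw [this]
    gcongr
    · exact abs_coord_le_one ω j
    · exact hb3b ω r hr
  have hfi := integrable_annulus_sphProj hN hR.le hfm hf
  have hgi := integrable_annulus_sphProj hN hR.le hgm hg
  have hi12 : Integrable (fun p => f p.1 * b1 p + f p.1 * b2 p) ((sphMeas N).prod ν) :=
    hi1.add hi2
  have hleft : ∫ x in annulus N R, f (sphProj hN x) * fderiv ℝ η x (stdVec j)
      = ∫ p, f p.1 * b1 p ∂((sphMeas N).prod ν) + ∫ p, f p.1 * b2 p ∂((sphMeas N).prod ν) := by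
    rw [integral_annulus_polar hN hR.le, ← integral_add hi1 hi2, integral_prod _ hi12]
    · refine integral_congr_ae (ae_of_all _ fun ω => ?_)
      refine setIntegral_congr_fun measurableSet_Ioo fun r hr => ?_
      simp only [hb1, hb2]
      rw [sphProj_smul hN (hR.trans hr.1), map_sub, map_smul, smul_eq_mul]
      ring
    · refine hfi.mul_bdd (c := B' * 1) ?_ (ae_of_all _ fun x => ?_)
      · exact Continuous.aestronglyMeasurable (hdηc.clm_apply continuous_const)
      · refine (ContinuousLinearMap.le_opNorm _ _).trans ?_
        rw [PiLp.norm_single, norm_one]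
        gcongr
        exact hB' _
  have hright : ∫ x in annulus N R, ‖x‖⁻¹ * g (sphProj hN x) * η x
      = ∫ p, g p.1 * b3 p ∂((sphMeas N).prod ν) := by
    rw [integral_annulus_polar hN hR.le, integral_prod _ hi3]
    · refine integral_congr_ae (ae_of_all _ fun ω => ?_)
      refine setIntegral_congr_fun measurableSet_Ioo fun r hr => ?_
      simp only [hb3]
      rw [sphProj_smul hN (hR.trans hr.1), norm_smul_sphere (hR.trans hr.1).le]
      ring
    · refine Integrable.mul_bdd (c := B) (hgi.bdd_mul (c := R⁻¹) ?_ ?_)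
        hη.continuous.aestronglyMeasurable (ae_of_all _ fun x => hB _)
      · exact measurable_norm.inv.aestronglyMeasurable
      · filter_upwards [ae_restrict_mem isOpen_annulus.measurableSet] with x hx
        rw [norm_inv, norm_norm]
        exact inv_anti₀ hR hx.1.le
  -- On the sphere of radius r the weak formula is used with the test function η(r ·), whose
  -- derivative is r Dη(r ·); this explains the factor r⁻¹. The curvature term with N - 1 will
  -- cancel against the radial part.
  have htan : ∫ p, f p.1 * b1 p ∂((sphMeas N).prod ν) = -∫ p, g p.1 * b3 p ∂((sphMeas N).prod ν)
      + ((N : ℝ) - 1) * ∫ p, f p.1 * b4 p ∂((sphMeas N).prod ν) := by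
    have h3 : Integrable (fun r => -∫ x, g x * b3 (x, r) ∂(sphMeas N)) ν :=
      hi3.integral_prod_right.neg
    have h4 : Integrable (fun r => ((N : ℝ) - 1) * ∫ x, f x * b4 (x, r) ∂(sphMeas N)) ν :=
      hi4.integral_prod_right.const_mul _
    rw [integral_prod_symm _ hi1, integral_prod_symm _ hi3, integral_prod_symm _ hi4,
      ← integral_neg, ← integral_const_mul, ← integral_add h3 h4]
    refine setIntegral_congr_fun measurableSet_Ioo fun r hr => ?_
    have hr0 : r ≠ 0 := by linarith [hr.1]
    have hη' : ContDiff ℝ (⊤ : ℕ∞) fun x => η (r • x) := hη.comp (contDiff_const_smul r)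
    have hηc' : HasCompactSupport fun x => η (r • x) :=
      hηc.comp_homeomorph (Homeomorph.smulOfNeZero r hr0)
    have h := hw _ hη' hηc'
    simp only [hb1, hb3, hb4]
    have hfd : ∀ x v : Euc N, fderiv ℝ (fun x => η (r • x)) x v = r * fderiv ℝ η (r • x) v := by
      intro x v
      have h1 := (hη1.differentiable one_ne_zero (r • x)).hasFDerivAt.comp x
        ((hasFDerivAt_id x).const_smul r)
      have h2 : fderiv ℝ (fun x => η (r • x)) x = _ := h1.fderiv
      rw [h2]
      simp
    simp only [hfd] at h
    have e1 : ∫ x : USphere N, f x * (r ^ (N - 1) * fderiv ℝ η (r • (x : Euc N))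
        (stdVec j - (x : Euc N) j • (x : Euc N))) ∂(sphMeas N)
        = r ^ (N - 1) * r⁻¹ * ∫ x : USphere N, f x * (r * fderiv ℝ η (r • (x : Euc N))
        (stdVec j - (x : Euc N) j • (x : Euc N))) ∂(sphMeas N) := by
      rw [← integral_const_mul]
      refine integral_congr_ae (ae_of_all _ fun x => ?_)
      simp only
      field_simp
    have e3 : ∫ x : USphere N, g x * (r ^ (N - 1) * r⁻¹ * η (r • (x : Euc N))) ∂(sphMeas N)
        = r ^ (N - 1) * r⁻¹ * ∫ x : USphere N, g x * η (r • (x : Euc N)) ∂(sphMeas N) := by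
      rw [← integral_const_mul]
      refine integral_congr_ae (ae_of_all _ fun x => ?_)
      simp only
      ring
    have e4 : ∫ x : USphere N, f x * ((x : Euc N) j * (r ^ (N - 1) * r⁻¹ * η (r • (x : Euc N))))
        ∂(sphMeas N) = r ^ (N - 1) * r⁻¹ *
          ∫ x : USphere N, (x : Euc N) j * f x * η (r • (x : Euc N)) ∂(sphMeas N) := by
      rw [← integral_const_mul]
      refine integral_congr_ae (ae_of_all _ fun x => ?_)
      simp only
      ring
    rw [e1, e3, e4, h]
    ring
  have hrad : ∫ p, f p.1 * b2 p ∂((sphMeas N).prod ν)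
      = -(((N : ℝ) - 1) * ∫ p, f p.1 * b4 p ∂((sphMeas N).prod ν)) := by
    rw [integral_prod _ hi2, integral_prod _ hi4, ← integral_const_mul, ← integral_neg]
    refine integral_congr_ae (ae_of_all _ fun ω => ?_)
    simp only [hb2, hb4, integral_const_mul]
    rw [integral_radial_deriv hR hR1 hη1 hηA hN ω]
    ring
  rw [hleft, hright, htan, hrad]
  ring

end HomogeneousWeak

/-! ### The case s = 1: the tangential Dirichlet energy -/

section SphereGradient

variable {N Q n : ℕ} {R : ℝ}

/-- The weak tangential gradient can be represented by functions which obey given bounds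
everywhere. -/
theorem IsSphW12.exists_bounded_representative {f : USphere N → ℝ} {g φ Φ : Fin N → USphere N → ℝ}
    (h : IsSphW12 f g) (hb : ∀ j, ∀ᵐ x ∂(sphMeas N), |g j x| ≤ φ j x)
    (hΦ : ∀ j, StronglyMeasurable (Φ j)) (hφΦ : ∀ j, φ j =ᵐ[sphMeas N] Φ j) :
    ∃ g' : Fin N → USphere N → ℝ, (∀ j, StronglyMeasurable (g' j)) ∧ IsSphW12 f g' ∧
      ∀ j x, |g' j x| ≤ |Φ j x| := by
  have hm := fun j => (h.memLp_grad j).1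
  -- The gradient is set to 0 where the bound fails, a null set. A bound valid everywhere survives
  -- composition with the projection along every segment.
  set g' : Fin N → USphere N → ℝ := fun j x =>
    if |(hm j).mk _ x| ≤ |Φ j x| then (hm j).mk _ x else 0 with hg'
  have hae : ∀ j, g j =ᵐ[sphMeas N] g' j := fun j => by
    filter_upwards [(hm j).ae_eq_mk, hb j, hφΦ j] with x h1 h2 h3
    simp only [hg']
    rw [if_pos, h1]
    rw [← h1, ← h3]
    exact h2.trans (le_abs_self _)
  refine ⟨g', fun j => ?_, ⟨h.memLp, fun j => (h.memLp_grad j).ae_eq (hae j), ?_⟩, fun j x => ?_⟩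
  · exact StronglyMeasurable.ite (measurableSet_le (hm j).stronglyMeasurable_mk.measurable.norm
      (hΦ j).measurable.norm) (hm j).stronglyMeasurable_mk stronglyMeasurable_const
  · intro j ψ hψ hψc
    rw [h.weak j ψ hψ hψc]
    congr 2
    refine integral_congr_ae ?_
    filter_upwards [hae j] with x hx
    rw [hx]
  · simp only [hg']
    split_ifs with h1
    · exact h1
    · rw [abs_zero]; exact abs_nonneg _

/-- The condition is closed in the test point, so it passes from the dense set to all of Y; the test
point a gives the distance itself. -/
theorem edist_le_of_denseRange {Y ι : Type} [PseudoMetricSpace Y] {T : ι → Y} (hT : DenseRange T)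
    {a b : Y} {H : ℝ≥0∞} (h : ∀ k, ‖dist b (T k) - dist a (T k)‖ₑ ≤ H) : edist a b ≤ H := by
  have hc : IsClosed {S : Y | ‖dist b S - dist a S‖ₑ ≤ H} :=
    isClosed_le (by fun_prop) continuous_const
  have h1 : closure (range T) ⊆ {S : Y | ‖dist b S - dist a S‖ₑ ≤ H} :=
    hc.closure_subset_iff.2 (range_subset_iff.2 h)
  have h2 : ‖dist b a - dist a a‖ₑ ≤ H := h1 (hT a)
  rwa [dist_self, sub_zero, Real.enorm_of_nonneg dist_nonneg, ← edist_dist, edist_comm] at h2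

/-- The homogeneous extension satisfies the upper gradient inequality on almost all translates
of a segment. -/
theorem ae_edist_homogeneous_le (hN : 0 < N) (hR : 1 / 2 ≤ R) (hR1 : R < 1)
    {u : USphere N → AQ Q n} (hu : StronglyMeasurable u) {φ Φ : Fin N → USphere N → ℝ}
    (h : IsSphQW12 u φ) (hΦ : ∀ j, StronglyMeasurable (Φ j))
    (hφΦ : ∀ j, φ j =ᵐ[sphMeas N] Φ j) (y : Euc N) :
    ∀ᵐ z, ‖y‖ < annDist N R z → edist (u (sphProj hN z)) (u (sphProj hN (z + y)))
      ≤ ‖y‖ₑ * ∫⁻ s in Ioo (0 : ℝ) 1, ∑ j, 2 * ‖Φ j (sphProj hN (z + s • y))‖ₑ := by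
  have hR0 : 0 < R := by linarith
  have hA : MeasurableSet (annulus N R) := isOpen_annulus.measurableSet
  have hO : IsOpen {z : Euc N | ‖y‖ < annDist N R z} :=
    isOpen_lt continuous_const lipschitzWith_annDist.continuous
  have hOA : ∀ z ∈ {z : Euc N | ‖y‖ < annDist N R z}, ∀ s ∈ Icc (0 : ℝ) 1,
      z + s • y ∈ annulus N R := by
    intro z hz s hs
    rw [annulus_eq]
    have h1 := (lipschitzWith_annDist (R := R)).dist_le_mul z (z + s • y)
    rw [NNReal.coe_one, one_mul, Real.dist_eq, dist_self_add_right, norm_smul,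
      Real.norm_of_nonneg hs.1] at h1
    have h2 : s * ‖y‖ ≤ ‖y‖ := mul_le_of_le_one_left (norm_nonneg _) hs.2
    have h3 := abs_le.1 (h1.trans h2)
    have h4 : ‖y‖ < annDist N R z := hz
    have : 0 < annDist N R (z + s • y) := by linarith
    exact this
  have : Nonempty (AQ Q n) := ⟨AQ.zero Q n⟩
  have hT : ∀ T : AQ Q n, ∀ᵐ z, ‖y‖ < annDist N R z →
      ‖dist (u (sphProj hN (z + y))) T - dist (u (sphProj hN z)) T‖ₑ
      ≤ ‖y‖ₑ * ∫⁻ s in Ioo (0 : ℝ) 1, ∑ j, 2 * ‖Φ j (sphProj hN (z + s • y))‖ₑ := by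
    intro T
    obtain ⟨g₀, hg₀, hb⟩ := h.bound T
    obtain ⟨g, hgm, hg, hgΦ⟩ := hg₀.exists_bounded_representative hb hΦ hφΦ
    have hfm : StronglyMeasurable fun ω => dist (u ω) T := hu.dist stronglyMeasurable_const
    have hfi : Integrable (fun ω => dist (u ω) T) (sphMeas N) := hg.memLp.integrable one_le_two
    have hgi : ∀ j, Integrable (g j) (sphMeas N) := fun j =>
      (hg.memLp_grad j).integrable one_le_two
    set F : Euc N → ℝ := (annulus N R).indicator fun x => dist (u (sphProj hN x)) T with hF
    set G : Fin N → Euc N → ℝ := fun j =>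
      (annulus N R).indicator fun x => ‖x‖⁻¹ * g j (sphProj hN x) with hG
    have hFi : Integrable F := (integrable_indicator_iff hA).2
      (integrable_annulus_sphProj hN hR0.le hfm hfi)
    -- The factor 2 in the upper gradient bounds 1/|x|, as R ≥ 1/2.
    have hinv : ∀ x ∈ annulus N R, ‖‖x‖⁻¹‖ ≤ 2 := fun x hx => by
      rw [norm_inv, norm_norm, inv_le_comm₀ (hR0.trans hx.1) two_pos]
      linarith [hx.1]
    have hGi : ∀ j, Integrable (G j) := fun j => (integrable_indicator_iff hA).2
      ((integrable_annulus_sphProj hN hR0.le (hgm j) (hgi j)).bdd_mul (c := 2)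
        measurable_norm.inv.aestronglyMeasurable
        (by filter_upwards [ae_restrict_mem hA] with x hx using hinv x hx))
    have hGm : ∀ j, StronglyMeasurable (G j) := fun j =>
      (measurable_norm.inv.stronglyMeasurable.mul
        ((hgm j).comp_measurable (measurable_sphProj hN))).indicator hA
    have hweak : ∀ j, ∀ η : Euc N → ℝ, ContDiff ℝ (⊤ : ℕ∞) η → HasCompactSupport η →
        tsupport η ⊆ annulus N R →
        ∫ x, F x * fderiv ℝ η x (stdVec j) = -∫ x, G j x * η x := by
      intro j η hη hηc hηA
      have := weak_grad_homogeneous hN hR0 hR1 hfm hfi (hgm j) (hgi j) (hg.weak j) hη hηc hηA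
      rw [← integral_indicator hA, ← integral_indicator hA] at this
      simpa only [hF, hG, Set.indicator_mul_left] using this
    filter_upwards [ae_sub_eq_integral_of_weak hO hFi hGi hGm hweak y hOA] with z hz hzy
    have h1 := hz hzy
    have hzA : z ∈ annulus N R := by simpa using hOA z hzy 0 (by simp)
    have hzyA : z + y ∈ annulus N R := by simpa using hOA z hzy 1 (by simp)
    simp only [hF, Set.indicator_of_mem hzA, Set.indicator_of_mem hzyA] at h1
    rw [h1, ← lintegral_const_mul' _ _ enorm_ne_top]
    refine (enorm_integral_le_lintegral_enorm _).trans (lintegral_mono fun s => ?_)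
    simp only
    rw [Finset.mul_sum]
    refine (enorm_sum_le _ _).trans (Finset.sum_le_sum fun j _ => ?_)
    rw [enorm_mul]
    refine mul_le_mul' ?_ ?_
    · rw [← ofReal_norm, ← ofReal_norm]
      exact ENNReal.ofReal_le_ofReal (PiLp.norm_apply_le y j)
    · simp only [hG]
      by_cases hx : z + s • y ∈ annulus N R
      · rw [Set.indicator_of_mem hx, enorm_mul]
        refine mul_le_mul' ?_ ?_
        · rw [← ofReal_norm]
          exact (ENNReal.ofReal_le_ofReal (hinv _ hx)).trans_eq (ENNReal.ofReal_ofNat 2)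
        · rw [← ofReal_norm, ← ofReal_norm]
          exact ENNReal.ofReal_le_ofReal (hgΦ j _)
      · rw [Set.indicator_of_notMem hx, enorm_zero]
        exact zero_le
  have hall := ae_all_iff.2 fun k => hT (TopologicalSpace.denseSeq (AQ Q n) k)
  filter_upwards [hall] with z hz hzy
  exact edist_le_of_denseRange (TopologicalSpace.denseRange_denseSeq (AQ Q n)) fun k => hz k hzy

/-- The Whitney energy of a homogeneous map is controlled by the tangential Dirichlet energy. -/
theorem whitneyEnergy_le_sphQEnergy (hN : 0 < N) (hR : 1 / 2 ≤ R) (hR1 : R < 1)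
    {u : USphere N → AQ Q n} (hu : StronglyMeasurable u) :
    whitneyEnergy (fun x => u (sphProj hN x)) (annDist N R)
      ≤ ENNReal.ofReal (10 / 3) ^ N * volume (Metric.ball (0 : Euc N) 1) * (4 * N) *
        ENNReal.ofReal (1 - R) * sphQEnergy u := by
  have hc : ENNReal.ofReal (10 / 3) ^ N * volume (Metric.ball (0 : Euc N) 1) * (4 * N) *
      ENNReal.ofReal (1 - R) ≠ ∞ := by
    have := (measure_ball_lt_top (μ := (volume : Measure (Euc N))) (x := 0) (r := 1)).ne
    finiteness
  -- The constant must be finite and nonzero to be moved inside the infimum defining the energy,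
  -- which is infinite when there are no admissible bounds.
  have hc0 : ENNReal.ofReal (10 / 3) ^ N * volume (Metric.ball (0 : Euc N) 1) * (4 * N) *
      ENNReal.ofReal (1 - R) ≠ 0 := by
    have := (Metric.measure_ball_pos (volume : Measure (Euc N)) 0 one_pos).ne'
    have h1 : ENNReal.ofReal (10 / 3) ≠ 0 := by norm_num
    have h2 : ENNReal.ofReal (1 - R) ≠ 0 := by simpa using hR1
    have h3 : (N : ℝ≥0∞) ≠ 0 := by exact_mod_cast hN.ne'
    exact mul_ne_zero (mul_ne_zero (mul_ne_zero (pow_ne_zero _ h1) this)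
      (mul_ne_zero four_ne_zero h3)) h2
  rw [sphQEnergy, ENNReal.mul_iInf_of_ne hc0 hc]
  refine le_iInf fun φ => ?_
  rw [ENNReal.mul_iInf_of_ne hc0 hc]
  refine le_iInf fun h => ?_
  set Φ : Fin N → USphere N → ℝ := fun j => (h.memLp j).1.mk _ with hΦd
  have hΦ : ∀ j, StronglyMeasurable (Φ j) := fun j => (h.memLp j).1.stronglyMeasurable_mk
  have hφΦ : ∀ j, φ j =ᵐ[sphMeas N] Φ j := fun j => (h.memLp j).1.ae_eq_mk
  have hGm : Measurable fun ω => ∑ j, 2 * ‖Φ j ω‖ₑ :=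
    Finset.measurable_fun_sum _ fun j _ => (hΦ j).measurable.enorm.const_mul 2
  refine (whitneyEnergy_le_lintegral_sq (hu.comp_measurable (measurable_sphProj hN))
    lipschitzWith_annDist (hGm.comp (measurable_sphProj hN))
    (ae_edist_homogeneous_le hN hR hR1 hu h hΦ hφΦ)).trans ?_
  rw [mul_assoc (_ * volume _), mul_assoc (_ * volume _), ← annulus_eq]
  refine mul_le_mul' le_rfl ?_
  have h1 := lintegral_annulus_polar_le hN (R := R) (κ := fun _ => 1) measurable_const
    (hGm.pow_const 2)
  simp only [one_mul, setLIntegral_const, Real.volume_Ioo] at h1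
  refine h1.trans ?_
  rw [mul_comm (4 * (N : ℝ≥0∞)), mul_assoc]
  refine mul_le_mul' le_rfl ?_
  rw [← lintegral_const_mul' _ _ (by finiteness)]
  refine lintegral_mono_ae ?_
  filter_upwards [ae_all_iff.2 hφΦ] with ω hω
  simp only [hω]
  rw [← Finset.mul_sum, mul_pow, mul_assoc]
  -- The square of a sum of N terms is at most N times the sum of squares; with the factor 2 of the
  -- upper gradient this gives 4N.
  have h2 := ENNReal.rpow_sum_le_const_mul_sum_rpow Finset.univ (fun j => ‖Φ j ω‖ₑ)
    (p := 2) one_le_two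
  norm_num at h2 ⊢
  gcongr

end SphereGradient

/-! ### The interpolating map, its Sobolev regularity and its traces -/

section Interpolation

variable {N : ℕ} {R : ℝ}

theorem lintegral_annMap_le {Y : Type} (hN : 0 < N) (hR : 0 ≤ R) {u v : USphere N → Y} (H : Y → ℝ≥0∞)
    (hu : Measurable fun ω => H (u ω)) (hv : Measurable fun ω => H (v ω)) :
    ∫⁻ x in annulus N R, H (annMap hN R u v x)
      ≤ ∫⁻ ω, H (u ω) ∂(sphMeas N) + ∫⁻ ω, H (v ω) ∂(sphMeas N) := by
  calc ∫⁻ x in annulus N R, H (annMap hN R u v x)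
      ≤ ∫⁻ x in annulus N R, (H (u (sphProj hN x)) + H (v (sphProj hN x))) := by
        refine lintegral_mono fun x => ?_
        simp only [annMap]
        split_ifs
        · exact le_self_add
        · exact le_add_self
    _ = (∫⁻ x in annulus N R, H (u (sphProj hN x))) + ∫⁻ x in annulus N R, H (v (sphProj hN x)) :=
        lintegral_add_left (hu.comp (measurable_sphProj hN)) _
    _ ≤ _ := add_le_add (lintegral_annulus_sphProj_le hN hR hu)
        (lintegral_annulus_sphProj_le hN hR hv)

theorem memLp_two_of_lintegral_sq {α : Type} [MeasurableSpace α] {μ : Measure α} {f : α → ℝ}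
    (hf : AEStronglyMeasurable f μ) (h : ∫⁻ x, ‖f x‖ₑ ^ 2 ∂μ < ∞) : MemLp f 2 μ := by
  refine ⟨hf, ?_⟩
  rw [eLpNorm_lt_top_iff_lintegral_rpow_enorm_lt_top two_ne_zero ENNReal.ofNat_ne_top]
  simpa using h

theorem lintegral_sq_lt_top_of_memLp_two {α : Type} [MeasurableSpace α] {μ : Measure α} {f : α → ℝ}
    (h : MemLp f 2 μ) : ∫⁻ x, ‖f x‖ₑ ^ 2 ∂μ < ∞ := by
  have := (eLpNorm_lt_top_iff_lintegral_rpow_enorm_lt_top two_ne_zero ENNReal.ofNat_ne_top).1 h.2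
  simpa using this

variable {Y : Type} [PseudoMetricSpace Y]

theorem ball_subset_annulus {x : Euc N} (hx : x ∈ annulus N R) :
    Metric.ball x (annDist N R x / 4) ⊆ annulus N R := by
  intro z hz
  rw [annulus_eq] at hx ⊢
  have h1 := (lipschitzWith_annDist (R := R)).dist_le_mul z x
  rw [NNReal.coe_one, one_mul, Real.dist_eq] at h1
  have h2 := abs_le.1 (h1.trans (Metric.mem_ball.1 hz).le)
  have h3 : 0 < annDist N R x := hx
  have : 0 < annDist N R z := by linarith
  exact this

theorem memLp_annMap (hN : 0 < N) (hR : 0 ≤ R) {u v : USphere N → Y} (hu : StronglyMeasurable u)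
    (hv : StronglyMeasurable v) {ψ : Y → ℝ} (hψ : Continuous ψ)
    (hψu : MemLp (fun ω => ψ (u ω)) 2 (sphMeas N)) (hψv : MemLp (fun ω => ψ (v ω)) 2 (sphMeas N)) :
    MemLp (fun x => ψ (annMap hN R u v x)) 2 (volume.restrict (annulus N R)) := by
  refine memLp_two_of_lintegral_sq
    (hψ.comp_stronglyMeasurable (stronglyMeasurable_annMap hN hu hv)).aestronglyMeasurable ?_
  refine (lintegral_annMap_le hN hR (fun y => ‖ψ y‖ₑ ^ 2)
    ((hψ.comp_stronglyMeasurable hu).measurable.enorm.pow_const 2)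
    ((hψ.comp_stronglyMeasurable hv).measurable.enorm.pow_const 2)).trans_lt ?_
  exact ENNReal.add_lt_top.2 ⟨lintegral_sq_lt_top_of_memLp_two hψu,
    lintegral_sq_lt_top_of_memLp_two hψv⟩

/-- A locally Lipschitz function which is close to the jump map `annMap` near the boundary of the
annulus is a Sobolev function with the corresponding traces. -/
theorem isW12_and_hasTraces (hN : 0 < N) (hR : 0 < R) (hR1 : R < 1) {a b : USphere N → ℝ}
    (ha : MemLp a 2 (sphMeas N)) (hb : MemLp b 2 (sphMeas N)) {f : Euc N → ℝ} {Φ : Euc N → ℝ}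
    (hF : MemLp (annMap hN R a b) 2 (volume.restrict (annulus N R)))
    (hf : LocallyLipschitzOn (annulus N R) f)
    (hfΦ : ∀ x ∈ annulus N R, 0 ≤ Φ x ∧ ∀ᶠ x' in nhds x, ‖f x' - f x‖ ≤ Φ x * ‖x' - x‖)
    (hΦ : MemLp Φ 2 (volume.restrict (annulus N R)))
    (hfF : ∫⁻ x in annulus N R, ENNReal.ofReal (annDist N R x)⁻¹ ^ 2 *
      ‖f x - annMap hN R a b x‖ₑ ^ 2 < ∞) :
    IsW12 (annulus N R) f (fun j x => lineDeriv ℝ f x (stdVec j)) ∧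
      HasTraces R f (fun j x => lineDeriv ℝ f x (stdVec j)) a b ∧
      ∀ j, ∀ x ∈ annulus N R, |lineDeriv ℝ f x (stdVec j)| ≤ Φ x := by
  have hA : MeasurableSet (annulus N R) := isOpen_annulus.measurableSet
  have hfin : IsFiniteMeasure (volume.restrict (annulus N R)) := by
    refine ⟨?_⟩
    rw [Measure.restrict_apply_univ]
    refine (measure_mono (t := Metric.ball 0 1) fun x hx => ?_).trans_lt measure_ball_lt_top
    rw [mem_ball_zero_iff]
    exact hx.2
  have hgΦ : ∀ j, ∀ x ∈ annulus N R, |lineDeriv ℝ f x (stdVec j)| ≤ Φ x := by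
    intro j x hx
    have := norm_lineDeriv_le_of_lip' ℝ (v := stdVec j) (hfΦ x hx).1 (hfΦ x hx).2
    simpa using this
  have hg : ∀ j, MemLp (fun x => lineDeriv ℝ f x (stdVec j)) 2 (volume.restrict (annulus N R)) :=
    fun j => hΦ.mono' (ae_lineDifferentiableAt_annulus hf (stdVec j)).2
      (by filter_upwards [ae_restrict_mem hA] with x hx using hgΦ j x hx)
  have hfm : AEStronglyMeasurable f (volume.restrict (annulus N R)) :=
    hf.continuousOn.aestronglyMeasurable hA
  have hdm : Measurable fun x : Euc N => (annDist N R x)⁻¹ :=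
    lipschitzWith_annDist.continuous.measurable.inv
  have hq : MemLp (fun x => (annDist N R x)⁻¹ * (f x - annMap hN R a b x)) 2
      (volume.restrict (annulus N R)) := by
    refine memLp_two_of_lintegral_sq (hdm.aestronglyMeasurable.mul (hfm.sub hF.1)) ?_
    refine lt_of_le_of_lt (le_of_eq (setLIntegral_congr_fun hA fun x hx => ?_)) hfF
    rw [annulus_eq] at hx
    have hx' : 0 < annDist N R x := hx
    simp only [enorm_mul, mul_pow]
    rw [Real.enorm_of_nonneg (inv_nonneg.2 hx'.le)]
  -- As t ≤ 1, the weighted bound also gives f - F in L², hence f in L².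
  have hd : MemLp (fun x => f x - annMap hN R a b x) 2 (volume.restrict (annulus N R)) := by
    refine hq.mono (hfm.sub hF.1) ?_
    filter_upwards [ae_restrict_mem hA] with x hx
    rw [annulus_eq] at hx
    have hx' : 0 < annDist N R x := hx
    have h1 : annDist N R x ≤ 1 := (min_le_left _ _).trans (by linarith [norm_nonneg x])
    rw [norm_mul]
    refine le_mul_of_one_le_left (norm_nonneg _) ?_
    rw [Real.norm_of_nonneg (inv_nonneg.2 hx'.le)]
    exact (one_le_inv₀ hx').2 h1
  have hfL : MemLp f 2 (volume.restrict (annulus N R)) := by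
    have := hd.add hF
    refine this.ae_eq (ae_of_all _ fun x => ?_)
    simp
  have hm : (1 + R) / 2 ∈ Ioo R 1 := by constructor <;> linarith
  have hGG := fun (j : Fin N) {φ : Euc N → ℝ} (hφ : ContDiff ℝ (⊤ : ℕ∞) φ)
      (hφc : HasCompactSupport φ) =>
    gauss_green_annulus hN hR.le hm (ha.integrable one_le_two) (hb.integrable one_le_two)
      (F := annMap hN R a b)
      (fun ω r hr => by
        have hr0 : 0 < r := by linarith [hr.1, hm.1]
        simp only [annMap]
        rw [norm_smul_sphere hr0.le, if_pos hr.1, sphProj_smul hN hr0])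
      (fun ω r hr => by
        have hr0 : 0 < r := by linarith [hr.1]
        simp only [annMap]
        rw [norm_smul_sphere hr0.le, if_neg (not_le.2 hr.2), sphProj_smul hN hr0])
      hf (hfL.integrable one_le_two) (hF.integrable one_le_two) j ((hg j).integrable one_le_two)
      (hq.integrable one_le_two) hφ hφc
  refine ⟨⟨hfL, hg, fun j φ hφ hφc hφA => ?_⟩, ⟨ha, hb, fun j φ hφ hφc => hGG j hφ hφc⟩, hgΦ⟩
  -- The weak formula inside the annulus is the Gauss-Green formula for test functions that vanish
  -- on both boundary spheres.
  have h0 : ∀ x : Euc N, x ∉ annulus N R → φ x = 0 := fun x hx =>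
    image_eq_zero_of_notMem_tsupport fun h => hx (hφA h)
  have h1 : ∀ ω : USphere N, φ ω = 0 := fun ω => h0 _ fun h => by
    have := h.2
    rw [norm_eq_of_mem_sphere] at this
    exact lt_irrefl _ this
  have h2 : ∀ ω : USphere N, φ (R • (ω : Euc N)) = 0 := fun ω => h0 _ fun h => by
    have := h.1
    rw [norm_smul_sphere hR.le] at this
    exact lt_irrefl _ this
  have := hGG j hφ hφc
  simp only [h1, h2, mul_zero, zero_mul, integral_zero, sub_zero] at this
  exact eq_neg_of_add_eq_zero_left this

/-- Interpolation of two maps on the sphere by a locally Lipschitz map on the annulus. -/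
theorem exists_annulus_interpolation [Nonempty Y] (hY : ConeContractible Y) (hN : 0 < N) :
    ∃ C : ℝ≥0∞, C ≠ ∞ ∧ ∀ R : ℝ, 0 < R → R < 1 → ∀ u v : USphere N → Y, StronglyMeasurable u →
      StronglyMeasurable v → ∀ y₀ : Y, sphDistSq u (fun _ => y₀) < ∞ →
      sphDistSq v (fun _ => y₀) < ∞ → whitneyEnergy (annMap hN R u v) (annDist N R) < ∞ →
      ∃ (w : Euc N → Y) (Φ : Euc N → ℝ), AEStronglyMeasurable w (volume.restrict (annulus N R)) ∧
        MemLp Φ 2 (volume.restrict (annulus N R)) ∧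
        ∫⁻ x in annulus N R, ∑ _j : Fin N, ‖Φ x‖ₑ ^ 2
          ≤ C * whitneyEnergy (annMap hN R u v) (annDist N R) ∧
        ∀ ψ : Y → ℝ, LipschitzWith 1 ψ → MemLp (fun ω => ψ (u ω)) 2 (sphMeas N) →
          MemLp (fun ω => ψ (v ω)) 2 (sphMeas N) → ∃ g : Fin N → Euc N → ℝ,
            IsW12 (annulus N R) (fun x => ψ (w x)) g ∧
            HasTraces R (fun x => ψ (w x)) g (fun ω => ψ (u ω)) (fun ω => ψ (v ω)) ∧
            ∀ j, ∀ x ∈ annulus N R, |g j x| ≤ Φ x := by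
  obtain ⟨K, hK, hap⟩ := exists_whitney_approximation hY N
  set c : ℝ≥0∞ := ENNReal.ofReal (5 / 4) ^ (2 * N + 2) * volume (Metric.ball (0 : Euc N) 1) with hc
  have hcf : c ≠ ∞ := ENNReal.mul_ne_top (ENNReal.pow_ne_top ENNReal.ofReal_ne_top)
    measure_ball_lt_top.ne
  -- Φ bounds each of the N partial derivatives by the local Lipschitz constant; hence the factor N.
  refine ⟨N * (ENNReal.ofReal K ^ 2 * c), by finiteness, ?_⟩
  intro R hR hR1 u v hu hv y₀ hu0 hv0 hE
  have hA : MeasurableSet (annulus N R) := isOpen_annulus.measurableSet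
  set U := annMap hN R u v with hU
  have hUm : StronglyMeasurable U := stronglyMeasurable_annMap hN hu hv
  have hpos : ∀ {x}, x ∈ annulus N R → 0 < annDist N R x := fun {x} hx => by
    rw [annulus_eq] at hx; exact hx
  have hosc : ∀ x, 0 < annDist N R x → oscSq U (annDist N R) x ≠ ∞ := by
    intro x hx
    have hxA : x ∈ annulus N R := by rw [annulus_eq]; exact hx
    refine oscSq_ne_top (y₀ := y₀) (ne_top_of_le_ne_top ?_
      ((lintegral_mono_set (ball_subset_annulus hxA)).trans (lintegral_annMap_le hN hR.le
        (fun y => edist y y₀ ^ 2) ((hu.edist stronglyMeasurable_const).measurable.pow_const 2)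
        ((hv.edist stronglyMeasurable_const).measurable.pow_const 2)))) hUm
    exact (ENNReal.add_lt_top.2 ⟨hu0, hv0⟩).ne
  obtain ⟨w, hw⟩ := hap (annDist N R) lipschitzWith_annDist U hUm hosc
  set Φ : Euc N → ℝ := fun x => K * (√(oscSq U (annDist N R) x).toReal / annDist N R x) with hΦ
  have htm : Measurable (annDist N R) := lipschitzWith_annDist.continuous.measurable
  have hom : Measurable (oscSq U (annDist N R)) := measurable_oscSq hUm htm
  have hΦm : Measurable Φ := (hom.ennreal_toReal.sqrt.div htm).const_mul K
  have hΦ0 : ∀ x ∈ annulus N R, 0 ≤ Φ x := fun x hx =>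
    mul_nonneg hK (div_nonneg (Real.sqrt_nonneg _) (hpos hx).le)
  have hΦsq : ∀ x ∈ annulus N R, ‖Φ x‖ₑ ^ 2 = ENNReal.ofReal K ^ 2 *
      (ENNReal.ofReal (annDist N R x)⁻¹ ^ 2 * oscSq U (annDist N R) x) := by
    intro x hx
    rw [Real.enorm_of_nonneg (hΦ0 x hx), hΦ]
    simp only
    rw [ENNReal.ofReal_mul hK, div_eq_mul_inv, ENNReal.ofReal_mul (Real.sqrt_nonneg _), mul_pow,
      mul_pow, ← ENNReal.ofReal_pow (Real.sqrt_nonneg _), Real.sq_sqrt ENNReal.toReal_nonneg,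
      ENNReal.ofReal_toReal (hosc x (hpos hx)), mul_comm (oscSq _ _ _)]
  have hI : ∫⁻ x in annulus N R, ENNReal.ofReal (annDist N R x)⁻¹ ^ 2 * oscSq U (annDist N R) x
      ≤ c * whitneyEnergy U (annDist N R) := by
    rw [annulus_eq]
    exact lintegral_oscSq_le hUm lipschitzWith_annDist
  have hΦE : ∫⁻ x in annulus N R, ‖Φ x‖ₑ ^ 2
      ≤ ENNReal.ofReal K ^ 2 * c * whitneyEnergy U (annDist N R) := by
    rw [setLIntegral_congr_fun hA hΦsq, lintegral_const_mul' _ _ (by finiteness), mul_assoc]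
    exact mul_le_mul' le_rfl hI
  have hΦL : MemLp Φ 2 (volume.restrict (annulus N R)) :=
    memLp_two_of_lintegral_sq hΦm.aestronglyMeasurable
      (hΦE.trans_lt (ENNReal.mul_lt_top (by finiteness) hE))
  have hscale : ∀ x ∈ annulus N R, Metric.closedBall x (whitneyScale N * annDist N R x) ∈ nhds x :=
    fun x hx => Metric.closedBall_mem_nhds x (mul_pos whitneyScale_pos (hpos hx))
  have hLip : ∀ x ∈ annulus N R, LipschitzOnWith (Φ x).toNNReal w
      (Metric.closedBall x (whitneyScale N * annDist N R x)) := fun x hx =>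
    LipschitzOnWith.of_dist_le_mul fun y hy y' hy' => by
      rw [Real.coe_toNNReal _ (hΦ0 x hx)]
      exact (hw x (hpos hx)).1 y y' hy hy'
  have hwc : ContinuousOn w (annulus N R) := fun x hx =>
    ((hLip x hx).continuousOn.continuousAt (hscale x hx)).continuousWithinAt
  refine ⟨w, Φ, hwc.aestronglyMeasurable hA, hΦL, ?_, ?_⟩
  · simp only [Finset.sum_const, Finset.card_univ, Fintype.card_fin, nsmul_eq_mul]
    rw [lintegral_const_mul' _ _ (by finiteness), mul_assoc]
    exact mul_le_mul' le_rfl hΦE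
  · intro ψ hψ hψu hψv
    have hcomp : annMap hN R (fun ω => ψ (u ω)) (fun ω => ψ (v ω)) = fun x => ψ (U x) := by
      funext x
      simp only [hU, annMap]
      split_ifs <;> rfl
    refine ⟨_, isW12_and_hasTraces hN hR hR1 hψu hψv (f := fun x => ψ (w x)) (Φ := Φ) ?_
      (fun x hx => ⟨_, _, mem_nhdsWithin_of_mem_nhds (hscale x hx),
        hψ.comp_lipschitzOnWith (hLip x hx)⟩)
      (fun x hx => ⟨hΦ0 x hx, ?_⟩) hΦL ?_⟩
    · rw [hcomp]
      exact memLp_annMap hN hR.le hu hv hψ.continuous hψu hψv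
    · filter_upwards [hscale x hx] with x' hx'
      have h1 := (hψ.comp_lipschitzOnWith (hLip x hx)).dist_le_mul x' hx' x
        (Metric.mem_closedBall_self (mul_pos whitneyScale_pos (hpos hx)).le)
      rwa [one_mul, Real.coe_toNNReal _ (hΦ0 x hx), dist_eq_norm, dist_eq_norm] at h1
    · have h2 : ∀ x ∈ annulus N R, ENNReal.ofReal (annDist N R x)⁻¹ ^ 2 *
          ‖ψ (w x) - annMap hN R (fun ω => ψ (u ω)) (fun ω => ψ (v ω)) x‖ₑ ^ 2
          ≤ ENNReal.ofReal K * (ENNReal.ofReal (annDist N R x)⁻¹ ^ 2 * oscSq U (annDist N R) x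
            + ENNReal.ofReal (annDist N R x)⁻¹ ^ 2 * (ENNReal.ofReal (annDist N R x)⁻¹ ^ N *
              ∫⁻ z in Metric.ball x (annDist N R x / 4), edist (U z) (U x) ^ 2)) := by
        intro x hx
        rw [hcomp, ← mul_add, mul_left_comm]
        refine mul_le_mul' le_rfl (le_trans (pow_le_pow_left' ?_ 2) (hw x (hpos hx)).2)
        have h3 := hψ.edist_le_mul (w x) (U x)
        rwa [ENNReal.coe_one, one_mul, edist_eq_enorm_sub] at h3
      refine (setLIntegral_mono' hA h2).trans_lt ?_
      have h4 : Measurable fun x => ENNReal.ofReal (annDist N R x)⁻¹ ^ 2 *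
          oscSq U (annDist N R) x := (htm.inv.ennreal_ofReal.pow_const 2).mul hom
      rw [lintegral_const_mul' _ _ ENNReal.ofReal_ne_top, lintegral_add_left h4]
      refine ENNReal.mul_lt_top ENNReal.ofReal_lt_top (ENNReal.add_lt_top.2
        ⟨hI.trans_lt (ENNReal.mul_lt_top hcf.lt_top hE), lt_of_le_of_lt ?_ hE⟩)
      rw [annulus_eq]
      exact lintegral_ball_edist_le U htm

end Interpolation

/-! ### Invariance under changes on null sets of the sphere -/

section Congr

variable {N Q n : ℕ} {R : ℝ}

theorem gagliardoSq_congr {Y : Type} [PseudoEMetricSpace Y] {s : ℝ} {u u' : USphere N → Y}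
    (h : u =ᵐ[sphMeas N] u') : gagliardoSq s u = gagliardoSq s u' := by
  refine lintegral_congr_ae ?_
  filter_upwards [Measure.quasiMeasurePreserving_fst.ae_eq_comp h,
    Measure.quasiMeasurePreserving_snd.ae_eq_comp h] with p h1 h2
  simp only [Function.comp_apply] at h1 h2
  rw [h1, h2]

theorem sphDistSq_congr {Y : Type} [PseudoEMetricSpace Y] {u u' v v' : USphere N → Y}
    (hu : u =ᵐ[sphMeas N] u') (hv : v =ᵐ[sphMeas N] v') : sphDistSq u v = sphDistSq u' v' := by
  refine lintegral_congr_ae ?_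
  filter_upwards [hu, hv] with x h1 h2
  rw [h1, h2]

theorem HasTraces.congr {w : Euc N → ℝ} {g : Fin N → Euc N → ℝ} {u u' v v' : USphere N → ℝ}
    (h : HasTraces R w g u v) (hu : u =ᵐ[sphMeas N] u') (hv : v =ᵐ[sphMeas N] v') :
    HasTraces R w g u' v' := by
  refine ⟨h.memLp_outer.ae_eq hu, h.memLp_inner.ae_eq hv, fun j φ hφ hφc => ?_⟩
  rw [h.gauss_green j φ hφ hφc]
  congr 1
  · refine integral_congr_ae ?_
    filter_upwards [hu] with x hx
    rw [hx]
  · congr 1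
    refine integral_congr_ae ?_
    filter_upwards [hv] with x hx
    rw [hx]

theorem IsSphW12.congr {f f' : USphere N → ℝ} {g : Fin N → USphere N → ℝ} (h : IsSphW12 f g)
    (hf : f =ᵐ[sphMeas N] f') : IsSphW12 f' g := by
  refine ⟨h.memLp.ae_eq hf, h.memLp_grad, fun j φ hφ hφc => ?_⟩
  have h1 : ∫ x, f' x * fderiv ℝ φ (x : Euc N) (stdVec j - (x : Euc N) j • (x : Euc N))
      ∂(sphMeas N) = ∫ x, f x * fderiv ℝ φ (x : Euc N) (stdVec j - (x : Euc N) j • (x : Euc N))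
      ∂(sphMeas N) := by
    refine integral_congr_ae ?_
    filter_upwards [hf] with x hx
    rw [hx]
  have h2 : ∫ x, (x : Euc N) j * f' x * φ (x : Euc N) ∂(sphMeas N)
      = ∫ x, (x : Euc N) j * f x * φ (x : Euc N) ∂(sphMeas N) := by
    refine integral_congr_ae ?_
    filter_upwards [hf] with x hx
    rw [hx]
  rw [h1, h2]
  exact h.weak j φ hφ hφc

theorem IsSphQW12.congr {u u' : USphere N → AQ Q n} {φ : Fin N → USphere N → ℝ}
    (h : IsSphQW12 u φ) (hu : u =ᵐ[sphMeas N] u') : IsSphQW12 u' φ := by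
  refine ⟨h.meas.congr hu, h.memLp, fun T => ?_⟩
  obtain ⟨g, hg, hb⟩ := h.bound T
  refine ⟨g, hg.congr ?_, hb⟩
  filter_upwards [hu] with x hx
  rw [hx]

theorem sphQEnergy_congr {u u' : USphere N → AQ Q n} (hu : u =ᵐ[sphMeas N] u') :
    sphQEnergy u = sphQEnergy u' :=
  le_antisymm
    (le_iInf₂ fun φ hφ => iInf₂_le (f := fun (φ : Fin N → USphere N → ℝ) (_ : IsSphQW12 u φ) =>
      ∫⁻ x, ∑ j, ‖φ j x‖ₑ ^ 2 ∂(sphMeas N)) φ (hφ.congr hu.symm))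
    (le_iInf₂ fun φ hφ => iInf₂_le (f := fun (φ : Fin N → USphere N → ℝ) (_ : IsSphQW12 u' φ) =>
      ∫⁻ x, ∑ j, ‖φ j x‖ₑ ^ 2 ∂(sphMeas N)) φ (hφ.congr hu))

theorem qSeminormSq_congr {s : ℝ} {u u' : USphere N → AQ Q n} (hu : u =ᵐ[sphMeas N] u') :
    qSeminormSq s u = qSeminormSq s u' := by
  unfold qSeminormSq
  rw [gagliardoSq_congr hu, sphQEnergy_congr hu]

end Congr

/-! ### The choice of the radius, and the theorem -/

section Main

variable {N : ℕ} {Y : Type} [PseudoMetricSpace Y]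

theorem sphDistSq_le_two_mul {u v : USphere N → Y} (hu : StronglyMeasurable u) (y : Y) :
    sphDistSq u v ≤ 2 * (sphDistSq u (fun _ => y) + sphDistSq v (fun _ => y)) := by
  have hm : Measurable fun x => edist (u x) y ^ 2 :=
    (hu.edist stronglyMeasurable_const).measurable.pow_const 2
  unfold sphDistSq
  rw [← lintegral_add_left hm, ← lintegral_const_mul' _ _ ENNReal.ofNat_ne_top]
  refine lintegral_mono fun x => (edist_sq_le_two_mul _ y _).trans_eq ?_
  simp only
  rw [edist_comm y]

/-- Interpolation with small energy, for a semi-norm which controls the Whitney energy of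
homogeneous maps with a factor which tends to zero with the width of the annulus. -/
theorem exists_small_annulus_interpolation [Nonempty Y] (hY : ConeContractible Y) (hN : 0 < N)
    (S : (USphere N → Y) → ℝ≥0∞) {a : ℝ≥0∞} (ha : a ≠ ∞) {b : ℝ → ℝ}
    (hb : Tendsto b (nhdsWithin 1 (Iio 1)) (nhds 0))
    (hS : ∀ R : ℝ, 1 / 2 ≤ R → R < 1 → ∀ u : USphere N → Y, StronglyMeasurable u →
      whitneyEnergy (fun x => u (sphProj hN x)) (annDist N R) ≤ a * ENNReal.ofReal (b R) * S u)
    {ε : ℝ} (hε : 0 < ε) :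
    ∃ Rε : ℝ, 0 < Rε ∧ Rε < 1 ∧ ∀ R : ℝ, Rε ≤ R → R < 1 → ∃ C : ℝ, 0 ≤ C ∧
      ∀ u v : USphere N → Y, StronglyMeasurable u → StronglyMeasurable v → ∀ y₀ : Y,
        sphDistSq u (fun _ => y₀) < ∞ → sphDistSq v (fun _ => y₀) < ∞ → S u < ∞ → S v < ∞ →
        ∃ (w : Euc N → Y) (Φ : Euc N → ℝ),
          AEStronglyMeasurable w (volume.restrict (annulus N R)) ∧
          MemLp Φ 2 (volume.restrict (annulus N R)) ∧
          ∫⁻ x in annulus N R, ∑ _j : Fin N, ‖Φ x‖ₑ ^ 2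
            ≤ ENNReal.ofReal ε * (S u + S v) + ENNReal.ofReal C * sphDistSq u v ∧
          ∀ ψ : Y → ℝ, LipschitzWith 1 ψ → MemLp (fun ω => ψ (u ω)) 2 (sphMeas N) →
            MemLp (fun ω => ψ (v ω)) 2 (sphMeas N) → ∃ g : Fin N → Euc N → ℝ,
              IsW12 (annulus N R) (fun x => ψ (w x)) g ∧
              HasTraces R (fun x => ψ (w x)) g (fun ω => ψ (u ω)) (fun ω => ψ (v ω)) ∧
              ∀ j, ∀ x ∈ annulus N R, |g j x| ≤ Φ x := by
  obtain ⟨C₀, hC₀, hint⟩ := exists_annulus_interpolation hY hN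
  have hA : C₀ * 2 * a ≠ ∞ := by finiteness
  have hlim : Tendsto (fun R => (C₀ * 2 * a).toReal * b R) (nhdsWithin 1 (Iio 1)) (nhds 0) := by
    simpa using hb.const_mul (C₀ * 2 * a).toReal
  -- On some interval (l,1) the coefficient of the semi-norms is at most ε. The radius (l+1)/2 lies
  -- inside it, and the maximum with 1/2 is required by the energy bounds for homogeneous maps.
  obtain ⟨l, hl, hlI⟩ := (mem_nhdsLT_iff_exists_Ioo_subset).1 (hlim.eventually (ge_mem_nhds hε))
  have hl' : l < 1 := hl
  refine ⟨max (1 / 2) ((l + 1) / 2), by positivity, by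
    rw [max_lt_iff]; constructor <;> linarith, fun R hRε hR1 => ?_⟩
  have hR2 : 1 / 2 ≤ R := (le_max_left _ _).trans hRε
  have hRl : l < R := by linarith [(le_max_right (1 / 2) ((l + 1) / 2)).trans hRε]
  have hR0 : 0 < R := by linarith
  have hbR : (C₀ * 2 * a).toReal * b R ≤ ε := hlI ⟨hRl, hR1⟩
  have hbR' : C₀ * 2 * (a * ENNReal.ofReal (b R)) ≤ ENNReal.ofReal ε := by
    rw [← mul_assoc, ← ENNReal.ofReal_toReal hA, ← ENNReal.ofReal_mul ENNReal.toReal_nonneg]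
    exact ENNReal.ofReal_le_ofReal hbR
  set κ : ℝ≥0∞ := 2 * ENNReal.ofReal (10 / (1 - R)) ^ (N + 2) *
    volume (Metric.ball (0 : Euc N) 1) with hκ
  have hball := (measure_ball_lt_top (μ := (volume : Measure (Euc N))) (x := 0) (r := 1)).ne
  have hκf : C₀ * κ ≠ ∞ := by rw [hκ]; finiteness
  -- C comes from the jump term alone.
  refine ⟨(C₀ * κ).toReal, ENNReal.toReal_nonneg, fun u v hu hv y₀ hu0 hv0 hSu hSv => ?_⟩
  have huv : sphDistSq u v < ∞ := (sphDistSq_le_two_mul hu y₀).trans_lt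
    (ENNReal.mul_lt_top ENNReal.ofNat_lt_top (ENNReal.add_lt_top.2 ⟨hu0, hv0⟩))
  have hEle : whitneyEnergy (annMap hN R u v) (annDist N R)
      ≤ 2 * (a * ENNReal.ofReal (b R)) * (S u + S v) + κ * sphDistSq u v := by
    refine (whitneyEnergy_annMap_le hN hR0.le hR1 hu hv).trans (add_le_add ?_ le_rfl)
    rw [mul_add, mul_assoc 2 _ (S u), mul_assoc 2 _ (S v)]
    exact add_le_add (mul_le_mul' le_rfl (hS R hR2 hR1 u hu))
      (mul_le_mul' le_rfl (hS R hR2 hR1 v hv))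
  have hκf' : κ ≠ ∞ := by rw [hκ]; finiteness
  have hE : whitneyEnergy (annMap hN R u v) (annDist N R) < ∞ := by
    refine hEle.trans_lt (ENNReal.add_lt_top.2 ⟨ENNReal.mul_lt_top (by finiteness)
      (ENNReal.add_lt_top.2 ⟨hSu, hSv⟩), ENNReal.mul_lt_top hκf'.lt_top huv⟩)
  obtain ⟨w, Φ, hw, hΦ, hΦE, hψ⟩ := hint R hR0 hR1 u v hu hv y₀ hu0 hv0 hE
  refine ⟨w, Φ, hw, hΦ, hΦE.trans ((mul_le_mul' le_rfl hEle).trans ?_), hψ⟩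
  rw [mul_add, ← mul_assoc, ← mul_assoc, ← mul_assoc C₀ κ, ENNReal.ofReal_toReal hκf]
  exact add_le_add (mul_le_mul' (by rwa [mul_assoc] at hbR' ⊢) le_rfl) le_rfl

theorem tendsto_rpow_width {s : ℝ} (hs : 1 / 2 < s) :
    Tendsto (fun R : ℝ => 2 * (1 - R) ^ (2 * s - 1) / (2 * s - 1)) (nhdsWithin 1 (Iio 1))
      (nhds 0) := by
  have hc : Continuous fun R : ℝ => 2 * (1 - R) ^ (2 * s - 1) / (2 * s - 1) := by
    refine (continuous_const.mul ?_).div_const _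
    exact (continuous_const.sub continuous_id).rpow_const fun _ => Or.inr (by linarith)
  have h := hc.tendsto 1
  rw [sub_self, Real.zero_rpow (by linarith), mul_zero, zero_div] at h
  exact h.mono_left nhdsWithin_le_nhds

theorem lintegral_sum_sq_le {g : Fin N → Euc N → ℝ} {Φ : Euc N → ℝ} {A : Set (Euc N)}
    (hA : MeasurableSet A) (h : ∀ j, ∀ x ∈ A, |g j x| ≤ Φ x) :
    ∫⁻ x in A, ∑ j, ‖g j x‖ₑ ^ 2 ≤ ∫⁻ x in A, ∑ _j : Fin N, ‖Φ x‖ₑ ^ 2 := by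
  refine setLIntegral_mono' hA fun x hx => Finset.sum_le_sum fun j _ => ?_
  refine pow_le_pow_left' ?_ 2
  rw [← ofReal_norm, ← ofReal_norm]
  exact ENNReal.ofReal_le_ofReal ((h j x hx).trans (le_abs_self _))

/-- The sphere has finite measure, so the constant T is at finite L² distance from the tuple Q⟦0⟧,
and so is u. -/
theorem memLp_dist {Q n : ℕ} {u : USphere N → AQ Q n} (hu : StronglyMeasurable u)
    (h : sphDistSq u (fun _ => AQ.zero Q n) < ∞) (T : AQ Q n) :
    MemLp (fun ω => dist (u ω) T) 2 (sphMeas N) := by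
  refine memLp_two_of_lintegral_sq (hu.dist stronglyMeasurable_const).aestronglyMeasurable ?_
  have h1 := sphDistSq_le_two_mul (v := fun _ => T) hu (AQ.zero Q n)
  have h2 : sphDistSq (N := N) (fun _ => T) (fun _ => AQ.zero Q n) < ∞ := by
    rw [sphDistSq, lintegral_const]
    exact ENNReal.mul_lt_top (ENNReal.pow_lt_top (edist_lt_top _ _)) (measure_lt_top _ _)
  refine lt_of_le_of_lt (le_of_eq ?_) (h1.trans_lt
    (ENNReal.mul_lt_top ENNReal.ofNat_lt_top (ENNReal.add_lt_top.2 ⟨h, h2⟩)))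
  refine lintegral_congr fun ω => ?_
  rw [Real.enorm_of_nonneg dist_nonneg, ← edist_dist]

end Main

theorem mainTheorem11 :
    (∀ (N : ℕ), 2 ≤ N → ∀ (s : ℝ), 1 / 2 < s → s < 1 → ∀ (ε : ℝ), 0 < ε →
      ∃ Rε : ℝ, 0 < Rε ∧ Rε < 1 ∧ ∀ (R : ℝ), Rε ≤ R → R < 1 →
        ∃ C : ℝ, 0 ≤ C ∧ ∀ (u v : USphere N → ℝ), MemWs s u → MemWs s v →
          ∃ (w : Euc N → ℝ) (g : Fin N → Euc N → ℝ),
            IsW12 (annulus N R) w g ∧ HasTraces R w g u v ∧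
            ∫⁻ x in annulus N R, ∑ j, ‖g j x‖ₑ ^ 2
              ≤ ENNReal.ofReal ε * (gagliardoSq s u + gagliardoSq s v)
                + ENNReal.ofReal C * sphDistSq u v) ∧
    (∀ (N Q n : ℕ), 2 ≤ N → ∀ (s : ℝ), 1 / 2 < s → s ≤ 1 → ∀ (ε : ℝ), 0 < ε →
      ∃ Rε : ℝ, 0 < Rε ∧ Rε < 1 ∧ ∀ (R : ℝ), Rε ≤ R → R < 1 →
        ∃ C : ℝ, 0 ≤ C ∧ ∀ (u v : USphere N → AQ Q n), MemQWs s u → MemQWs s v →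
          ∃ w : Euc N → AQ Q n,
            MemQW12 (annulus N R) w ∧ HasQTraces R w u v ∧
            qEnergy (annulus N R) w
              ≤ ENNReal.ofReal ε * (qSeminormSq s u + qSeminormSq s v)
                + ENNReal.ofReal C * sphDistSq u v) := by
  constructor
  · intro N hN s hs hs1 ε hε
    have hN0 : 0 < N := by omega
    obtain ⟨Rε, hRε0, hRε1, hmain⟩ := exists_small_annulus_interpolation coneContractible_real hN0
      (gagliardoSq s) ENNReal.ofReal_ne_top (tendsto_rpow_width hs)
      (fun R hR hR1 u hu => whitneyEnergy_le_gagliardoSq hN0 hs hR hR1 hu) hε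
    refine ⟨Rε, hRε0, hRε1, fun R hR hR1 => ?_⟩
    obtain ⟨C, hC, hmain⟩ := hmain R hR hR1
    refine ⟨C, hC, fun u v hu hv => ?_⟩
    -- The construction evaluates the maps pointwise and needs strongly measurable representatives;
    -- traces, semi-norms and L² distances do not see the change.
    have hu' := hu.1.1.ae_eq_mk
    have hv' := hv.1.1.ae_eq_mk
    have hfin : ∀ {f : USphere N → ℝ}, MemLp f 2 (sphMeas N) → sphDistSq f (fun _ => 0) < ∞ :=
      fun hf => by simpa [sphDistSq, edist_eq_enorm_sub] using lintegral_sq_lt_top_of_memLp_two hf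
    obtain ⟨w, Φ, -, -, hE, hψ⟩ := hmain _ _ hu.1.1.stronglyMeasurable_mk
      hv.1.1.stronglyMeasurable_mk 0 (hfin (hu.1.ae_eq hu')) (hfin (hv.1.ae_eq hv'))
      ((gagliardoSq_congr hu').symm.trans_lt hu.2) ((gagliardoSq_congr hv').symm.trans_lt hv.2)
    obtain ⟨g, hg, htr, hgΦ⟩ := hψ id LipschitzWith.id (hu.1.ae_eq hu') (hv.1.ae_eq hv')
    refine ⟨w, g, hg, htr.congr hu'.symm hv'.symm,
      (lintegral_sum_sq_le isOpen_annulus.measurableSet hgΦ).trans ?_⟩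
    rwa [← gagliardoSq_congr hu', ← gagliardoSq_congr hv', ← sphDistSq_congr hu' hv'] at hE
  · intro N Q n hN s hs hs1 ε hε
    have hN0 : 0 < N := by omega
    have : Nonempty (AQ Q n) := ⟨AQ.zero Q n⟩
    -- The cases s < 1 and s = 1 differ only in this bound for homogeneous maps: the factor is of
    -- order (1-R)^(2s-1) in the first and 1 - R in the second.
    have hsmall : ∃ (a : ℝ≥0∞) (b : ℝ → ℝ), a ≠ ∞ ∧
        Tendsto b (nhdsWithin 1 (Iio 1)) (nhds 0) ∧ ∀ R : ℝ, 1 / 2 ≤ R → R < 1 →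
        ∀ u : USphere N → AQ Q n, StronglyMeasurable u →
        whitneyEnergy (fun x => u (sphProj hN0 x)) (annDist N R)
          ≤ a * ENNReal.ofReal (b R) * qSeminormSq s u := by
      by_cases h : s < 1
      · refine ⟨ENNReal.ofReal (2 * 3 ^ ((N : ℝ) - 1 + 2 * s)), _, ENNReal.ofReal_ne_top, tendsto_rpow_width hs, fun R hR hR1 u hu => ?_⟩
        rw [qSeminormSq, if_pos h]
        exact whitneyEnergy_le_gagliardoSq hN0 hs hR hR1 hu
      · refine ⟨ENNReal.ofReal (10 / 3) ^ N * volume (Metric.ball (0 : Euc N) 1) * (4 * N),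
          fun R => 1 - R, ?_, ?_, fun R hR hR1 u hu => ?_⟩
        · have := (measure_ball_lt_top (μ := (volume : Measure (Euc N))) (x := 0) (r := 1)).ne
          finiteness
        · have h1 : Tendsto (fun R : ℝ => 1 - R) (nhds 1) (nhds (1 - 1)) :=
            (continuous_const.sub continuous_id).tendsto 1
          rw [sub_self] at h1
          exact h1.mono_left nhdsWithin_le_nhds
        · rw [qSeminormSq, if_neg h]
          exact whitneyEnergy_le_sphQEnergy hN0 hR hR1 hu
    obtain ⟨a, b, ha, hb, hS⟩ := hsmall
    obtain ⟨Rε, hRε0, hRε1, hmain⟩ := exists_small_annulus_interpolation (AQ.coneContractible Q n)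
      hN0 (qSeminormSq s) ha hb hS hε
    refine ⟨Rε, hRε0, hRε1, fun R hR hR1 => ?_⟩
    obtain ⟨C, hC, hmain⟩ := hmain R hR hR1
    refine ⟨C, hC, fun u v hu hv => ?_⟩
    have hu' := hu.1.ae_eq_mk
    have hv' := hv.1.ae_eq_mk
    have hu0 := (sphDistSq_congr hu' (ae_eq_refl fun _ => AQ.zero Q n)).symm.trans_lt hu.2.1
    have hv0 := (sphDistSq_congr hv' (ae_eq_refl fun _ => AQ.zero Q n)).symm.trans_lt hv.2.1
    obtain ⟨w, Φ, hw, hΦ, hE, hψ⟩ := hmain _ _ hu.1.stronglyMeasurable_mk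
      hv.1.stronglyMeasurable_mk (AQ.zero Q n) hu0 hv0
      ((qSeminormSq_congr hu').symm.trans_lt hu.2.2) ((qSeminormSq_congr hv').symm.trans_lt hv.2.2)
    have hT := fun T : AQ Q n => hψ (fun y => dist y T) (LipschitzWith.dist_left T)
      (memLp_dist hu.1.stronglyMeasurable_mk hu0 T) (memLp_dist hv.1.stronglyMeasurable_mk hv0 T)
    -- The same Φ bounds the derivatives of G(w,T) for all T, so it is admissible in the definition
    -- of the energy, whose infimum it bounds from above.
    have hQ : IsQW12 (annulus N R) w (fun _ => Φ) := by
      refine ⟨hw, fun _ => hΦ, fun T => ?_⟩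
      obtain ⟨g, hg, -, hgΦ⟩ := hT T
      refine ⟨g, hg, fun j => ?_⟩
      filter_upwards [ae_restrict_mem isOpen_annulus.measurableSet] with x hx using hgΦ j x hx
    refine ⟨w, ⟨_, hQ⟩, fun T => ?_, (iInf₂_le _ hQ).trans ?_⟩
    · obtain ⟨g, hg, htr, -⟩ := hT T
      refine ⟨g, hg, htr.congr ?_ ?_⟩
      · filter_upwards [hu'] with x hx
        rw [hx]
      · filter_upwards [hv'] with x hx
        rw [hx]
    · rwa [← qSeminormSq_congr hu', ← qSeminormSq_congr hv', ← sphDistSq_congr hu' hv'] at hE
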